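/- **Lemma 5.1 (Quantum matrix-vector product verification).** Conventions: let $p$ be a prime, $\mathbb F=\mathbb F_p=\{0,\dots,p-1\}$, $n\ge 1$, $[n]=\{0,\dots,n-1\}$ and $\varepsilon\in(0,1)$. An index $j\in[n]$ is stored in binary on $\lceil\log_2 n\rceil$ qubits and an element $z\in\mathbb F$ in binary on $\lceil\log_2 p\rceil$ qubits. For a matrix $M\in\mathbb F^{n\times n}$ and a vector $u\in\mathbb F^n$, quantum oracles $U_M$ and $U_u$ are any unitaries such that $$U_M|j,k,z\rangle=|j,k,z+M_{jk}\rangle,\qquad U_u|j,z\rangle=|j,z+u_j\rangle\qquad(j,k\in[n],\ z\in\mathbb F),$$ with addition in $\mathbb F$ (their action on basis states that encode no such triple or pair is unconstrained). A unitary query algorithm is a circuit of arbitrary one-qubit and two-qubit gates and of queries to $U_M,U_v,U_b$ and their adjoints that starts in $|0\cdots0\rangle$; at the end one output qubit is measured, and the algorithm accepts on outcome $1$ and rejects on outcome $0$. Statement: there are absolute constants $K$ and $c$ such that for all $n,p,\varepsilon$ as above there is a unitary query algorithm $\mathsf{Q_{verify}}$, depending only on $n,p,\varepsilon$, such that for all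 $M\in\mathbb F^{n\times n}$, all $v,b\in\mathbb F^n$ and all quantum oracles $U_M,U_v,U_b$ for them, - if $Mv=b$, it accepts with probability $1$; - if $Mv\ne b$, it rejects with probability at least $1-\varepsilon$. Moreover, $\mathsf{Q_{verify}}$ uses - $q\le K\,n^{3/2}\log(2/\varepsilon)$ queries to $U_M$ and $U_M^\dagger$; - at most $K\,n$ queries to $U_v$, $U_b$ and their adjoints in total; - at most $K\,q\,\log(2n)\,(\log p)^{c}$ additional one-qubit and two-qubit gates; - at most $K\,n\log p$ qubits in total (all of them ancillary, including the output qubit). -/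

import Mathlib

open scoped Matrix

noncomputable section

namespace QMvPV

/-- Classical states of a register whose qubits are labelled by `ι`.
They label the computational basis of its state space `(ι → Bool) → ℂ`. -/
abbrev Bits (ι : Type) : Type := ι → Bool

/-- Unitary operators on a register of qubits labelled by `ι`, as matrices in the computational
basis (the entry at `x`, `y` is `⟨x| U |y⟩`). -/
abbrev Unitary (ι : Type) [Fintype ι] [DecidableEq ι] : Type :=
  Matrix.unitaryGroup (Bits ι) ℂ

/-- The computational basis state `|x⟩`. -/
def ket {ι : Type} [DecidableEq ι] [Fintype ι] (x : Bits ι) : Bits ι → ℂ := Pi.single x 1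

/-- Number of qubits `⌈log₂ m⌉` of a register that stores an element of `{0, …, m - 1}`. -/
abbrev width (m : ℕ) : ℕ := Nat.clog 2 m

/-- Binary representation of `a` on `w` bits (bit `i` has weight `2 ^ i`). -/
def binary (w a : ℕ) : Bits (Fin w) := fun i => a.testBit i

/-- Qubit labels of the register `|j, k, z⟩` on which the matrix oracle acts:
two index registers and a register for an element of `ZMod p`. -/
abbrev MatReg (n p : ℕ) : Type := Fin (width n) ⊕ Fin (width n) ⊕ Fin (width p)

/-- Qubit labels of the register `|j, z⟩` on which a vector oracle acts. -/
abbrev VecReg (n p : ℕ) : Type := Fin (width n) ⊕ Fin (width p)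

/-- The classical state `j, k, z`. -/
def matCode {n p : ℕ} (j k : Fin n) (z : ZMod p) : Bits (MatReg n p) :=
  Sum.elim (binary (width n) j) (Sum.elim (binary (width n) k) (binary (width p) z.val))

/-- The classical state `j, z`. -/
def vecCode {n p : ℕ} (j : Fin n) (z : ZMod p) : Bits (VecReg n p) :=
  Sum.elim (binary (width n) j) (binary (width p) z.val)

/-- `U` is an oracle for the matrix `M`: `U |j, k, z⟩ = |j, k, z + M j k⟩`.
Nothing is said about basis states that do not encode a triple `(j, k, z)`. -/
def IsMatOracle {n p : ℕ} (M : Matrix (Fin n) (Fin n) (ZMod p))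
    (U : Unitary (MatReg n p)) : Prop :=
  ∀ (j k : Fin n) (z : ZMod p),
    U.val *ᵥ ket (matCode j k z) = ket (matCode j k (z + M j k))

/-- `U` is an oracle for the vector `v`: `U |j, z⟩ = |j, z + v j⟩`.
Nothing is said about basis states that do not encode a pair `(j, z)`. -/
def IsVecOracle {n p : ℕ} (v : Fin n → ZMod p) (U : Unitary (VecReg n p)) : Prop :=
  ∀ (j : Fin n) (z : ZMod p), U.val *ᵥ ket (vecCode j z) = ket (vecCode j (z + v j))

/-- The operator on `N` qubits that applies `U` to the qubits selected by `e`
(qubit `i` of `U` is placed at position `e i`) and the identity to all the others. -/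
def applyAt {ι : Type} [Fintype ι] [DecidableEq ι] {N : ℕ} (e : ι ↪ Fin N)
    (U : Matrix (Bits ι) (Bits ι) ℂ) : Matrix (Bits (Fin N)) (Bits (Fin N)) ℂ :=
  Matrix.of fun x y => if ∀ i, (∀ a, e a ≠ i) → x i = y i then U (x ∘ e) (y ∘ e) else 0

/-- One step of a quantum query circuit on `N` qubits: an arbitrary one-qubit or two-qubit gate,
or a query to one of the oracles `U_M`, `U_v`, `U_b`, or, if `inv = true`, to its adjoint. -/
inductive Step (n p N : ℕ) : Type
  | gate₁ (e : Fin 1 ↪ Fin N) (G : Unitary (Fin 1))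
  | gate₂ (e : Fin 2 ↪ Fin N) (G : Unitary (Fin 2))
  | queryM (inv : Bool) (e : MatReg n p ↪ Fin N)
  | queryV (inv : Bool) (e : VecReg n p ↪ Fin N)
  | queryB (inv : Bool) (e : VecReg n p ↪ Fin N)

/-- `U` or its adjoint. -/
def orAdjoint {ι : Type} [Fintype ι] [DecidableEq ι] (inv : Bool) (U : Unitary ι) :
    Matrix (Bits ι) (Bits ι) ℂ :=
  if inv then U.valᴴ else U.val

/-- The operator on the `N` qubits that a step performs when the oracles are `UM`, `Uv`, `Ub`. -/
def Step.op {n p N : ℕ} (UM : Unitary (MatReg n p)) (Uv Ub : Unitary (VecReg n p)) :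
    Step n p N → Matrix (Bits (Fin N)) (Bits (Fin N)) ℂ
  | .gate₁ e G => applyAt e G.val
  | .gate₂ e G => applyAt e G.val
  | .queryM inv e => applyAt e (orAdjoint inv UM)
  | .queryV inv e => applyAt e (orAdjoint inv Uv)
  | .queryB inv e => applyAt e (orAdjoint inv Ub)

def Step.isGate {n p N : ℕ} : Step n p N → Bool
  | .gate₁ _ _ => true
  | .gate₂ _ _ => true
  | _ => false

def Step.isQueryM {n p N : ℕ} : Step n p N → Bool
  | .queryM _ _ => true
  | _ => false

def Step.isQueryV {n p N : ℕ} : Step n p N → Bool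
  | .queryV _ _ => true
  | _ => false

def Step.isQueryB {n p N : ℕ} : Step n p N → Bool
  | .queryB _ _ => true
  | _ => false

/-- A unitary quantum query algorithm with access to an `n × n` matrix and two vectors of length
`n` over `ZMod p`: a circuit on `qubits` qubits (all of them ancillary, the output qubit included),
which is run on the all-zeros state, and whose qubit `out` is measured at the end. -/
structure QueryAlgorithm (n p : ℕ) : Type where
  qubits : ℕ
  out : Fin qubits
  steps : List (Step n p qubits)

namespace QueryAlgorithm

variable {n p : ℕ}

/-- The final state: the steps are applied in order to `|0⋯0⟩`. -/
def finalState (A : QueryAlgorithm n p) (UM : Unitary (MatReg n p))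
    (Uv Ub : Unitary (VecReg n p)) : Bits (Fin A.qubits) → ℂ :=
  A.steps.foldl (fun ψ s => s.op UM Uv Ub *ᵥ ψ) (ket fun _ => false)

/-- Probability that measuring the output qubit of the final state gives the bit `c`. -/
def prob (A : QueryAlgorithm n p) (UM : Unitary (MatReg n p)) (Uv Ub : Unitary (VecReg n p))
    (c : Bool) : ℝ :=
  ∑ x : Bits (Fin A.qubits), if x A.out = c then ‖A.finalState UM Uv Ub x‖ ^ 2 else 0

/-- The algorithm accepts when the outcome of the measurement is `1`. -/
def acceptProb (A : QueryAlgorithm n p) (UM : Unitary (MatReg n p))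
    (Uv Ub : Unitary (VecReg n p)) : ℝ :=
  A.prob UM Uv Ub true

/-- The algorithm rejects when the outcome of the measurement is `0`. -/
def rejectProb (A : QueryAlgorithm n p) (UM : Unitary (MatReg n p))
    (Uv Ub : Unitary (VecReg n p)) : ℝ :=
  A.prob UM Uv Ub false

/-- Number of one-qubit and two-qubit gates. -/
def gates (A : QueryAlgorithm n p) : ℕ := A.steps.countP Step.isGate

/-- Number of queries to `U_M` and its adjoint. -/
def queriesM (A : QueryAlgorithm n p) : ℕ := A.steps.countP Step.isQueryM

/-- Number of queries to `U_v` and its adjoint. -/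
def queriesV (A : QueryAlgorithm n p) : ℕ := A.steps.countP Step.isQueryV

/-- Number of queries to `U_b` and its adjoint. -/
def queriesB (A : QueryAlgorithm n p) : ℕ := A.steps.countP Step.isQueryB

end QueryAlgorithm

end QMvPV

end

/-! Let `d_j` be an integer representing the entry `j` of `M v - b`, and let `w = ⌈log₂ p⌉`. Once
`v` and `b` have been copied into qubits with `n` queries each, a circuit with `2 n` queries to the
matrix oracle multiplies `|j, y⟩` by `exp (2 π i y d_j / p)`, where `y` is a `w`-bit number. Only
the residue of the exponent modulo `p` matters, so the products can be taken over the integers and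
no modular arithmetic is computed.

Let `s` be the initial basis state, let `V` spread `s` uniformly over all `(j, y)` and apply these
phases, and let `X` flip every bit of `y`. Then `R = V⁻¹ X V` is a reflection, and summing bit by
bit gives `⟨s, R s⟩ = (1 / n) ∑_j ∏_{i < w} cos (2 ^ i * 2 π d_j / p)` (`sum_phase_prod`,
`exists_grover`). A row with `p ∣ d_j` contributes exactly `1`, any other row at most `3 / 4`
(`prod_cos_le`). Hence the overlap is `1` if `M v = b` and at most `1 - 1 / (4 n)` otherwise.

Write the overlap as `cos α`. The Grover operator `G = (2 |s⟩⟨s| - 1) R` satisfies `G s + G⁻¹ s = 2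
cos α • s` (`grover_add_symm`), so `s` is built from eigenvectors with eigenvalues `exp (± i α)`.
Hadamard tests of `G ^ (2 ^ i)` for `i < ℓ` leave all their flags at `0` with probability `∏ cos² (2
^ i α / 2)` (`norm_foldl_half_add_sq`). This is `1` for `α = 0`. Otherwise `α² ≥ 1 / (2 n)`, and
with `2 ^ ℓ` of order `√n` some angle falls in `(π / 4, π / 2]`, so the probability is at most `1 /
2` (`prod_cos_sq_le`, `clearProb_le`). A Grover operator costs `4 n` queries, the tests together
order `n ^ (3 / 2)`.

Finally `π / 3` fixed-point search triples the circuit and cubes this probability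
(`fixed_point_step`). The value `1` stays `1`, which keeps acceptance certain, and a value at most
`1 / 2` drops to at most `ε` once `3 ^ k` is of order `log (2 / ε)`. The rounds reuse the same
qubits, so the number of qubits does not depend on `ε`. The output bit records whether all flags are
clear. -/

noncomputable section

namespace QMvPV

set_option linter.unusedSectionVars false

/-! ### Operators on a register with arbitrary qubit labels -/

section Place

variable {ι κ : Type} [Fintype ι] [DecidableEq ι] [Fintype κ] [DecidableEq κ]

open Classical in
/-- Overwrite the bits of `x` at the positions `e` by `u`. -/
def put (e : κ ↪ ι) (u : Bits κ) (x : Bits ι) : Bits ι :=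
  fun i => if h : ∃ a, e a = i then u h.choose else x i

@[simp] lemma put_apply (e : κ ↪ ι) (u : Bits κ) (x : Bits ι) (a : κ) : put e u x (e a) = u a := by
  have h : ∃ a', e a' = e a := ⟨a, rfl⟩
  rw [put, dif_pos h, e.injective h.choose_spec]

lemma put_of_notMem (e : κ ↪ ι) (u : Bits κ) (x : Bits ι) {i : ι} (h : ∀ a, e a ≠ i) :
    put e u x i = x i := by
  rw [put, dif_neg (by push Not; exact h)]

@[simp] lemma put_comp (e : κ ↪ ι) (u : Bits κ) (x : Bits ι) : put e u x ∘ e = u := by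
  ext a; simp

/-- The first condition is the one under which an entry of `place` may be nonzero; the second
selects the only `u` that contributes to it. -/
lemma eq_put_iff (e : κ ↪ ι) (u : Bits κ) (x z : Bits ι) :
    z = put e u x ↔ (∀ i, (∀ a, e a ≠ i) → z i = x i) ∧ u = z ∘ e := by
  constructor
  · rintro rfl
    exact ⟨fun i hi => put_of_notMem e u x hi, (put_comp e u x).symm⟩
  · rintro ⟨h, rfl⟩
    ext i
    by_cases hi : ∃ a, e a = i
    · obtain ⟨a, rfl⟩ := hi
      simp
    · push Not at hi
      rw [put_of_notMem e _ x hi, h i hi]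

@[simp] lemma put_put (e : κ ↪ ι) (u v : Bits κ) (x : Bits ι) :
    put e u (put e v x) = put e u x := by
  rw [eq_put_iff]
  exact ⟨fun i hi => by rw [put_of_notMem _ _ _ hi, put_of_notMem _ _ _ hi], by simp⟩

/-- The operator that applies `U` to the qubits selected by `e`. -/
def place (e : κ ↪ ι) (U : Matrix (Bits κ) (Bits κ) ℂ) : Matrix (Bits ι) (Bits ι) ℂ :=
  Matrix.of fun x y => if ∀ i, (∀ a, e a ≠ i) → x i = y i then U (x ∘ e) (y ∘ e) else 0

lemma mulVec_ket {ι : Type} [Fintype ι] [DecidableEq ι] (A : Matrix (Bits ι) (Bits ι) ℂ)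
    (x z : Bits ι) : (A *ᵥ ket x) z = A z x := by
  simp [ket]

lemma ket_apply (x z : Bits ι) : ket x z = if z = x then 1 else 0 := by
  simp [ket, Pi.single_apply]

lemma place_mulVec_ket (e : κ ↪ ι) (U : Matrix (Bits κ) (Bits κ) ℂ) (x : Bits ι) :
    place e U *ᵥ ket x = ∑ u, U u (x ∘ e) • ket (put e u x) := by
  ext z
  rw [mulVec_ket, Finset.sum_apply]
  simp only [Pi.smul_apply, ket_apply, eq_put_iff, smul_eq_mul, place, Matrix.of_apply]
  by_cases h : ∀ i, (∀ a, e a ≠ i) → z i = x i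
  · rw [if_pos h, Finset.sum_eq_single (z ∘ e)]
    · rw [if_pos ⟨h, rfl⟩, mul_one]
    · intro u _ hu
      rw [if_neg fun h' => hu h'.2, mul_zero]
    · simp
  · rw [if_neg h]
    exact (Finset.sum_eq_zero fun u _ => by rw [if_neg fun h' => h h'.1, mul_zero]).symm

lemma place_mulVec_ket_of {e : κ ↪ ι} {U : Matrix (Bits κ) (Bits κ) ℂ} {x : Bits ι} {u : Bits κ}
    (h : U *ᵥ ket (x ∘ e) = ket u) : place e U *ᵥ ket x = ket (put e u x) := by
  have h' : ∀ v, U v (x ∘ e) = if v = u then 1 else 0 := fun v => by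
    exact (mulVec_ket U _ v).symm.trans (by rw [h, ket_apply])
  simp [place_mulVec_ket, h']

lemma matrix_ext_ket {A B : Matrix (Bits ι) (Bits ι) ℂ} (h : ∀ x, A *ᵥ ket x = B *ᵥ ket x) :
    A = B := by
  ext z x
  exact (mulVec_ket A x z).symm.trans (by rw [h, mulVec_ket])

lemma place_mul (e : κ ↪ ι) (U V : Matrix (Bits κ) (Bits κ) ℂ) :
    place e (U * V) = place e U * place e V := by
  refine matrix_ext_ket fun x => ?_
  rw [← Matrix.mulVec_mulVec, place_mulVec_ket, place_mulVec_ket, Matrix.mulVec_sum]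
  simp only [Matrix.mulVec_smul, place_mulVec_ket, put_comp, put_put, Matrix.mul_apply,
    Finset.sum_smul, Finset.smul_sum, smul_smul]
  rw [Finset.sum_comm]
  simp only [mul_comm]

lemma place_one (e : κ ↪ ι) : place e (1 : Matrix (Bits κ) (Bits κ) ℂ) = 1 := by
  refine matrix_ext_ket fun x => ?_
  rw [place_mulVec_ket_of (u := x ∘ e) (Matrix.one_mulVec _), Matrix.one_mulVec]
  congr 1
  exact ((eq_put_iff e _ x x).2 ⟨fun _ _ => rfl, rfl⟩).symm

lemma place_conjTranspose (e : κ ↪ ι) (U : Matrix (Bits κ) (Bits κ) ℂ) :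
    place e Uᴴ = (place e U)ᴴ := by
  ext x y
  simp only [place, Matrix.of_apply, Matrix.conjTranspose_apply]
  have : (∀ i, (∀ a, e a ≠ i) → x i = y i) ↔ (∀ i, (∀ a, e a ≠ i) → y i = x i) :=
    forall_congr' fun i => imp_congr_right fun _ => eq_comm
  simp only [this]
  split_ifs <;> simp

lemma place_trans {N : ℕ} (e : κ ↪ ι) (q : ι ≃ Fin N) (U : Matrix (Bits κ) (Bits κ) ℂ)
    (x y : Bits (Fin N)) :
    applyAt (e.trans q.toEmbedding) U x y = place e U (x ∘ q) (y ∘ q) := by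
  simp only [applyAt, place, Matrix.of_apply]
  have : (∀ i, (∀ a, (e.trans q.toEmbedding) a ≠ i) → x i = y i) ↔
      (∀ i, (∀ a, e a ≠ i) → (x ∘ q) i = (y ∘ q) i) := by
    constructor
    · intro h i hi
      exact h (q i) fun a ha => hi a (q.injective ha)
    · intro h i hi
      have := h (q.symm i) fun a ha => hi a (by simp [ha])
      simpa using this
  simp only [this]
  rfl

end Place

/-! ### Circuits -/

/-- The three oracles. -/
structure Oracles (n p : ℕ) : Type where
  UM : Unitary (MatReg n p)
  Uv : Unitary (VecReg n p)
  Ub : Unitary (VecReg n p)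

/-- A step of a query circuit whose qubits are labelled by `ι`. -/
inductive Op (n p : ℕ) (ι : Type) : Type
  | gate₁ (e : Fin 1 ↪ ι) (G : Unitary (Fin 1))
  | gate₂ (e : Fin 2 ↪ ι) (G : Unitary (Fin 2))
  | queryM (inv : Bool) (e : MatReg n p ↪ ι)
  | queryV (inv : Bool) (e : VecReg n p ↪ ι)
  | queryB (inv : Bool) (e : VecReg n p ↪ ι)

variable {n p : ℕ} {ι : Type}

/-- The same step on the qubits `0, …, N - 1`. -/
def Op.toStep {N : ℕ} (q : ι ≃ Fin N) : Op n p ι → Step n p N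
  | .gate₁ e G => .gate₁ (e.trans q.toEmbedding) G
  | .gate₂ e G => .gate₂ (e.trans q.toEmbedding) G
  | .queryM i e => .queryM i (e.trans q.toEmbedding)
  | .queryV i e => .queryV i (e.trans q.toEmbedding)
  | .queryB i e => .queryB i (e.trans q.toEmbedding)

/-- The inverse step. -/
def Op.inv : Op n p ι → Op n p ι
  | .gate₁ e G => .gate₁ e (star G)
  | .gate₂ e G => .gate₂ e (star G)
  | .queryM i e => .queryM (!i) e
  | .queryV i e => .queryV (!i) e
  | .queryB i e => .queryB (!i) e

/-- The inverse circuit. -/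
def invC (C : List (Op n p ι)) : List (Op n p ι) := (C.map Op.inv).reverse

/-- Compute with `C`, apply `D`, uncompute. -/
def conj (C D : List (Op n p ι)) : List (Op n p ι) := C ++ D ++ invC C

section Run

variable [Fintype ι] [DecidableEq ι]

/-- The operator of a step. -/
def Op.mat (O : Oracles n p) : Op n p ι → Matrix (Bits ι) (Bits ι) ℂ
  | .gate₁ e G => place e G.val
  | .gate₂ e G => place e G.val
  | .queryM i e => place e (orAdjoint i O.UM)
  | .queryV i e => place e (orAdjoint i O.Uv)
  | .queryB i e => place e (orAdjoint i O.Ub)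

lemma orAdjoint_not {κ : Type} [Fintype κ] [DecidableEq κ] (i : Bool) (U : Unitary κ) :
    orAdjoint (!i) U = (orAdjoint i U)ᴴ := by
  cases i <;> simp [orAdjoint]

lemma orAdjoint_unitary {κ : Type} [Fintype κ] [DecidableEq κ] (i : Bool) (U : Unitary κ) :
    (orAdjoint i U)ᴴ * orAdjoint i U = 1 := by
  cases i
  · exact Matrix.mem_unitaryGroup_iff'.1 U.2
  · simp only [orAdjoint, if_true, Matrix.conjTranspose_conjTranspose]
    exact Matrix.mem_unitaryGroup_iff.1 U.2

lemma Op.mat_inv (O : Oracles n p) (s : Op n p ι) : s.inv.mat O = (s.mat O)ᴴ := by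
  cases s <;> simp [Op.inv, Op.mat, ← place_conjTranspose, orAdjoint_not,
    Matrix.star_eq_conjTranspose]

lemma Op.mat_unitary (O : Oracles n p) (s : Op n p ι) : (s.mat O)ᴴ * s.mat O = 1 := by
  cases s with
  | gate₁ e G =>
    simp only [Op.mat, ← place_conjTranspose, ← place_mul]
    rw [← Matrix.star_eq_conjTranspose, Matrix.mem_unitaryGroup_iff'.1 G.2, place_one]
  | gate₂ e G =>
    simp only [Op.mat, ← place_conjTranspose, ← place_mul]
    rw [← Matrix.star_eq_conjTranspose, Matrix.mem_unitaryGroup_iff'.1 G.2, place_one]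
  | _ => simp only [Op.mat, ← place_conjTranspose, ← place_mul, orAdjoint_unitary, place_one]

/-- The operator of a circuit; the steps are applied in the order of the list. -/
def run (O : Oracles n p) : List (Op n p ι) → (Bits ι → ℂ) →ₗ[ℂ] (Bits ι → ℂ)
  | [] => LinearMap.id
  | s :: C => run O C ∘ₗ (s.mat O).mulVecLin

variable (O : Oracles n p)

@[simp] lemma run_nil (ψ : Bits ι → ℂ) : run O [] ψ = ψ := rfl

lemma run_cons (s : Op n p ι) (C : List (Op n p ι)) (ψ : Bits ι → ℂ) :
    run O (s :: C) ψ = run O C (s.mat O *ᵥ ψ) := rfl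

lemma run_append (C D : List (Op n p ι)) (ψ : Bits ι → ℂ) :
    run O (C ++ D) ψ = run O D (run O C ψ) := by
  induction C generalizing ψ with
  | nil => rfl
  | cons s C ih => simp [run_cons, ih]

lemma run_invC_run (C : List (Op n p ι)) (ψ : Bits ι → ℂ) :
    run O (invC C) (run O C ψ) = ψ := by
  induction C generalizing ψ with
  | nil => rfl
  | cons s C ih =>
    have : invC (s :: C) = invC C ++ [s.inv] := by simp [invC]
    rw [this, run_append, run_cons, run_cons O s C, ih, run_nil, Op.mat_inv, Matrix.mulVec_mulVec,
      Op.mat_unitary, Matrix.one_mulVec]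

/-- The inverse circuit never has to be evaluated: it suffices to recognise the state after `D` as
the image under `C` of some `χ`. -/
lemma run_conj {C D : List (Op n p ι)} {ψ χ : Bits ι → ℂ} (h : run O D (run O C ψ) = run O C χ) :
    run O (conj C D) ψ = χ := by
  rw [conj, run_append, run_append, h, run_invC_run]

lemma run_conj_smul {C D : List (Op n p ι)} {ψ ψ' : Bits ι → ℂ} {c : ℂ} (hC : run O C ψ = ψ')
    (h : run O D ψ' = c • ψ') : run O (conj C D) ψ = c • ψ :=
  run_conj O (by rw [hC, h, map_smul, hC])

/-- The squared norm of a vector of amplitudes. -/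
def normSq {α : Type} [Fintype α] (ψ : α → ℂ) : ℝ := ∑ x, ‖ψ x‖ ^ 2

lemma normSq_eq {α : Type} [Fintype α] (ψ : α → ℂ) : (normSq ψ : ℂ) = star ψ ⬝ᵥ ψ := by
  simp [normSq, dotProduct, ← Complex.normSq_eq_norm_sq, Complex.normSq_eq_conj_mul_self]

lemma normSq_run (C : List (Op n p ι)) (ψ : Bits ι → ℂ) : normSq (run O C ψ) = normSq ψ := by
  induction C generalizing ψ with
  | nil => rfl
  | cons s C ih =>
    rw [run_cons, ih, ← Complex.ofReal_inj, normSq_eq, normSq_eq, Matrix.star_mulVec,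
      ← Matrix.dotProduct_mulVec, Matrix.mulVec_mulVec, Op.mat_unitary, Matrix.one_mulVec]

end Run

/-! ### Counting steps -/

def Op.isGate : Op n p ι → Bool
  | .gate₁ _ _ => true
  | .gate₂ _ _ => true
  | _ => false

def Op.isQueryM : Op n p ι → Bool
  | .queryM _ _ => true
  | _ => false

def Op.isQueryVB : Op n p ι → Bool
  | .queryV _ _ => true
  | .queryB _ _ => true
  | _ => false

def gates (C : List (Op n p ι)) : ℕ := C.countP Op.isGate
def queries (C : List (Op n p ι)) : ℕ := C.countP Op.isQueryM
def vqueries (C : List (Op n p ι)) : ℕ := C.countP Op.isQueryVB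

section Count

variable (C D : List (Op n p ι))

@[simp] lemma gates_nil : gates ([] : List (Op n p ι)) = 0 := rfl
@[simp] lemma queries_nil : queries ([] : List (Op n p ι)) = 0 := rfl
@[simp] lemma vqueries_nil : vqueries ([] : List (Op n p ι)) = 0 := rfl
@[simp] lemma gates_append : gates (C ++ D) = gates C + gates D := List.countP_append
@[simp] lemma queries_append : queries (C ++ D) = queries C + queries D := List.countP_append
@[simp] lemma vqueries_append : vqueries (C ++ D) = vqueries C + vqueries D := List.countP_append

@[simp] lemma gates_invC : gates (invC C) = gates C := by
  simp only [gates, invC, List.countP_reverse, List.countP_map]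
  exact List.countP_congr fun s _ => by cases s <;> simp [Op.isGate, Op.inv]

@[simp] lemma queries_invC : queries (invC C) = queries C := by
  simp only [queries, invC, List.countP_reverse, List.countP_map]
  exact List.countP_congr fun s _ => by cases s <;> simp [Op.isQueryM, Op.inv]

@[simp] lemma vqueries_invC : vqueries (invC C) = vqueries C := by
  simp only [vqueries, invC, List.countP_reverse, List.countP_map]
  exact List.countP_congr fun s _ => by cases s <;> simp [Op.isQueryVB, Op.inv]

@[simp] lemma gates_conj : gates (conj C D) = 2 * gates C + gates D := by
  simp [conj]; ring
@[simp] lemma queries_conj : queries (conj C D) = 2 * queries C + queries D := by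
  simp [conj]; ring
@[simp] lemma vqueries_conj : vqueries (conj C D) = 2 * vqueries C + vqueries D := by
  simp [conj]; ring

variable {α : Type}

lemma gates_flatMap_le {L : List α} {f : α → List (Op n p ι)} {b : ℕ}
    (h : ∀ a ∈ L, gates (f a) ≤ b) : gates (L.flatMap f) ≤ L.length * b := by
  induction L with
  | nil => simp
  | cons a L ih =>
    have h1 := h a (by simp)
    have h2 := ih fun a ha => h a (by simp [ha])
    simp only [List.flatMap_cons, gates_append, List.length_cons]
    linarith

lemma queries_flatMap {L : List α} {f : α → List (Op n p ι)} {b : ℕ}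
    (h : ∀ a ∈ L, queries (f a) = b) : queries (L.flatMap f) = L.length * b := by
  induction L with
  | nil => simp
  | cons a L ih =>
    have h1 := h a (by simp)
    have h2 := ih fun a ha => h a (by simp [ha])
    simp only [List.flatMap_cons, queries_append, List.length_cons]
    linarith

lemma vqueries_flatMap {L : List α} {f : α → List (Op n p ι)} {b : ℕ}
    (h : ∀ a ∈ L, vqueries (f a) = b) : vqueries (L.flatMap f) = L.length * b := by
  induction L with
  | nil => simp
  | cons a L ih =>
    have h1 := h a (by simp)
    have h2 := ih fun a ha => h a (by simp [ha])
    simp only [List.flatMap_cons, vqueries_append, List.length_cons]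
    linarith

end Count

/-! ### From labelled circuits to query algorithms -/

section Compile

variable [Fintype ι] [DecidableEq ι]

/-- The query algorithm given by a circuit on labelled qubits. -/
def compile (C : List (Op n p ι)) (out : ι) : QueryAlgorithm n p where
  qubits := Fintype.card ι
  out := Fintype.equivFin ι out
  steps := C.map (Op.toStep (Fintype.equivFin ι))

lemma Op.toStep_mulVec {N : ℕ} (q : ι ≃ Fin N) (O : Oracles n p) (s : Op n p ι) (ψ : Bits ι → ℂ) :
    (s.toStep q).op O.UM O.Uv O.Ub *ᵥ (fun x => ψ (x ∘ q)) =
      fun x => (s.mat O *ᵥ ψ) (x ∘ q) := by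
  have key : ∀ {κ : Type} [Fintype κ] [DecidableEq κ] (e : κ ↪ ι) (U : Matrix (Bits κ) (Bits κ) ℂ),
      applyAt (e.trans q.toEmbedding) U *ᵥ (fun x => ψ (x ∘ q)) =
        fun x => (place e U *ᵥ ψ) (x ∘ q) := by
    intro κ _ _ e U
    ext x
    simp only [Matrix.mulVec, dotProduct, place_trans]
    exact Fintype.sum_equiv (q.symm.arrowCongr (Equiv.refl Bool)) _ _ fun y => rfl
  cases s <;> exact key _ _

lemma compile_finalState (C : List (Op n p ι)) (out : ι) (O : Oracles n p) :
    (compile C out).finalState O.UM O.Uv O.Ub =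
      fun x => run O C (ket fun _ => false) (x ∘ Fintype.equivFin ι) := by
  have key : ∀ (D : List (Op n p ι)) (ψ : Bits ι → ℂ),
      (D.map (Op.toStep (Fintype.equivFin ι))).foldl
        (fun φ s => s.op O.UM O.Uv O.Ub *ᵥ φ) (fun x => ψ (x ∘ Fintype.equivFin ι)) =
      fun x => run O D ψ (x ∘ Fintype.equivFin ι) := by
    intro D
    induction D with
    | nil => intro ψ; rfl
    | cons s D ih =>
      intro ψ
      rw [List.map_cons, List.foldl_cons, Op.toStep_mulVec, ih]
      rfl
  rw [← key]
  simp only [QueryAlgorithm.finalState, compile]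
  congr 1
  ext x
  have h : ((fun x => ket (fun _ : ι => false) (x ∘ Fintype.equivFin ι)) :
      Bits (Fin (Fintype.card ι)) → ℂ) = ket fun _ => false := by
    ext y
    rw [ket_apply, ket_apply]
    refine if_congr ⟨fun h => ?_, ?_⟩ rfl rfl
    · ext i
      simpa using congrFun h ((Fintype.equivFin ι).symm i)
    · rintro rfl
      rfl
  exact (congrFun h x).symm

lemma compile_prob (C : List (Op n p ι)) (out : ι) (O : Oracles n p) (c : Bool) :
    (compile C out).prob O.UM O.Uv O.Ub c =
      ∑ x : Bits ι, if x out = c then ‖run O C (ket fun _ => false) x‖ ^ 2 else 0 := by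
  rw [QueryAlgorithm.prob, compile_finalState]
  exact Fintype.sum_equiv ((Fintype.equivFin ι).symm.arrowCongr (Equiv.refl Bool)) _ _ fun y => rfl

lemma compile_gates (C : List (Op n p ι)) (out : ι) : (compile C out).gates = gates C := by
  simp only [QueryAlgorithm.gates, compile, gates, List.countP_map]
  exact List.countP_congr fun s _ => by cases s <;> rfl

lemma compile_queriesM (C : List (Op n p ι)) (out : ι) :
    (compile C out).queriesM = queries C := by
  simp only [QueryAlgorithm.queriesM, compile, queries, List.countP_map]
  exact List.countP_congr fun s _ => by cases s <;> rfl

lemma compile_queriesVB (C : List (Op n p ι)) (out : ι) :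
    (compile C out).queriesV + (compile C out).queriesB = vqueries C := by
  simp only [QueryAlgorithm.queriesV, QueryAlgorithm.queriesB, compile, vqueries, List.countP_map]
  induction C with
  | nil => rfl
  | cons s C ih =>
    simp only [List.countP_cons]
    rw [← ih]
    cases s <;> simp [Op.toStep, Step.isQueryV, Step.isQueryB, Op.isQueryVB] <;> omega

end Compile

/-! ### Elementary gates -/

/-- The complex number `e ^ (i θ)`. -/
def phase (θ : ℝ) : ℂ := Complex.exp (θ * Complex.I)

@[simp] lemma phase_zero : phase 0 = 1 := by simp [phase]

lemma phase_add (a b : ℝ) : phase (a + b) = phase a * phase b := by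
  simp [phase, add_mul, Complex.exp_add]

@[simp] lemma phase_pi : phase Real.pi = -1 := by simp [phase]

@[simp] lemma norm_phase (θ : ℝ) : ‖phase θ‖ = 1 := Complex.norm_exp_ofReal_mul_I θ

lemma conj_phase (θ : ℝ) : star (phase θ) = phase (-θ) := by
  simp [phase, ← Complex.exp_conj]

lemma star_phase_mul (θ : ℝ) : star (phase θ) * phase θ = 1 := by
  rw [conj_phase, ← phase_add]; simp

variable {n p : ℕ} {ι : Type}

/-- The one-qubit gate with matrix `m` on the qubit `a`. -/
def gate1 (a : ι) (m : Matrix Bool Bool ℂ) (hm : mᴴ * m = 1) : Op n p ι :=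
  .gate₁ ⟨fun _ => a, fun _ _ _ => Subsingleton.elim _ _⟩
    ⟨m.submatrix (Equiv.funUnique (Fin 1) Bool) (Equiv.funUnique (Fin 1) Bool), by
      rw [Matrix.mem_unitaryGroup_iff', Matrix.star_eq_conjTranspose,
        Matrix.conjTranspose_submatrix, Matrix.submatrix_mul_equiv, hm,
        Matrix.submatrix_one_equiv]⟩

/-- The two-qubit gate with matrix `m` on the qubits `a`, `b`. -/
def gate2 (a b : ι) (hab : a ≠ b) (m : Matrix (Bool × Bool) (Bool × Bool) ℂ) (hm : mᴴ * m = 1) :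
    Op n p ι :=
  .gate₂ ⟨![a, b], by
      intro i j h
      fin_cases i <;> fin_cases j <;> simp_all [eq_comm]⟩
    ⟨m.submatrix (finTwoArrowEquiv Bool) (finTwoArrowEquiv Bool), by
      rw [Matrix.mem_unitaryGroup_iff', Matrix.star_eq_conjTranspose,
        Matrix.conjTranspose_submatrix, Matrix.submatrix_mul_equiv, hm,
        Matrix.submatrix_one_equiv]⟩

/-! ### Action of one-qubit and two-qubit gates on basis states -/

section Gates

variable [Fintype ι] [DecidableEq ι] (O : Oracles n p)

lemma run_gate1 (a : ι) (m : Matrix Bool Bool ℂ) (hm : mᴴ * m = 1) (x : Bits ι) :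
    run O [gate1 a m hm] (ket x) = ∑ b, m b (x a) • ket (Function.update x a b) := by
  rw [run_cons, run_nil]
  simp only [gate1, Op.mat]
  rw [place_mulVec_ket]
  refine Fintype.sum_equiv (Equiv.funUnique (Fin 1) Bool) _ _ fun u => ?_
  refine congrArg₂ (· • ·) ?_ (congrArg ket ?_)
  · rfl
  symm
  rw [eq_put_iff]
  refine ⟨fun i hi => Function.update_of_ne (fun h => hi 0 h.symm) _ _, ?_⟩
  ext i
  obtain rfl := Subsingleton.elim i 0
  change u 0 = Function.update x a (u 0) a
  rw [Function.update_self]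

lemma run_gate2 (a b : ι) (hab : a ≠ b) (m : Matrix (Bool × Bool) (Bool × Bool) ℂ)
    (hm : mᴴ * m = 1) (x : Bits ι) :
    run O [gate2 a b hab m hm] (ket x) =
      ∑ c, m c (x a, x b) • ket (Function.update (Function.update x a c.1) b c.2) := by
  rw [run_cons, run_nil]
  simp only [gate2, Op.mat]
  rw [place_mulVec_ket]
  refine Fintype.sum_equiv (finTwoArrowEquiv Bool) _ _ fun u => ?_
  refine congrArg₂ (· • ·) ?_ (congrArg ket ?_)
  · rfl
  symm
  rw [eq_put_iff]
  constructor
  · intro i hi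
    have h0 : a ≠ i := hi 0
    have h1 : b ≠ i := hi 1
    rw [Function.update_of_ne (Ne.symm h1), Function.update_of_ne (Ne.symm h0)]
  · ext i
    fin_cases i
    · change u 0 = Function.update (Function.update x a (u 0)) b (u 1) a
      rw [Function.update_of_ne hab, Function.update_self]
    · change u 1 = Function.update (Function.update x a (u 0)) b (u 1) b
      rw [Function.update_self]

end Gates

lemma diagonal_phase_unitary {α : Type} [Fintype α] [DecidableEq α] (θ : α → ℝ) :
    (Matrix.diagonal fun c => phase (θ c))ᴴ * (Matrix.diagonal fun c => phase (θ c)) = 1 := by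
  rw [Matrix.diagonal_conjTranspose, Matrix.diagonal_mul_diagonal, ← Matrix.diagonal_one]
  congr 1
  ext c
  exact star_phase_mul _

/-- The matrix of the classical gate `f`. -/
def permMatrix {α : Type} [DecidableEq α] (f : α → α) : Matrix α α ℂ :=
  Matrix.of fun c d => if c = f d then 1 else 0

lemma permMatrix_unitary {α : Type} [Fintype α] [DecidableEq α] {f : α → α}
    (hf : Function.Injective f) : (permMatrix f)ᴴ * permMatrix f = 1 := by
  ext c d
  simp only [permMatrix, Matrix.mul_apply, Matrix.conjTranspose_apply, Matrix.of_apply, apply_ite,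
    star_one, star_zero, mul_one, mul_zero, Finset.sum_ite_eq', Finset.mem_univ,
    if_true, Matrix.one_apply]
  simp [hf.eq_iff, eq_comm]

/-- The Hadamard matrix. -/
def hadamard : Matrix Bool Bool ℂ :=
  Matrix.of fun c d => if c && d then -((Real.sqrt 2)⁻¹ : ℝ) else ((Real.sqrt 2)⁻¹ : ℝ)

lemma inv_sqrt_two_mul_self : ((Real.sqrt 2 : ℂ))⁻¹ * (Real.sqrt 2 : ℂ)⁻¹ = 1 / 2 := by
  rw [← mul_inv, ← Complex.ofReal_mul, Real.mul_self_sqrt (by norm_num)]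
  norm_num

lemma hadamard_unitary : hadamardᴴ * hadamard = 1 := by
  ext c d
  cases c <;> cases d <;> norm_num [hadamard, Matrix.mul_apply, inv_sqrt_two_mul_self]

/-- Hadamard gate. -/
def had (a : ι) : Op n p ι := gate1 a hadamard hadamard_unitary

/-- Bit flip. -/
def flip (a : ι) : Op n p ι := gate1 a (permMatrix not) (permMatrix_unitary Bool.not_injective)

/-- Phase `e ^ (i θ)` if the qubit is `1`. -/
def phaseGate (a : ι) (θ : ℝ) : Op n p ι :=
  gate1 a (Matrix.diagonal fun c => phase (if c then θ else 0)) (diagonal_phase_unitary _)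

lemma cnot_injective :
    Function.Injective (fun c : Bool × Bool => (c.1, xor c.1 c.2)) := by
  rintro ⟨a, b⟩ ⟨c, d⟩ h
  simp only [Prod.mk.injEq] at h
  obtain ⟨rfl, h⟩ := h
  simpa using h

/-- Rotation in the plane spanned by `|10⟩` and `|01⟩`. -/
def rotMatrix (θ : ℝ) : Matrix (Bool × Bool) (Bool × Bool) ℂ :=
  Matrix.of fun c d => match d, c with
    | (true, false), (true, false) => (Real.cos θ : ℂ)
    | (true, false), (false, true) => (Real.sin θ : ℂ)
    | (false, true), (true, false) => (-Real.sin θ : ℂ)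
    | (false, true), (false, true) => (Real.cos θ : ℂ)
    | (false, false), (false, false) => 1
    | (true, true), (true, true) => 1
    | _, _ => 0

lemma rotMatrix_unitary (θ : ℝ) : (rotMatrix θ)ᴴ * rotMatrix θ = 1 := by
  have h : (Real.cos θ : ℂ) * Real.cos θ + Real.sin θ * Real.sin θ = 1 := by
    exact_mod_cast (by nlinarith [Real.sin_sq_add_cos_sq θ] :
      Real.cos θ * Real.cos θ + Real.sin θ * Real.sin θ = 1)
  ext ⟨a, b⟩ ⟨c, d⟩
  cases a <;> cases b <;> cases c <;> cases d <;>
    simp [rotMatrix, Matrix.mul_apply, Fintype.sum_prod_type,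
      Complex.conj_ofReal, -Complex.ofReal_cos, -Complex.ofReal_sin, mul_comm] <;> linear_combination h

/-! ### Controlled gates built from two-qubit gates -/

section TwoQubit

variable [DecidableEq ι]

/-- Controlled bit flip. -/
def cnot (a b : ι) : List (Op n p ι) :=
  -- The empty circuit for `a = b` is a default that keeps the definition total; `run_cnot` asks for
  -- distinct qubits.
  if h : a ≠ b then [gate2 a b h (permMatrix fun c => (c.1, xor c.1 c.2))
    (permMatrix_unitary cnot_injective)] else []

/-- Phase `e ^ (i θ)` if the bit at `a` is `pol` and the bit at `b` is `1`. -/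
def cphase (a : ι) (pol : Bool) (b : ι) (θ : ℝ) : List (Op n p ι) :=
  if h : a ≠ b then [gate2 a b h (Matrix.diagonal fun c => phase (if c.1 = pol ∧ c.2 then θ else 0))
    (diagonal_phase_unitary _)] else []

/-- Rotation on the qubits `a`, `b`. -/
def rot (a b : ι) (θ : ℝ) : List (Op n p ι) :=
  if h : a ≠ b then [gate2 a b h (rotMatrix θ) (rotMatrix_unitary θ)] else []

/-- Phase `e ^ (i θ)` if the bits at `a`, `b`, `c` are `1`, `pol`, `1`. -/
def ccphase (a b : ι) (pol : Bool) (c : ι) (θ : ℝ) : List (Op n p ι) :=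
  cphase a true c (θ / 2) ++ conj (cnot a b) (cphase b pol c (-(θ / 2))) ++ cphase b pol c (θ / 2)

/-- Flip `c` if the bits at `a`, `b` are `1`, `pol`. -/
def toffoli (a b : ι) (pol : Bool) (c : ι) : List (Op n p ι) :=
  conj [had c] (ccphase a b pol c Real.pi)

/-- Phase `e ^ (i θ)` if the bit at `t` is `1` and the bits in `lits` have the prescribed values.
The qubits in `ancs` have to be `0`. -/
def ladder (θ : ℝ) : ι → List (ι × Bool) → List ι → List (Op n p ι)
  | t, [], _ => [phaseGate t θ]
  -- Default when the ancillas run out; `run_ladder` assumes that there are enough.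
  | _, _ :: _, [] => []
  | t, l :: ls, a :: as => conj (toffoli t l.1 l.2 a) (ladder θ a ls as)

end TwoQubit

/-! ### Action of the elementary circuits on basis states -/

section Specs

variable [Fintype ι] [DecidableEq ι] (O : Oracles n p)

lemma run_had (a : ι) (x : Bits ι) :
    run O [had a] (ket x) = ((Real.sqrt 2)⁻¹ : ℂ) •
      (ket (Function.update x a false) +
        (if x a then (-1 : ℂ) else 1) • ket (Function.update x a true)) := by
  rw [had, run_gate1]
  cases h : x a <;> simp [hadamard, add_comm]

lemma run_flip (a : ι) (x : Bits ι) :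
    run O [flip a] (ket x) = ket (Function.update x a (!x a)) := by
  rw [flip, run_gate1]
  simp [permMatrix, -Fintype.univ_bool]

lemma run_phaseGate (a : ι) (θ : ℝ) (x : Bits ι) :
    run O [phaseGate a θ] (ket x) = phase (if x a then θ else 0) • ket x := by
  rw [phaseGate, run_gate1, Finset.sum_eq_single (x a)] <;>
    simp +contextual

lemma run_cnot {a b : ι} (hab : a ≠ b) (x : Bits ι) :
    run O (cnot a b) (ket x) = ket (Function.update x b (xor (x a) (x b))) := by
  rw [cnot, dif_pos hab, run_gate2, Finset.sum_eq_single (x a, xor (x a) (x b))] <;>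
    simp +contextual [permMatrix]

lemma run_cphase {a b : ι} (hab : a ≠ b) (pol : Bool) (θ : ℝ) (x : Bits ι) :
    run O (cphase a pol b θ) (ket x) = phase (if x a = pol ∧ x b then θ else 0) • ket x := by
  rw [cphase, dif_pos hab, run_gate2, Finset.sum_eq_single (x a, x b)] <;>
    simp +contextual

/-- With `[·]` for indicators, `2 [a ∧ b = pol] = [a] + [b = pol] - [a ⊕ b = pol]`. The three terms
are phases of `± θ / 2` controlled by a single qubit besides `c`, the last one after `a` has been
added to `b`. -/
lemma run_ccphase {a b c : ι} (hab : a ≠ b) (hac : a ≠ c) (hbc : b ≠ c) (pol : Bool) (θ : ℝ)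
    (x : Bits ι) :
    run O (ccphase a b pol c θ) (ket x) =
      phase (if x a ∧ x b = pol ∧ x c then θ else 0) • ket x := by
  have h : run O (conj (cnot a b) (cphase b pol c (-(θ / 2)))) (ket x) =
      phase (if xor (x a) (x b) = pol ∧ x c then -(θ / 2) else 0) • ket x := by
    refine run_conj_smul O (run_cnot O hab x) ?_
    rw [run_cphase O hbc]
    simp [Function.update_of_ne hbc.symm]
  rw [ccphase, run_append, run_append, run_cphase O hac, map_smul, h, map_smul, map_smul,
    run_cphase O hbc, smul_smul, smul_smul, ← phase_add, ← phase_add]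
  congr 2
  cases x a <;> cases x b <;> cases x c <;> cases pol <;> simp

/-- A sign change between two Hadamard gates is a bit flip. The condition `P` must be the same for
both values of the bit at `c`, which is why the hypothesis quantifies over `v`. -/
lemma run_conj_had {C : List (Op n p ι)} {c : ι} {x : Bits ι} {P : Prop} [Decidable P]
    (h : ∀ v, run O C (ket (Function.update x c v)) =
      phase (if v ∧ P then Real.pi else 0) • ket (Function.update x c v)) :
    run O (conj [had c] C) (ket x) = ket (Function.update x c (xor (x c) (decide P))) := by
  refine run_conj O ?_
  rw [run_had, run_had, map_smul, map_add, map_smul, h, h]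
  by_cases hP : P <;> cases hx : x c <;> simp [hP]

lemma run_toffoli {a b c : ι} (hab : a ≠ b) (hac : a ≠ c) (hbc : b ≠ c) (pol : Bool)
    (x : Bits ι) :
    run O (toffoli a b pol c) (ket x) =
      ket (Function.update x c (xor (x c) (decide (x a = true ∧ x b = pol)))) := by
  refine run_conj_had O fun v => ?_
  rw [run_ccphase O hab hac hbc]
  simp only [Function.update_of_ne hac, Function.update_of_ne hbc, Function.update_self]
  congr 2
  exact if_congr (by tauto) rfl rfl

/-- Each Toffoli stores the conjunction of the current target and the next literal in a fresh
ancilla, which becomes the next target; the conjugation clears it again. The induction survives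
because no literal sits on an ancilla, so later literals keep their values. -/
lemma run_ladder (θ : ℝ) (lits : List (ι × Bool)) (ancs : List ι) (t : ι) (x : Bits ι)
    (hlen : lits.length ≤ ancs.length) (hnd : ancs.Nodup) (hx : ∀ a ∈ ancs, x a = false)
    (ht : t ∉ ancs) (hl : ∀ l ∈ lits, l.1 ≠ t ∧ l.1 ∉ ancs) :
    run O (ladder θ t lits ancs) (ket x) =
      phase (if x t = true ∧ ∀ l ∈ lits, x l.1 = l.2 then θ else 0) • ket x := by
  induction lits generalizing ancs t x with
  | nil => simp [ladder, run_phaseGate]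
  | cons l ls ih =>
    match ancs, hlen, hnd, hx, ht, hl with
    | a :: as, hlen, hnd, hx, ht, hl =>
      have hxa := hx a (by simp)
      have hll := hl l (by simp)
      simp only [List.mem_cons, not_or] at hll ht
      rw [List.nodup_cons] at hnd
      rw [ladder]
      refine run_conj_smul O (run_toffoli O hll.1.symm ht.1 hll.2.1 l.2 x) ?_
      rw [hxa, Bool.false_xor, ih]
      · congr 2
        have h1 : ∀ m ∈ ls, Function.update x a
            (decide (x t = true ∧ x l.1 = l.2)) m.1 = x m.1 := fun m hm =>
          Function.update_of_ne (fun h => (hl m (by simp [hm])).2 (by simp [h])) _ _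
        have h2 : (∀ m ∈ ls, Function.update x a
            (decide (x t = true ∧ x l.1 = l.2)) m.1 = m.2) ↔ ∀ m ∈ ls, x m.1 = m.2 :=
          forall₂_congr fun m hm => by rw [h1 m hm]
        simp only [h2, Function.update_self, decide_eq_true_eq, List.forall_mem_cons, and_assoc]
      · simpa using hlen
      · exact hnd.2
      · intro b hb
        rw [Function.update_of_ne (fun h : b = a => hnd.1 (h ▸ hb))]
        exact hx b (by simp [hb])
      · exact hnd.1
      · intro m hm
        have := (hl m (by simp [hm])).2
        simp only [List.mem_cons, not_or] at this
        exact this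

end Specs

/-! ### Gate and query counts of the elementary circuits -/

section Costs

variable [DecidableEq ι]

@[simp] lemma gates_had (a : ι) : gates [(had a : Op n p ι)] = 1 := rfl
@[simp] lemma queries_had (a : ι) : queries [(had a : Op n p ι)] = 0 := rfl
@[simp] lemma vqueries_had (a : ι) : vqueries [(had a : Op n p ι)] = 0 := rfl
@[simp] lemma gates_flip (a : ι) : gates [(flip a : Op n p ι)] = 1 := rfl
@[simp] lemma queries_flip (a : ι) : queries [(flip a : Op n p ι)] = 0 := rfl
@[simp] lemma vqueries_flip (a : ι) : vqueries [(flip a : Op n p ι)] = 0 := rfl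
@[simp] lemma gates_phaseGate (a : ι) (θ : ℝ) : gates [(phaseGate a θ : Op n p ι)] = 1 := rfl
@[simp] lemma queries_phaseGate (a : ι) (θ : ℝ) : queries [(phaseGate a θ : Op n p ι)] = 0 := rfl
@[simp] lemma vqueries_phaseGate (a : ι) (θ : ℝ) : vqueries [(phaseGate a θ : Op n p ι)] = 0 := rfl

lemma gates_cnot (a b : ι) : gates (cnot a b : List (Op n p ι)) ≤ 1 := by
  unfold cnot; split_ifs <;> simp [gates, gate2, Op.isGate]
@[simp] lemma queries_cnot (a b : ι) : queries (cnot a b : List (Op n p ι)) = 0 := by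
  unfold cnot; split_ifs <;> rfl
@[simp] lemma vqueries_cnot (a b : ι) : vqueries (cnot a b : List (Op n p ι)) = 0 := by
  unfold cnot; split_ifs <;> rfl

lemma gates_cphase (a b : ι) (q : Bool) (θ : ℝ) :
    gates (cphase a q b θ : List (Op n p ι)) ≤ 1 := by
  unfold cphase; split_ifs <;> simp [gates, gate2, Op.isGate]
@[simp] lemma queries_cphase (a b : ι) (q : Bool) (θ : ℝ) :
    queries (cphase a q b θ : List (Op n p ι)) = 0 := by
  unfold cphase; split_ifs <;> rfl
@[simp] lemma vqueries_cphase (a b : ι) (q : Bool) (θ : ℝ) :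
    vqueries (cphase a q b θ : List (Op n p ι)) = 0 := by
  unfold cphase; split_ifs <;> rfl

lemma gates_rot (a b : ι) (θ : ℝ) : gates (rot a b θ : List (Op n p ι)) ≤ 1 := by
  unfold rot; split_ifs <;> simp [gates, gate2, Op.isGate]
@[simp] lemma queries_rot (a b : ι) (θ : ℝ) : queries (rot a b θ : List (Op n p ι)) = 0 := by
  unfold rot; split_ifs <;> rfl
@[simp] lemma vqueries_rot (a b : ι) (θ : ℝ) : vqueries (rot a b θ : List (Op n p ι)) = 0 := by
  unfold rot; split_ifs <;> rfl

lemma gates_ccphase (a b c : ι) (q : Bool) (θ : ℝ) :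
    gates (ccphase a b q c θ : List (Op n p ι)) ≤ 5 := by
  have h1 := gates_cphase (n := n) (p := p) a c true (θ / 2)
  have h2 := gates_cphase (n := n) (p := p) b c q (-(θ / 2))
  have h3 := gates_cphase (n := n) (p := p) b c q (θ / 2)
  have h4 := gates_cnot (n := n) (p := p) a b
  simp only [ccphase, gates_append, gates_conj]
  omega
@[simp] lemma queries_ccphase (a b c : ι) (q : Bool) (θ : ℝ) :
    queries (ccphase a b q c θ : List (Op n p ι)) = 0 := by simp [ccphase]
@[simp] lemma vqueries_ccphase (a b c : ι) (q : Bool) (θ : ℝ) :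
    vqueries (ccphase a b q c θ : List (Op n p ι)) = 0 := by simp [ccphase]

lemma gates_toffoli (a b c : ι) (q : Bool) :
    gates (toffoli a b q c : List (Op n p ι)) ≤ 7 := by
  have := gates_ccphase (n := n) (p := p) a b c q Real.pi
  simp only [toffoli, gates_conj, gates_had]
  omega
@[simp] lemma queries_toffoli (a b c : ι) (q : Bool) :
    queries (toffoli a b q c : List (Op n p ι)) = 0 := by simp [toffoli]
@[simp] lemma vqueries_toffoli (a b c : ι) (q : Bool) :
    vqueries (toffoli a b q c : List (Op n p ι)) = 0 := by simp [toffoli]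

/-- A literal costs two Toffoli circuits of at most seven gates; the extra gate is the final phase.
-/
lemma gates_ladder (θ : ℝ) (lits : List (ι × Bool)) (ancs : List ι) (t : ι) :
    gates (ladder θ t lits ancs : List (Op n p ι)) ≤ 14 * lits.length + 1 := by
  induction lits generalizing ancs t with
  | nil => simp [ladder]
  | cons l ls ih =>
    cases ancs with
    | nil => simp [ladder]
    | cons a as =>
      have h1 := ih as a
      have h2 := gates_toffoli (n := n) (p := p) t l.1 a l.2
      simp only [ladder, gates_conj, List.length_cons]
      omega
@[simp] lemma queries_ladder (θ : ℝ) (lits : List (ι × Bool)) (ancs : List ι) (t : ι) :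
    queries (ladder θ t lits ancs : List (Op n p ι)) = 0 := by
  induction lits generalizing ancs t with
  | nil => simp [ladder]
  | cons l ls ih => cases ancs <;> simp [ladder, ih]
@[simp] lemma vqueries_ladder (θ : ℝ) (lits : List (ι × Bool)) (ancs : List ι) (t : ι) :
    vqueries (ladder θ t lits ancs : List (Op n p ι)) = 0 := by
  induction lits generalizing ancs t with
  | nil => simp [ladder]
  | cons l ls ih => cases ancs <;> simp [ladder, ih]

end Costs

/-! ### The registers of the algorithm -/

/-- Qubit labels: `ℓ` flags, a one-hot row index, a multiplier `y`, the registers of the matrix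
oracle, copies of the two vectors, ancillas and the output qubit. -/
inductive Reg (ℓ n p : ℕ) : Type
  | flag (i : Fin ℓ)
  -- One-hot storage lets two-qubit rotations prepare the uniform superposition exactly for every
  -- `n`, and its `n` qubits fit the budget.
  | hot (j : Fin n)
  | y (s : Fin (width p))
  | row (i : Fin (width n))
  | col (i : Fin (width n))
  | val (s : Fin (width p))
  -- All of `v` and `b` stays in memory, so the vector oracles are queried only while loading.
  | vec (k : Fin n) (s : Fin (width p))
  | rhs (j : Fin n) (s : Fin (width p))
  -- The conjunctions that are evaluated have at most `width p + 1`, `ℓ` or `width p + ℓ` literals.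
  | anc (i : Fin (ℓ + width p + 1))
  | out

/-- The qubit labels as a sum type. -/
def Reg.equiv (ℓ n p : ℕ) : Reg ℓ n p ≃
    Fin ℓ ⊕ Fin n ⊕ Fin (width p) ⊕ Fin (width n) ⊕ Fin (width n) ⊕ Fin (width p) ⊕
      (Fin n × Fin (width p)) ⊕ (Fin n × Fin (width p)) ⊕ Fin (ℓ + width p + 1) ⊕ Unit where
  toFun
    | .flag i => .inl i
    | .hot j => .inr (.inl j)
    | .y s => .inr (.inr (.inl s))
    | .row i => .inr (.inr (.inr (.inl i)))
    | .col i => .inr (.inr (.inr (.inr (.inl i))))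
    | .val s => .inr (.inr (.inr (.inr (.inr (.inl s)))))
    | .vec k s => .inr (.inr (.inr (.inr (.inr (.inr (.inl (k, s)))))))
    | .rhs k s => .inr (.inr (.inr (.inr (.inr (.inr (.inr (.inl (k, s))))))))
    | .anc i => .inr (.inr (.inr (.inr (.inr (.inr (.inr (.inr (.inl i))))))))
    | .out => .inr (.inr (.inr (.inr (.inr (.inr (.inr (.inr (.inr ()))))))))
  invFun
    | .inl i => .flag i
    | .inr (.inl j) => .hot j
    | .inr (.inr (.inl s)) => .y s
    | .inr (.inr (.inr (.inl i))) => .row i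
    | .inr (.inr (.inr (.inr (.inl i)))) => .col i
    | .inr (.inr (.inr (.inr (.inr (.inl s))))) => .val s
    | .inr (.inr (.inr (.inr (.inr (.inr (.inl (k, s))))))) => .vec k s
    | .inr (.inr (.inr (.inr (.inr (.inr (.inr (.inl (k, s)))))))) => .rhs k s
    | .inr (.inr (.inr (.inr (.inr (.inr (.inr (.inr (.inl i)))))))) => .anc i
    | .inr (.inr (.inr (.inr (.inr (.inr (.inr (.inr (.inr ())))))))) => .out
  left_inv r := by cases r <;> rfl
  right_inv r := by
    rcases r with _ | _ | _ | _ | _ | _ | ⟨_, _⟩ | ⟨_, _⟩ | _ | _ <;> rfl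

instance (ℓ n p : ℕ) : DecidableEq (Reg ℓ n p) := (Reg.equiv ℓ n p).injective.decidableEq
instance (ℓ n p : ℕ) : Fintype (Reg ℓ n p) := Fintype.ofEquiv _ (Reg.equiv ℓ n p).symm

lemma card_reg (ℓ n p : ℕ) : Fintype.card (Reg ℓ n p) =
    2 * ℓ + n + 3 * width p + 2 * width n + 2 * (n * width p) + 2 := by
  rw [Fintype.card_congr (Reg.equiv ℓ n p)]
  simp
  ring

/-- Contents of all registers. -/
structure Conf (ℓ n p : ℕ) : Type where
  flag : Fin ℓ → Bool
  hot : Fin n → Bool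
  y : Fin (width p) → Bool
  row : Fin (width n) → Bool
  col : Fin (width n) → Bool
  val : Fin (width p) → Bool
  vec : Fin n → Fin (width p) → Bool
  rhs : Fin n → Fin (width p) → Bool
  anc : Fin (ℓ + width p + 1) → Bool
  out : Bool

variable {ℓ n p : ℕ}

/-- The classical state with the given register contents. -/
def Conf.bits (c : Conf ℓ n p) : Bits (Reg ℓ n p)
  | .flag i => c.flag i
  | .hot j => c.hot j
  | .y s => c.y s
  | .row i => c.row i
  | .col i => c.col i
  | .val s => c.val s
  | .vec k s => c.vec k s
  | .rhs j s => c.rhs j s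
  | .anc i => c.anc i
  | .out => c.out

section Updates

variable (c : Conf ℓ n p) (b : Bool)

lemma update_flag (i) : Function.update c.bits (.flag i) b =
    Conf.bits { c with flag := Function.update c.flag i b } := by
  ext r; cases r <;> simp [Conf.bits, Function.update_apply]

lemma update_hot (i) : Function.update c.bits (.hot i) b =
    Conf.bits { c with hot := Function.update c.hot i b } := by
  ext r; cases r <;> simp [Conf.bits, Function.update_apply]

lemma update_y (i) : Function.update c.bits (.y i) b =
    Conf.bits { c with y := Function.update c.y i b } := by
  ext r; cases r <;> simp [Conf.bits, Function.update_apply]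

lemma update_row (i) : Function.update c.bits (.row i) b =
    Conf.bits { c with row := Function.update c.row i b } := by
  ext r; cases r <;> simp [Conf.bits, Function.update_apply]

lemma update_col (i) : Function.update c.bits (.col i) b =
    Conf.bits { c with col := Function.update c.col i b } := by
  ext r; cases r <;> simp [Conf.bits, Function.update_apply]

lemma update_out : Function.update c.bits .out b = Conf.bits { c with out := b } := by
  ext r; cases r <;> simp [Conf.bits]

end Updates

/-- The qubits on which the matrix oracle is queried. -/
def matEmb : MatReg n p ↪ Reg ℓ n p where
  toFun := Sum.elim .row (Sum.elim .col .val)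
  inj' := by
    rintro (a | a | a) (b | b | b) h <;> simp_all

/-- The qubits on which the oracle of the vector `v` is queried. -/
def vecEmb (k : Fin n) : VecReg n p ↪ Reg ℓ n p where
  toFun := Sum.elim .row (.vec k)
  inj' := by
    rintro (a | a) (b | b) h <;> simp_all

/-- The qubits on which the oracle of the vector `b` is queried. -/
def rhsEmb (k : Fin n) : VecReg n p ↪ Reg ℓ n p where
  toFun := Sum.elim .row (.rhs k)
  inj' := by
    rintro (a | a) (b | b) h <;> simp_all

@[simp] lemma matEmb_row (i) : (matEmb (.inl i) : Reg ℓ n p) = .row i := rfl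
@[simp] lemma matEmb_col (i) : (matEmb (.inr (.inl i)) : Reg ℓ n p) = .col i := rfl
@[simp] lemma matEmb_val (i) : (matEmb (.inr (.inr i)) : Reg ℓ n p) = .val i := rfl
@[simp] lemma vecEmb_row (k : Fin n) (i) : (vecEmb k (.inl i) : Reg ℓ n p) = .row i := rfl
@[simp] lemma vecEmb_vec (k : Fin n) (i) : (vecEmb k (.inr i) : Reg ℓ n p) = .vec k i := rfl
@[simp] lemma rhsEmb_row (k : Fin n) (i) : (rhsEmb k (.inl i) : Reg ℓ n p) = .row i := rfl
@[simp] lemma rhsEmb_rhs (k : Fin n) (i) : (rhsEmb k (.inr i) : Reg ℓ n p) = .rhs k i := rfl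

/-! ### Iterated steps -/

section Iterate

variable {ι : Type} [Fintype ι] [DecidableEq ι] (O : Oracles n p)

/-- Each block is responsible for one coordinate and relies only on that coordinate being untouched.
The invariant is that coordinates still in the list have their old value and all others the new one.
-/
lemma run_flatMap_update {α : Type} {m : ℕ} (F : (Fin m → α) → Bits ι)
    (C : Fin m → List (Op n p ι)) (a b : Fin m → α)
    (h : ∀ i v, v i = a i → run O (C i) (ket (F v)) = ket (F (Function.update v i (b i)))) :
    run O ((List.finRange m).flatMap C) (ket (F a)) = ket (F b) := by
  have key : ∀ L : List (Fin m), L.Nodup →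
      run O (L.flatMap C) (ket (F fun i => if i ∈ L then a i else b i)) = ket (F b) := by
    intro L
    induction L with
    | nil => intro _; simp
    | cons i L ih =>
      intro hL
      rw [List.nodup_cons] at hL
      rw [List.flatMap_cons, run_append, h i _ (by simp)]
      have : Function.update (fun k => if k ∈ i :: L then a k else b k) i (b i) =
          fun k => if k ∈ L then a k else b k := by
        ext k
        by_cases hk : k = i
        · subst hk; simp [hL.1]
        · simp [hk]
      rw [this, ih hL.2]
  simpa using key _ (List.nodup_finRange m)

lemma run_flatMap_phase {α : Type} {L : List α} {C : α → List (Op n p ι)} {ψ : Bits ι → ℂ}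
    {θ : α → ℝ} (h : ∀ a ∈ L, run O (C a) ψ = phase (θ a) • ψ) :
    run O (L.flatMap C) ψ = phase (L.map θ).sum • ψ := by
  induction L with
  | nil => simp
  | cons a L ih =>
    rw [List.flatMap_cons, run_append, h a (by simp), map_smul, ih fun a ha => h a (by simp [ha]),
      List.map_cons, List.sum_cons, phase_add, smul_smul]

lemma run_finRange_phase {m : ℕ} {C : Fin m → List (Op n p ι)} {ψ : Bits ι → ℂ}
    {θ : Fin m → ℝ} (h : ∀ i, run O (C i) ψ = phase (θ i) • ψ) :
    run O ((List.finRange m).flatMap C) ψ = phase (∑ i, θ i) • ψ := by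
  rw [run_flatMap_phase O fun i _ => h i, ← List.ofFn_eq_map, List.sum_ofFn]

end Iterate

/-- The number with the given binary digits. -/
def num {w : ℕ} (u : Fin w → Bool) : ℕ := ∑ s : Fin w, if u s then 2 ^ (s : ℕ) else 0

lemma num_binary {w a : ℕ} (h : a < 2 ^ w) : num (binary w a) = a := by
  induction w generalizing a with
  | zero => simp [num]; omega
  | succ w ih =>
    have h2 := ih (a := a / 2) (by rw [pow_succ] at h; omega)
    rw [num, Fin.sum_univ_succ]
    have h3 : ∑ i : Fin w, (if binary (w + 1) a i.succ then 2 ^ (i.succ : ℕ) else 0) =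
        2 * num (binary w (a / 2)) := by
      rw [num, Finset.mul_sum]
      refine Finset.sum_congr rfl fun i _ => ?_
      by_cases hi : (a / 2).testBit i = true <;>
        simp [binary, Nat.testBit_succ, pow_succ, hi, mul_comm]
    rw [h3, h2]
    simp only [binary, Fin.val_zero, Nat.testBit_zero, pow_zero]
    rcases Nat.mod_two_eq_zero_or_one a with h | h <;> simp [h] <;> omega

lemma num_cast {w : ℕ} (u : Fin w → Bool) :
    (num u : ℝ) = ∑ s : Fin w, if u s then (2 : ℝ) ^ (s : ℕ) else 0 := by
  simp [num]

/-! ### Phases given by products of binary numbers -/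

section Multilinear

variable {ι : Type} [Fintype ι] [DecidableEq ι] (O : Oracles n p) {w : ℕ}

/-- The phase `θ a b c` for the numbers `a`, `b`, `c` in three registers. -/
def trilinear (a b c : Fin w → ι) (θ : ℝ) : List (Op n p ι) :=
  (List.finRange w).flatMap fun s => (List.finRange w).flatMap fun t =>
    (List.finRange w).flatMap fun u =>
      ccphase (a s) (b t) true (c u) (θ * (2 ^ (s : ℕ) * 2 ^ (t : ℕ) * 2 ^ (u : ℕ)))

/-- The phase `θ a b` for the numbers `a`, `b` in two registers, if the bit at `h` is `1`. -/
def bilinear (h : ι) (a b : Fin w → ι) (θ : ℝ) : List (Op n p ι) :=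
  (List.finRange w).flatMap fun s => (List.finRange w).flatMap fun t =>
      ccphase h (a s) true (b t) (θ * (2 ^ (s : ℕ) * 2 ^ (t : ℕ)))

/-- The product of three binary numbers is a sum over triples of bits, and phases add. The product
is thus never computed in a register. -/
lemma run_trilinear {a b c : Fin w → ι} (hab : ∀ s t, a s ≠ b t) (hac : ∀ s t, a s ≠ c t)
    (hbc : ∀ s t, b s ≠ c t) (θ : ℝ) (x : Bits ι) :
    run O (trilinear a b c θ) (ket x) =
      phase (θ * (num (x ∘ a) * num (x ∘ b) * num (x ∘ c))) • ket x := by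
  rw [trilinear, run_finRange_phase O fun s => run_finRange_phase O fun t =>
    run_finRange_phase O fun u => run_ccphase O (hab s t) (hac s u) (hbc t u) _ _ x]
  congr 2
  rw [num_cast, num_cast, num_cast, Finset.sum_mul_sum, Finset.sum_mul, Finset.mul_sum]
  refine Finset.sum_congr rfl fun s _ => ?_
  rw [Finset.sum_mul_sum, Finset.mul_sum]
  refine Finset.sum_congr rfl fun t _ => ?_
  rw [Finset.mul_sum]
  refine Finset.sum_congr rfl fun u _ => ?_
  simp only [Function.comp_apply]
  by_cases h1 : x (a s) <;> by_cases h2 : x (b t) <;> by_cases h3 : x (c u) <;> simp [h1, h2, h3]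

lemma run_bilinear {h : ι} {a b : Fin w → ι} (ha : ∀ s, h ≠ a s) (hb : ∀ s, h ≠ b s)
    (hab : ∀ s t, a s ≠ b t) (θ : ℝ) (x : Bits ι) :
    run O (bilinear h a b θ) (ket x) =
      phase (if x h then θ * (num (x ∘ a) * num (x ∘ b)) else 0) • ket x := by
  rw [bilinear, run_finRange_phase O fun s => run_finRange_phase O fun t =>
    run_ccphase O (ha s) (hb t) (hab s t) _ _ x]
  congr 2
  by_cases h0 : x h
  · rw [if_pos h0, num_cast, num_cast, Finset.sum_mul_sum, Finset.mul_sum]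
    refine Finset.sum_congr rfl fun s _ => ?_
    rw [Finset.mul_sum]
    refine Finset.sum_congr rfl fun t _ => ?_
    simp only [Function.comp_apply]
    by_cases h1 : x (a s) <;> by_cases h2 : x (b t) <;> simp [h0, h1, h2]
  · simp [h0]

end Multilinear

/-! ### Loading the inputs and the phase oracle -/

/-- Flip the qubits of a register according to the binary digits of `a`. -/
def write {ι : Type} {w : ℕ} (r : Fin w → ι) (a : ℕ) : List (Op n p ι) :=
  (List.finRange w).flatMap fun i => if binary w a i then [flip (r i)] else []

/-- Copy the index of the one-hot register to the row register. -/
def loadRow : List (Op n p (Reg ℓ n p)) :=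
  (List.finRange n).flatMap fun j : Fin n => (List.finRange (width n)).flatMap fun i =>
    if binary (width n) j i then cnot (.hot j) (.row i) else []

/-- Load the vector `v`. -/
def loadVec : List (Op n p (Reg ℓ n p)) :=
  (List.finRange n).flatMap fun k : Fin n => conj (write .row k) [.queryV false (vecEmb k)]

/-- Load the vector `b`. -/
def loadRhs : List (Op n p (Reg ℓ n p)) :=
  (List.finRange n).flatMap fun k : Fin n => conj (write .row k) [.queryB false (rhsEmb k)]

/-- Multiply `|j, y⟩` by `e ^ (2 π i y (M v - b)_j / p)`. -/
def phaseOracle : List (Op n p (Reg ℓ n p)) :=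
  conj loadRow ((List.finRange n).flatMap fun k : Fin n =>
    -- Two matrix queries per column: one writes the entry, its adjoint erases it.
    conj (write .col k ++ [.queryM false matEmb]) (trilinear .y (.vec k) .val (2 * Real.pi / p))) ++
  (List.finRange n).flatMap fun j : Fin n => bilinear (.hot j) .y (.rhs j) (-(2 * Real.pi / p))

section Load

variable (O : Oracles n p)

lemma run_write_row (c : Conf ℓ n p) (hc : c.row = fun _ => false) (a : ℕ) :
    run O (write .row a) (ket c.bits) = ket (Conf.bits { c with row := binary _ a }) := by
  have := run_flatMap_update O (fun v => Conf.bits { c with row := v })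
    (fun i => if binary (width n) a i then [flip (.row i)] else []) (fun _ => false)
    (binary (width n) a) (by
      intro i v hv
      split_ifs with h
      · rw [run_flip, update_row]
        simp [Conf.bits, hv, h]
      · rw [run_nil]
        congr 3
        simp only [Bool.not_eq_true] at h
        rw [h, ← hv, Function.update_eq_self])
  rw [← this, ← hc]
  rfl

lemma run_write_col (c : Conf ℓ n p) (hc : c.col = fun _ => false) (a : ℕ) :
    run O (write .col a) (ket c.bits) = ket (Conf.bits { c with col := binary _ a }) := by
  have := run_flatMap_update O (fun v => Conf.bits { c with col := v })
    (fun i => if binary (width n) a i then [flip (.col i)] else []) (fun _ => false)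
    (binary (width n) a) (by
      intro i v hv
      split_ifs with h
      · rw [run_flip, update_col]
        simp [Conf.bits, hv, h]
      · rw [run_nil]
        congr 3
        simp only [Bool.not_eq_true] at h
        rw [h, ← hv, Function.update_eq_self])
  rw [← this, ← hc]
  rfl

lemma run_loadRow (c : Conf ℓ n p) (j : Fin n) (hc : c.row = fun _ => false)
    (hj : c.hot = fun i => decide (i = j)) :
    run O loadRow (ket c.bits) = ket (Conf.bits { c with row := binary _ j }) := by
  have := run_flatMap_update O
    -- The bit `v k` records whether block `k` has been run; only block `j` has an effect.
    (fun v : Fin n → Bool => Conf.bits { c with row := if v j then binary _ j else c.row })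
    (fun j : Fin n => (List.finRange (width n)).flatMap fun i =>
      if binary (width n) j i then cnot (.hot j) (.row i) else []) (fun _ => false)
    (fun _ => true) (by
      intro k v hv
      by_cases hk : k = j
      · subst hk
        rw [hv]
        simp only [Function.update_self, if_true, Bool.false_eq_true, if_false, hc]
        refine run_flatMap_update O (fun u => Conf.bits { c with row := u }) _ _ _ ?_
        intro i u hu
        split_ifs with h
        · rw [run_cnot O (by simp), update_row]
          simp [Conf.bits, hu, h, hj]
        · simp only [Bool.not_eq_true] at h
          rw [h, ← hu, Function.update_eq_self, run_nil]
      · rw [Function.update_of_ne (Ne.symm hk)]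
        generalize (if v j then binary (width n) j else c.row) = r
        -- For `k ≠ j` the control qubit is `0`, so the block fixes the state; `Unit` expresses that
        -- nothing changes.
        refine run_flatMap_update O (fun _ : Fin (width n) → Unit => Conf.bits { c with row := r })
          _ (fun _ => ()) (fun _ => ()) ?_
        intro i u hu
        split_ifs with h
        · rw [run_cnot O (by simp), update_row]
          simp [Conf.bits, hj, hk]
        · rfl)
  simp only [Bool.false_eq_true, if_false, if_true] at this
  exact this

lemma put_bits {κ : Type} [Fintype κ] [DecidableEq κ] (e : κ ↪ Reg ℓ n p) (u : Bits κ)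
    {c d : Conf ℓ n p} (h1 : d.bits ∘ e = u) (h2 : ∀ i, (∀ a, e a ≠ i) → d.bits i = c.bits i) :
    put e u c.bits = d.bits :=
  ((eq_put_iff e u c.bits d.bits).2 ⟨h2, h1.symm⟩).symm

lemma run_queryM {M : Matrix (Fin n) (Fin n) (ZMod p)} (hM : IsMatOracle M O.UM)
    (c : Conf ℓ n p) (j k : Fin n) (hr : c.row = binary _ j) (hk : c.col = binary _ k)
    (hz : c.val = fun _ => false) :
    run O [.queryM false matEmb] (ket c.bits) =
      ket (Conf.bits { c with val := binary _ (M j k).val }) := by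
  have h := hM j k 0
  rw [zero_add] at h
  rw [run_cons, run_nil]
  simp only [Op.mat, orAdjoint, Bool.false_eq_true, if_false]
  rw [place_mulVec_ket_of (u := matCode j k (M j k))]
  · congr 1
    refine put_bits _ _ ?_ ?_
    · ext (a | a | a) <;> simp [matCode, Conf.bits, hr, hk]
    · intro i hi
      cases i with
      | val s => exact absurd rfl (hi (.inr (.inr s)))
      | _ => rfl
  · rw [← h]
    congr 2
    ext (a | a | a) <;> simp [matCode, Conf.bits, hr, hk, hz, binary]

lemma run_loadVec {v : Fin n → ZMod p} (hv : IsVecOracle v O.Uv)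
    (c : Conf ℓ n p) (hr : c.row = fun _ => false) (hz : c.vec = fun _ _ => false) :
    run O loadVec (ket c.bits) =
      ket (Conf.bits { c with vec := fun k => binary _ (v k).val }) := by
  have := run_flatMap_update O (fun u => Conf.bits { c with vec := u })
    (fun k : Fin n => conj (write .row k) [.queryV false (vecEmb k)]) (fun _ _ => false)
    (fun k => binary _ (v k).val) (by
      intro k u hu
      refine run_conj O ?_
      rw [run_write_row O { c with vec := u } hr, run_write_row O { c with vec := Function.update u k _ } hr, run_cons,
        run_nil]
      simp only [Op.mat, orAdjoint, Bool.false_eq_true, if_false]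
      have h := hv k 0
      rw [zero_add] at h
      rw [place_mulVec_ket_of (u := vecCode k (v k))]
      · congr 1
        refine put_bits _ _ ?_ ?_
        · ext (a | a) <;> simp [vecCode, Conf.bits]
        · intro i hi
          cases i with
          | vec k' s =>
            have hk' : k' ≠ k := by
              rintro rfl
              exact hi (.inr s) rfl
            simp [Conf.bits, Function.update_of_ne hk']
          | _ => rfl
      · rw [← h]
        congr 2
        ext (a | a) <;> simp [vecCode, Conf.bits, hu, binary])
  rw [← this, ← hz]
  rfl

lemma run_loadRhs {b : Fin n → ZMod p} (hb : IsVecOracle b O.Ub)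
    (c : Conf ℓ n p) (hr : c.row = fun _ => false) (hz : c.rhs = fun _ _ => false) :
    run O loadRhs (ket c.bits) =
      ket (Conf.bits { c with rhs := fun k => binary _ (b k).val }) := by
  have := run_flatMap_update O (fun u => Conf.bits { c with rhs := u })
    (fun k : Fin n => conj (write .row k) [.queryB false (rhsEmb k)]) (fun _ _ => false)
    (fun k => binary _ (b k).val) (by
      intro k u hu
      refine run_conj O ?_
      rw [run_write_row O { c with rhs := u } hr, run_write_row O { c with rhs := Function.update u k _ } hr, run_cons,
        run_nil]
      simp only [Op.mat, orAdjoint, Bool.false_eq_true, if_false]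
      have h := hb k 0
      rw [zero_add] at h
      rw [place_mulVec_ket_of (u := vecCode k (b k))]
      · congr 1
        refine put_bits _ _ ?_ ?_
        · ext (a | a) <;> simp [vecCode, Conf.bits]
        · intro i hi
          cases i with
          | rhs k' s =>
            have hk' : k' ≠ k := by
              rintro rfl
              exact hi (.inr s) rfl
            simp [Conf.bits, Function.update_of_ne hk']
          | _ => rfl
      · rw [← h]
        congr 2
        ext (a | a) <;> simp [vecCode, Conf.bits, hu, binary])
  rw [← this, ← hz]
  rfl

/-- The standard configuration with flags `F`, row index `j` and multiplier `y`. -/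
def std (v b : Fin n → ZMod p) (F : Fin ℓ → Bool) (c : Fin n × (Fin (width p) → Bool)) :
    Conf ℓ n p where
  flag := F
  hot := fun i => decide (i = c.1)
  y := c.2
  row := fun _ => false
  col := fun _ => false
  val := fun _ => false
  vec := fun k => binary _ (v k).val
  rhs := fun k => binary _ (b k).val
  anc := fun _ => false
  out := false

/-- An integer that represents the `j`-th entry of `M v - b`. -/
def residue (M : Matrix (Fin n) (Fin n) (ZMod p)) (v b : Fin n → ZMod p) (j : Fin n) : ℤ :=
  ∑ k, ((v k).val : ℤ) * (M j k).val - (b j).val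

lemma residue_cast [NeZero p] (M : Matrix (Fin n) (Fin n) (ZMod p)) (v b : Fin n → ZMod p)
    (j : Fin n) : ((residue M v b j : ℤ) : ZMod p) = M.mulVec v j - b j := by
  simp [residue, Matrix.mulVec, dotProduct, mul_comm]

lemma val_lt_pow_width [NeZero p] (z : ZMod p) : z.val < 2 ^ width p :=
  (ZMod.val_lt z).trans_le (Nat.le_pow_clog (by norm_num) p)

/-- The columns contribute the phases of `y * v_k * M_jk`, the one-hot controlled part that of `- y
* b_j`; only the qubit of row `j` is set, so only one of the latter fires. -/
lemma run_phaseOracle [NeZero p] {M : Matrix (Fin n) (Fin n) (ZMod p)} (hM : IsMatOracle M O.UM)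
    (v b : Fin n → ZMod p) (F : Fin ℓ → Bool) (c : Fin n × (Fin (width p) → Bool)) :
    run O phaseOracle (ket (std v b F c).bits) =
      phase (2 * Real.pi / p * (num c.2 * residue M v b c.1)) • ket (std v b F c).bits := by
  have h1 : run O (conj loadRow ((List.finRange n).flatMap fun k : Fin n =>
      conj (write .col k ++ [.queryM false matEmb])
        (trilinear .y (.vec k) .val (2 * Real.pi / p)))) (ket (std v b F c).bits) =
      phase (∑ k, 2 * Real.pi / p * (num c.2 * (v k).val * (M c.1 k).val)) •
        ket (std v b F c).bits := by
    refine run_conj_smul O (run_loadRow O _ c.1 rfl rfl) (run_finRange_phase O fun k => ?_)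
    refine run_conj_smul O (ψ' := ket (Conf.bits { std v b F c with
      row := binary _ c.1, col := binary _ k, val := binary _ (M c.1 k).val })) ?_ ?_
    · rw [run_append, run_write_col O _ rfl, run_queryM O hM _ c.1 k rfl rfl rfl]
    · rw [run_trilinear O (by simp) (by simp) (by simp)]
      congr 5
      · congr 1
        exact num_binary (val_lt_pow_width _)
      · exact num_binary (val_lt_pow_width _)
  have h2 : run O ((List.finRange n).flatMap fun j : Fin n =>
      bilinear (.hot j) .y (.rhs j) (-(2 * Real.pi / p))) (ket (std v b F c).bits) =
      phase (-(2 * Real.pi / p) * (num c.2 * (b c.1).val)) • ket (std v b F c).bits := by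
    rw [run_finRange_phase O fun j => run_bilinear O (by simp) (by simp) (by simp) _ _]
    congr 2
    rw [Finset.sum_eq_single c.1]
    · rw [if_pos (by simp [std, Conf.bits])]
      congr 3
      exact num_binary (val_lt_pow_width _)
    · intro j _ hj
      rw [if_neg (by simpa [std, Conf.bits] using hj)]
    · simp
  rw [phaseOracle, run_append, h1, map_smul, h2, smul_smul, ← phase_add]
  congr 2
  have h3 : ∑ k, 2 * Real.pi / p * ((num c.2 : ℝ) * (v k).val * (M c.1 k).val) =
      2 * Real.pi / p * (num c.2 * ∑ k, ((v k).val : ℝ) * (M c.1 k).val) := by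
    rw [Finset.mul_sum, Finset.mul_sum]
    exact Finset.sum_congr rfl fun k _ => by ring
  rw [h3, residue]
  push_cast
  ring

end Load

/-! ### Products of cosines -/

/-- Doubling `x` repeatedly, some `2 ^ i * x` with `i < ℓ` lies in `(π / 4, π / 2]`. That factor is
at most `1 / 2` and the others are at most `1`. -/
lemma prod_cos_sq_le (ℓ : ℕ) (x : ℝ) (h0 : 0 < x) (h1 : x ≤ Real.pi / 2)
    (h2 : Real.pi / 2 < 2 ^ ℓ * x) :
    ∏ i ∈ Finset.range ℓ, Real.cos (2 ^ i * x) ^ 2 ≤ 1 / 2 := by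
  induction ℓ generalizing x with
  | zero =>
    rw [pow_zero, one_mul] at h2
    linarith
  | succ ℓ ih =>
    rw [Finset.prod_range_succ']
    simp only [pow_zero, one_mul]
    by_cases hx : x ≤ Real.pi / 4
    · have h := ih (2 * x) (by linarith) (by linarith) (by rw [pow_succ] at h2; linarith)
      have e : ∏ k ∈ Finset.range ℓ, Real.cos (2 ^ (k + 1) * x) ^ 2 =
          ∏ k ∈ Finset.range ℓ, Real.cos (2 ^ k * (2 * x)) ^ 2 :=
        Finset.prod_congr rfl fun k _ => by rw [pow_succ (2 : ℝ), mul_assoc]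
      rw [e]
      refine (mul_le_of_le_one_right (Finset.prod_nonneg fun _ _ => sq_nonneg _) ?_).trans h
      exact Real.cos_sq_le_one x
    · have h3 : Real.cos x ^ 2 ≤ 1 / 2 := by
        rw [Real.cos_sq]
        have : Real.cos (2 * x) ≤ 0 :=
          Real.cos_nonpos_of_pi_div_two_le_of_le (by linarith) (by linarith)
        linarith
      refine (mul_le_of_le_one_left (sq_nonneg _) ?_).trans h3
      exact Finset.prod_le_one (fun _ _ => sq_nonneg _) fun _ _ => Real.cos_sq_le_one _

lemma cos_sq_add_int_mul_pi (x : ℝ) (m : ℤ) : Real.cos (x + m * Real.pi) ^ 2 = Real.cos x ^ 2 := by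
  rw [Real.cos_sq, Real.cos_sq, show 2 * (x + m * Real.pi) = 2 * x + m * (2 * Real.pi) by ring,
    Real.cos_add_int_mul_two_pi]

lemma prod_cos_eq_one {p : ℕ} (hp : p.Prime) {d : ℤ} (hd : (p : ℤ) ∣ d) (w : ℕ) :
    ∏ s ∈ Finset.range w, Real.cos (2 ^ s * (2 * Real.pi / p * d)) = 1 := by
  obtain ⟨m, rfl⟩ := hd
  refine Finset.prod_eq_one fun s _ => ?_
  have hp0 : (p : ℝ) ≠ 0 := by exact_mod_cast hp.ne_zero
  have : (2 : ℝ) ^ s * (2 * Real.pi / p * ((p * m : ℤ) : ℝ)) =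
      ((2 ^ s * m : ℤ) : ℝ) * (2 * Real.pi) := by
    push_cast
    field_simp
  rw [this, Real.cos_int_mul_two_pi]

lemma abs_prod_cos_le_one (w : ℕ) (x : ℝ) :
    |∏ s ∈ Finset.range w, Real.cos (2 ^ s * x)| ≤ 1 := by
  rw [Finset.abs_prod]
  exact Finset.prod_le_one (fun _ _ => abs_nonneg _) fun _ _ => Real.abs_cos_le_one _

/-- For odd `p` the squares of the factors are `cos² (2 ^ s * π x)`, with `x` the distance from `2 d
/ p` to the nearest integer. Since `p ∤ 2 d`, this distance is at least `1 / p`, and `width p`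
doublings suffice for `prod_cos_sq_le`. -/
lemma prod_cos_le {p : ℕ} (hp : p.Prime) {d : ℤ} (hd : ¬ (p : ℤ) ∣ d) :
    ∏ s ∈ Finset.range (width p), Real.cos (2 ^ s * (2 * Real.pi / p * d)) ≤ 3 / 4 := by
  have hp0 : (0 : ℝ) < p := by exact_mod_cast hp.pos
  rcases hp.eq_two_or_odd' with rfl | hodd
  -- For `p = 2` squaring would lose everything: the only factor is `cos (π d) = -1`, and its sign
  -- is what counts.
  · have hw : width 2 = 1 := by norm_num [width, Nat.clog]
    rw [hw, Finset.prod_range_one]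
    obtain ⟨m, rfl⟩ := Int.not_even_iff_odd.1 (fun h => hd (by exact_mod_cast h.two_dvd))
    have : (2 : ℝ) ^ 0 * (2 * Real.pi / (2 : ℕ) * ((2 * m + 1 : ℤ) : ℝ)) =
        Real.pi + m * (2 * Real.pi) := by push_cast; ring
    rw [this, Real.cos_add_int_mul_two_pi, Real.cos_pi]
    norm_num
  · set m : ℤ := round (2 * (d : ℝ) / p) with hm
    set x : ℝ := |2 * (d : ℝ) / p - m| with hx
    have hx1 : x ≤ 1 / 2 := abs_sub_round _
    have hx2 : 1 / p ≤ x := by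
      have h1 : (2 * d - p * m : ℤ) ≠ 0 := by
        intro h
        have h2 : (p : ℤ) ∣ 2 * d := ⟨m, by linarith⟩
        rcases (Nat.prime_iff_prime_int.1 hp).dvd_or_dvd h2 with h3 | h3
        · have h4 : p ∣ 2 := by exact_mod_cast h3
          have h5 := (Nat.prime_dvd_prime_iff_eq hp Nat.prime_two).1 h4
          subst h5
          exact absurd hodd (by decide)
        · exact hd h3
      have h2 : (1 : ℝ) ≤ |((2 * d - p * m : ℤ) : ℝ)| := by
        exact_mod_cast Int.one_le_abs h1
      have h3 : x = |((2 * d - p * m : ℤ) : ℝ)| / p := by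
        rw [hx, ← abs_of_pos hp0, ← abs_div, abs_of_pos hp0]
        congr 1
        push_cast
        field_simp
      rw [h3]
      gcongr
    have hx0 : 0 < x := lt_of_lt_of_le (by positivity) hx2
    have hpi := Real.pi_pos
    have key := prod_cos_sq_le (width p) (Real.pi * x) (by positivity) (by nlinarith) (by
      have h1 : (p : ℝ) ≤ 2 ^ width p := by exact_mod_cast Nat.le_pow_clog (by norm_num) p
      have h2 : 1 ≤ 2 ^ width p * x := by
        calc (1 : ℝ) = p * (1 / p) := by field_simp
          _ ≤ _ := by gcongr
      nlinarith)
    have e : ∀ s, Real.cos (2 ^ s * (2 * Real.pi / p * d)) ^ 2 =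
        Real.cos (2 ^ s * (Real.pi * x)) ^ 2 := by
      intro s
      have h1 : (2 : ℝ) ^ s * (2 * Real.pi / p * d) =
          2 ^ s * (Real.pi * (2 * (d : ℝ) / p - m)) + ((2 ^ s * m : ℤ) : ℝ) * Real.pi := by
        push_cast; ring
      rw [h1, cos_sq_add_int_mul_pi, ← Real.cos_abs, abs_mul, abs_mul, ← hx,
        abs_of_pos hpi, abs_of_pos (by positivity : (0 : ℝ) < 2 ^ s)]
    simp only [← e] at key
    rw [Finset.prod_pow] at key
    -- A real number with square at most `1 / 2` is below `3 / 4`.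
    nlinarith

/-! ### Amplitude amplification in a Hilbert space -/

section Hilbert

variable {H : Type*} [NormedAddCommGroup H] [InnerProductSpace ℂ H]

local notation "⟪" x ", " y "⟫" => inner ℂ x y

/-- The hypothesis says that `χ` is a combination of eigenvectors of `T` with eigenvalues `exp (± i
β)`. It gives `Re ⟪χ, T χ⟫ = cos β * ‖χ‖²`, and `(1 + cos β) / 2 = cos² (β / 2)`. -/
lemma norm_half_add_sq (T : H ≃ₗᵢ[ℂ] H) (β : ℝ) (χ : H)
    (h : T χ + T.symm χ = ((2 * Real.cos β : ℝ) : ℂ) • χ) :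
    ‖(1 / 2 : ℂ) • (χ + T χ)‖ ^ 2 = Real.cos (β / 2) ^ 2 * ‖χ‖ ^ 2 := by
  have h1 : ⟪χ, T χ⟫ + ⟪T χ, χ⟫ = ((2 * Real.cos β * ‖χ‖ ^ 2 : ℝ) : ℂ) := by
    have : ⟪T χ, χ⟫ = ⟪χ, T.symm χ⟫ := by
      rw [← T.inner_map_map χ (T.symm χ), T.apply_symm_apply]
    rw [this, ← inner_add_right, h, inner_smul_right, inner_self_eq_norm_sq_to_K]
    push_cast
    rfl
  have h2 : 2 * Complex.re ⟪χ, T χ⟫ = 2 * Real.cos β * ‖χ‖ ^ 2 := by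
    have := congrArg Complex.re h1
    rw [Complex.add_re, ← inner_conj_symm (T χ) χ, Complex.conj_re, Complex.ofReal_re] at this
    linarith
  rw [norm_smul, mul_pow, norm_add_sq (𝕜 := ℂ), T.norm_map]
  have h3 : RCLike.re ⟪χ, T χ⟫ = Complex.re ⟪χ, T χ⟫ := rfl
  rw [h3, h2, Real.cos_sq (β / 2), mul_div_cancel₀ β (two_ne_zero)]
  norm_num
  ring

/-- After the first factor the same situation recurs with `T²`, `2 β` and the vector `(χ + T χ) /
2`. -/
lemma norm_foldl_half_add_sq (ℓ : ℕ) (T : H ≃ₗᵢ[ℂ] H) (β : ℝ) (χ : H)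
    (h : T χ + T.symm χ = ((2 * Real.cos β : ℝ) : ℂ) • χ) :
    ‖(List.finRange ℓ).foldl (fun φ (i : Fin ℓ) => (1 / 2 : ℂ) • (φ + T^[2 ^ (i : ℕ)] φ)) χ‖ ^ 2 =
      (∏ i ∈ Finset.range ℓ, Real.cos (2 ^ i * (β / 2)) ^ 2) * ‖χ‖ ^ 2 := by
  induction ℓ generalizing T β χ with
  | zero => simp
  | succ ℓ ih =>
    rw [List.finRange_succ, List.foldl_cons, List.foldl_map]
    have e : ∀ i : Fin ℓ, (T^[2 ^ (i.succ : ℕ)] : H → H) = (T.trans T)^[2 ^ (i : ℕ)] := by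
      intro i
      rw [Fin.val_succ, pow_succ', Function.iterate_mul]
      rfl
    simp only [e, Fin.val_zero, pow_zero, Function.iterate_one]
    rw [ih (T.trans T) (2 * β), norm_half_add_sq T β χ h, Finset.prod_range_succ']
    · have e2 : ∀ k : ℕ, (2 : ℝ) ^ k * (2 * β / 2) = 2 ^ (k + 1) * (β / 2) := fun k => by ring
      simp only [e2, pow_zero, one_mul]
      ring
    · have h1 : T (T χ) + χ = ((2 * Real.cos β : ℝ) : ℂ) • T χ := by
        have := congrArg T h
        simpa using this
      have h2 : χ + T.symm (T.symm χ) = ((2 * Real.cos β : ℝ) : ℂ) • T.symm χ := by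
        have := congrArg T.symm h
        simpa using this
      -- This is `T² + T⁻² = (T + T⁻¹)² - 2` against `2 cos 2β = (2 cos β)² - 2`.
      have h3 : ∀ φ : H, T φ + T.symm φ = ((2 * Real.cos β : ℝ) : ℂ) • φ →
          T (T φ) + T.symm (T.symm φ) = ((2 * Real.cos (2 * β) : ℝ) : ℂ) • φ := by
        intro φ hφ
        have h1 : T (T φ) + φ = ((2 * Real.cos β : ℝ) : ℂ) • T φ := by
          simpa using congrArg T hφ
        have h2 : φ + T.symm (T.symm φ) = ((2 * Real.cos β : ℝ) : ℂ) • T.symm φ := by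
          simpa using congrArg T.symm hφ
        have h4 : T (T φ) + T.symm (T.symm φ) =
            ((2 * Real.cos β : ℝ) : ℂ) • (T φ + T.symm φ) - (2 : ℂ) • φ := by
          rw [smul_add, ← h1, ← h2, two_smul]
          abel
        rw [h4, hφ, smul_smul, ← sub_smul, Real.cos_two_mul]
        congr 1
        push_cast
        ring
      -- The eigenvalue relation passes from `χ` to `χ + T χ` because `T` commutes with `T + T⁻¹`.
      refine h3 _ ?_
      rw [map_smul, map_smul, map_add, map_add, ← smul_add, smul_comm]
      congr 1
      rw [T.symm_apply_apply, smul_add, ← h, ← h1]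
      abel

/-- Since `R (R s) = s`, the formula for `G` gives `G (R s) = 2 s - s = s`, so `G⁻¹ s = R s`, which
cancels the term `- R s` of `G s`. -/
lemma grover_add_symm (G : H ≃ₗᵢ[ℂ] H) (R : H → H) (s : H) (hs : ‖s‖ = 1)
    (hR : R (R s) = s) (hG : ∀ φ, G φ = (2 * ⟪s, R φ⟫) • s - R φ) :
    G s + G.symm s = (2 * ⟪s, R s⟫) • s := by
  have h : G.symm s = R s := by
    rw [LinearIsometryEquiv.symm_apply_eq, hG, hR, inner_self_eq_norm_sq_to_K, hs]
    norm_num [two_smul]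
  rw [h, hG]
  abel

lemma phase_pi_div_three : phase (Real.pi / 3) = (1 / 2 : ℂ) + (Real.sqrt 3 / 2 : ℂ) * Complex.I := by
  rw [phase, Complex.exp_mul_I, ← Complex.ofReal_cos, ← Complex.ofReal_sin, Real.cos_pi_div_three,
    Real.sin_pi_div_three]
  push_cast
  rfl

/-- For a primitive sixth root of unity `q` the conjugate is `1 - q`. This relation, special to the
angle `π / 3`, makes the terms of order zero cancel in `fixed_point_step`. -/
lemma phase_neg_pi_div_three :
    phase (-(Real.pi / 3)) = 1 - phase (Real.pi / 3) := by
  rw [← conj_phase, phase_pi_div_three]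
  apply Complex.ext
  · norm_num
  · simp

lemma norm_phase_pi_div_three_sub_one : ‖phase (Real.pi / 3) - 1‖ = 1 := by
  rw [← norm_neg, neg_sub, ← phase_neg_pi_div_three, norm_phase]

/-- One step of the `π / 3` fixed-point search cubes the weight of the subspace `range P`. -/
lemma fixed_point_step (U : H ≃ₗᵢ[ℂ] H) (P : H →ₗ[ℂ] H) (s : H)
    (hP : ∀ φ, P (P φ) = P φ) (hP2 : ∀ φ, ⟪φ, P φ⟫ = ((‖P φ‖ ^ 2 : ℝ) : ℂ)) (hs : ‖s‖ = 1)
    (Rt Rs : H → H)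
    (hRt : ∀ φ, Rt φ = φ + (phase (-(Real.pi / 3)) - 1) • P φ)
    (hRs : ∀ φ, Rs φ = φ + ((phase (Real.pi / 3) - 1) * ⟪s, φ⟫) • s) :
    ‖P (U (Rs (U.symm (Rt (U s)))))‖ ^ 2 = (‖P (U s)‖ ^ 2) ^ 3 := by
  set q := phase (Real.pi / 3) with hq
  set φ := U s with hφ
  set δ : ℝ := ‖P φ‖ ^ 2 with hδ
  have h1 : ⟪s, U.symm (Rt φ)⟫ = 1 + (phase (-(Real.pi / 3)) - 1) * (δ : ℂ) := by
    rw [← U.inner_map_map, U.apply_symm_apply, ← hφ, hRt, inner_add_right, inner_smul_right, hP2,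
      inner_self_eq_norm_sq_to_K, hφ, U.norm_map, hs]
    norm_num [hδ, hφ]
  -- The coefficient is `(1 - q) + (q - 1) * (1 - q δ)`; only the term in `δ` survives, and `q - 1`
  -- and `q` have modulus one.
  have h2 : P (U (Rs (U.symm (Rt φ)))) = (-((q - 1) * q * (δ : ℂ))) • P φ := by
    rw [hRs, map_add, map_smul, U.apply_symm_apply, ← hφ, map_add, map_smul, hRt φ, map_add,
      map_smul, hP, ← hRt φ, h1, phase_neg_pi_div_three, ← hq]
    module
  rw [h2, norm_smul, norm_neg, norm_mul, norm_mul, norm_phase_pi_div_three_sub_one, hq, norm_phase,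
    mul_pow, ← hδ, Complex.norm_real, Real.norm_of_nonneg (by positivity)]
  ring

end Hilbert

/-! ### Isometries realized by circuits -/

section Isometry

variable {α κ : Type} [Fintype α] [DecidableEq α] [Fintype κ] [DecidableEq κ]

/-- Distinct labels give orthonormal states, so measurement probabilities are read off from the
coefficients; `P` is the measured event. -/
lemma sum_ite_sum_ket {g : α → Bits κ} (hg : Function.Injective g) (f : α → ℂ)
    (P : Bits κ → Prop) [DecidablePred P] :
    (∑ x, if P x then ‖(∑ a, f a • ket (g a)) x‖ ^ 2 else 0) =
      ∑ a, if P (g a) then ‖f a‖ ^ 2 else 0 := by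
  symm
  refine Fintype.sum_of_injective g hg _ _ ?_ ?_
  · intro x hx
    have : (∑ a, f a • ket (g a)) x = 0 := by
      rw [Finset.sum_apply]
      refine Finset.sum_eq_zero fun a _ => ?_
      rw [Pi.smul_apply, ket_apply, if_neg (fun h => hx ⟨a, h.symm⟩), smul_zero]
    rw [this]
    simp
  · intro a
    congr 3
    rw [Finset.sum_apply, Finset.sum_eq_single a]
    · simp [ket_apply]
    · intro b _ hb
      rw [Pi.smul_apply, ket_apply, if_neg (fun h => hb (hg h).symm), smul_zero]
    · simp

lemma normSq_sum_ket {g : α → Bits κ} (hg : Function.Injective g) (f : α → ℂ) :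
    normSq (∑ a, f a • ket (g a)) = ∑ a, ‖f a‖ ^ 2 := by
  simpa [normSq] using sum_ite_sum_ket hg f fun _ => True

/-- `T` inherits linearity and norm preservation from `A` because `L` is injective and preserves
norms; finite dimension makes it onto. Knowing the effect of a circuit on encoded states thus
already provides a unitary on the small space. -/
lemma exists_isometry {H : Type} [NormedAddCommGroup H] [InnerProductSpace ℂ H]
    [FiniteDimensional ℂ H] (L : H →ₗ[ℂ] (α → ℂ)) (hL : ∀ φ, normSq (L φ) = ‖φ‖ ^ 2)
    (A : (α → ℂ) →ₗ[ℂ] (α → ℂ)) (hA : ∀ ψ, normSq (A ψ) = normSq ψ) (T : H → H)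
    (h : ∀ φ, A (L φ) = L (T φ)) : ∃ T' : H ≃ₗᵢ[ℂ] H, ∀ φ, T' φ = T φ := by
  have hinj : ∀ φ ψ, L φ = L ψ → φ = ψ := by
    intro φ ψ hφ
    have h1 := hL (φ - ψ)
    rw [map_sub, hφ, sub_self] at h1
    have h2 : normSq (0 : α → ℂ) = 0 := by simp [normSq]
    rw [h2] at h1
    exact sub_eq_zero.1 (norm_eq_zero.1 (pow_eq_zero_iff two_ne_zero |>.1 h1.symm))
  let T₀ : H →ₗᵢ[ℂ] H :=
    { toFun := T
      map_add' := fun φ ψ => hinj _ _ (by rw [← h, map_add, map_add, map_add, h, h])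
      map_smul' := fun c φ => hinj _ _ (by
        rw [← h, map_smul, map_smul, h, RingHom.id_apply, map_smul])
      norm_map' := fun φ => by
        have h1 := hL (T φ)
        rw [← h, hA, hL] at h1
        exact (pow_left_inj₀ (norm_nonneg _) (norm_nonneg _) two_ne_zero).1 h1.symm }
  exact ⟨T₀.toLinearIsometryEquiv rfl, fun φ => rfl⟩

end Isometry

/-- The sign by which the Hadamard gate multiplies `|1⟩`. -/
def sgn (b : Bool) : ℂ := if b then -1 else 1

/-- Pairing each `u` with its flip at `s` turns the action on basis labels into the action on
coefficients, the Hadamard matrix being symmetric. -/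
lemma hadamard_sum {V W : Type*} [AddCommGroup V] [Module ℂ V] [AddCommGroup W] [Module ℂ W]
    {m : ℕ} (R : V →ₗ[ℂ] V) (K : (Fin m → Bool) → W →ₗ[ℂ] V) (s : Fin m) (a : ℂ)
    (h : ∀ u w, R (K u w) = a • (K (Function.update u s false) w +
      sgn (u s) • K (Function.update u s true) w))
    (Φ : (Fin m → Bool) → W) :
    R (∑ u, K u (Φ u)) = ∑ u, K u (a • (Φ (Function.update u s false) +
      sgn (u s) • Φ (Function.update u s true))) := by
  have pair : ∀ f : (Fin m → Bool) → V, ∑ u, f u = (1 / 2 : ℂ) • ∑ u,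
      (f (Function.update u s false) + f (Function.update u s true)) := by
    intro f
    have h1 : ∀ u : Fin m → Bool,
        f (Function.update u s false) + f (Function.update u s true) =
          f u + f (Function.update u s (!u s)) := by
      intro u
      cases hu : u s
      · rw [← hu, Function.update_eq_self, hu]; rfl
      · rw [← hu, Function.update_eq_self, hu, add_comm]; rfl
    have h2 : ∑ u, f (Function.update u s (!u s)) = ∑ u, f u := by
      have hinv : Function.Involutive fun u : Fin m → Bool => Function.update u s (!u s) := by
        intro u; simp
      exact Fintype.sum_equiv hinv.toPerm _ _ fun u => rfl
    simp only [h1, Finset.sum_add_distrib, h2, ← two_smul ℂ (∑ u, f u), smul_smul]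
    norm_num
  rw [map_sum, pair, pair fun u => K u _]
  congr 1
  refine Finset.sum_congr rfl fun u _ => ?_
  simp only [h, Function.update_idem, Function.update_self, sgn, map_smul, map_add]
  simp only [if_true, Bool.false_eq_true, if_false]
  module

/-! ### The state space of the search -/

variable {ℓ n p : ℕ}

/-- A row index and a multiplier. -/
abbrev Item (n p : ℕ) : Type := Fin n × (Fin (width p) → Bool)

/-- States of the search without flags. -/
abbrev Space (n p : ℕ) : Type := EuclideanSpace ℂ (Item n p)

/-- States of the search with flags. -/
abbrev FlagSpace (ℓ n p : ℕ) : Type := PiLp 2 fun _ : Fin ℓ → Bool => Space n p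

lemma std_injective (v b : Fin n → ZMod p) :
    Function.Injective fun x : (Fin ℓ → Bool) × Item n p => (std v b x.1 x.2).bits := by
  rintro ⟨F, j, y⟩ ⟨F', j', y'⟩ h
  have h1 : F = F' := by
    ext i; exact congrFun h (.flag i)
  have h2 : y = y' := by
    ext i; exact congrFun h (.y i)
  have h3 : j = j' := by
    have := congrFun h (.hot j)
    simpa [std, Conf.bits] using this
  rw [h1, h2, h3]

/-- Amplitudes of the states with flags `F`. -/
def embFun (v b : Fin n → ZMod p) (F : Fin ℓ → Bool) :
    (Item n p → ℂ) →ₗ[ℂ] (Bits (Reg ℓ n p) → ℂ) where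
  toFun f := ∑ c, f c • ket (std v b F c).bits
  map_add' f g := by simp [add_smul, Finset.sum_add_distrib]
  map_smul' a f := by simp [mul_smul, Finset.smul_sum]

lemma embFun_apply (v b : Fin n → ZMod p) (F : Fin ℓ → Bool) (f : Item n p → ℂ) :
    embFun v b F f = ∑ c, f c • ket (std v b F c).bits := rfl

lemma embFun_single (v b : Fin n → ZMod p) (F : Fin ℓ → Bool) (c : Item n p) :
    embFun v b F (Pi.single c 1) = ket (std v b F c).bits := by
  rw [embFun_apply, Finset.sum_eq_single c] <;> simp +contextual

/-- The state with flags `F` given by a vector of the search space. -/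
def emb (v b : Fin n → ZMod p) (F : Fin ℓ → Bool) :
    Space n p →ₗ[ℂ] (Bits (Reg ℓ n p) → ℂ) :=
  embFun v b F ∘ₗ (WithLp.linearEquiv 2 ℂ (Item n p → ℂ)).toLinearMap

lemma emb_apply (v b : Fin n → ZMod p) (F : Fin ℓ → Bool) (φ : Space n p) :
    emb v b F φ = ∑ c, φ c • ket (std v b F c).bits := rfl

lemma normSq_emb (v b : Fin n → ZMod p) (F : Fin ℓ → Bool) (φ : Space n p) :
    normSq (emb v b F φ) = ‖φ‖ ^ 2 := by
  rw [emb_apply, normSq_sum_ket (g := fun c => (std v b F c).bits) fun c c' h =>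
    (Prod.mk.inj (std_injective v b (a₁ := (F, c)) (a₂ := (F, c')) h)).2, EuclideanSpace.norm_sq_eq]

/-- The state given by a vector of the search space with flags. -/
def embFlag (v b : Fin n → ZMod p) : FlagSpace ℓ n p →ₗ[ℂ] (Bits (Reg ℓ n p) → ℂ) where
  toFun Φ := ∑ F, emb v b F (Φ F)
  map_add' Φ Ψ := by simp [Finset.sum_add_distrib]
  map_smul' a Φ := by simp [Finset.smul_sum]

lemma embFlag_apply (v b : Fin n → ZMod p) (Φ : FlagSpace ℓ n p) :
    embFlag v b Φ = ∑ F, emb v b F (Φ F) := rfl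

lemma embFlag_eq (v b : Fin n → ZMod p) (Φ : FlagSpace ℓ n p) :
    embFlag v b Φ = ∑ x : (Fin ℓ → Bool) × Item n p, Φ x.1 x.2 • ket (std v b x.1 x.2).bits := by
  rw [embFlag_apply, Fintype.sum_prod_type]
  rfl

lemma normSq_embFlag (v b : Fin n → ZMod p) (Φ : FlagSpace ℓ n p) :
    normSq (embFlag v b Φ) = ‖Φ‖ ^ 2 := by
  rw [embFlag_eq, normSq_sum_ket (std_injective v b), PiLp.norm_sq_eq_of_L2,
    Fintype.sum_prod_type]
  simp only [EuclideanSpace.norm_sq_eq]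

/-! ### Uniform superposition -/

/-- Rotations from the row index `z` that spread the amplitude evenly. -/
def rotations (z : Fin n) : List (Fin n) → List (Op n p (Reg ℓ n p))
  | [] => []
  | j :: L => rot (.hot z) (.hot j) (Real.arcsin (Real.sqrt (L.length + 2))⁻¹) ++ rotations z L

/-- Preparation of the uniform superposition of all row indices and multipliers. -/
def spread (z : Fin n) : List (Op n p (Reg ℓ n p)) :=
  rotations z ((List.finRange n).filter (· ≠ z)) ++
    (List.finRange (width p)).flatMap fun s => [had (.y s)]

section Spread

variable (O : Oracles n p) (v b : Fin n → ZMod p)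

/-- Action of a rotation on amplitudes. -/
def rotFun (z j : Fin n) (θ : ℝ) : (Item n p → ℂ) →ₗ[ℂ] (Item n p → ℂ) where
  toFun f c := if c.1 = z then Real.cos θ * f (z, c.2) - Real.sin θ * f (j, c.2)
    else if c.1 = j then Real.sin θ * f (z, c.2) + Real.cos θ * f (j, c.2) else f c
  map_add' f g := by
    ext c
    simp only [Pi.add_apply]
    split_ifs <;> ring
  map_smul' a f := by
    ext c
    simp only [Pi.smul_apply, smul_eq_mul, RingHom.id_apply]
    split_ifs <;> ring

lemma rotFun_apply (z j : Fin n) (θ : ℝ) (f : Item n p → ℂ) (c : Item n p) :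
    rotFun z j θ f c = if c.1 = z then Real.cos θ * f (z, c.2) - Real.sin θ * f (j, c.2)
      else if c.1 = j then Real.sin θ * f (z, c.2) + Real.cos θ * f (j, c.2) else f c := rfl

/-- In a one-hot register the two qubits are never both `1`, so the rotation stays among one-hot
states. -/
lemma run_rot_std {z j : Fin n} (hzj : z ≠ j) (θ : ℝ) (F : Fin ℓ → Bool) (c : Item n p) :
    run O (rot (.hot z) (.hot j) θ) (ket (std v b F c).bits) =
      if c.1 = z then (Real.cos θ : ℂ) • ket (std v b F (z, c.2)).bits +
          (Real.sin θ : ℂ) • ket (std v b F (j, c.2)).bits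
        else if c.1 = j then (-Real.sin θ : ℂ) • ket (std v b F (z, c.2)).bits +
          (Real.cos θ : ℂ) • ket (std v b F (j, c.2)).bits
        else ket (std v b F c).bits := by
  obtain ⟨i, y⟩ := c
  have hu : ∀ s t : Bool, Function.update (Function.update (std v b F (i, y)).bits (.hot z) s)
      (.hot j) t = Conf.bits { std v b F (i, y) with
        hot := Function.update (Function.update (fun k => decide (k = i)) z s) j t } := by
    intro s t
    rw [update_hot, update_hot]
    rfl
  have h1 : i = z ∨ i = j →
      (Conf.bits { std v b F (i, y) with
        hot := Function.update (Function.update (fun k => decide (k = i)) z true) j false } =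
      (std v b F (z, y)).bits) := by
    intro hi
    have : Function.update (Function.update (fun k => decide (k = i)) z true) j false =
        fun k => decide (k = z) := by
      ext k
      simp only [Function.update_apply]
      rcases hi with rfl | rfl <;> split_ifs <;> simp_all [eq_comm]
    rw [this]; rfl
  have h2 : i = z ∨ i = j →
      (Conf.bits { std v b F (i, y) with
        hot := Function.update (Function.update (fun k => decide (k = i)) z false) j true } =
      (std v b F (j, y)).bits) := by
    intro hi
    have : Function.update (Function.update (fun k => decide (k = i)) z false) j true =
        fun k => decide (k = j) := by
      ext k
      simp only [Function.update_apply]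
      rcases hi with rfl | rfl <;> split_ifs <;> simp_all [eq_comm]
    rw [this]; rfl
  have h3 : i ≠ z → i ≠ j →
      (Conf.bits { std v b F (i, y) with
        hot := Function.update (Function.update (fun k => decide (k = i)) z false) j false } =
      (std v b F (i, y)).bits) := by
    intro hz hj
    have : Function.update (Function.update (fun k => decide (k = i)) z false) j false =
        fun k => decide (k = i) := by
      ext k
      simp only [Function.update_apply]
      split_ifs <;> simp_all [eq_comm]
    rw [this]; rfl
  rw [rot, dif_pos (by simpa using hzj), run_gate2, Fintype.sum_prod_type]
  simp only [Fintype.sum_bool, hu]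
  by_cases hz : i = z
  · rw [if_pos hz, h1 (.inl hz), h2 (.inl hz)]
    simp [rotMatrix, Conf.bits, std, hz, hzj.symm]
  · by_cases hj : i = j
    · rw [if_neg hz, if_pos hj, h1 (.inr hj), h2 (.inr hj)]
      simp [rotMatrix, Conf.bits, std, hj, hzj]
    · rw [if_neg hz, if_neg hj, h3 hz hj]
      simp [rotMatrix, Conf.bits, std, Ne.symm hz, Ne.symm hj]

lemma run_rot_embFun {z j : Fin n} (hzj : z ≠ j) (θ : ℝ) (F : Fin ℓ → Bool) (f : Item n p → ℂ) :
    run O (rot (.hot z) (.hot j) θ) (embFun v b F f) = embFun v b F (rotFun z j θ f) := by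
  have : run O (rot (.hot z) (.hot j) θ) ∘ₗ embFun v b F = embFun v b F ∘ₗ rotFun z j θ := by
    refine (Pi.basisFun ℂ (Item n p)).ext fun c => ?_
    obtain ⟨i, y⟩ := c
    rw [Pi.basisFun_apply, LinearMap.comp_apply, LinearMap.comp_apply, embFun_single,
      run_rot_std O v b hzj]
    have hs : ∀ (a a' : ℂ), a • ket (std v b F (z, y)).bits + a' • ket (std v b F (j, y)).bits =
        embFun v b F (a • Pi.single (z, y) 1 + a' • Pi.single (j, y) 1) := by
      intro a a'
      rw [map_add, map_smul, map_smul, embFun_single, embFun_single]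
    rw [hs, hs, ← embFun_single, ← apply_ite (embFun v b F), ← apply_ite (embFun v b F)]
    congr 1
    ext ⟨k, u⟩
    simp only [rotFun_apply]
    by_cases hu : u = y
    · subst hu
      by_cases hz : i = z
      · subst hz
        by_cases hk : k = i
        · subst hk; simp [hzj, hzj.symm]
        · by_cases hk' : k = j
          · subst hk'; simp [hzj.symm]
          · simp [hk, hk']
      · by_cases hj : i = j
        · subst hj
          by_cases hk : k = z
          · subst hk; simp [hzj, hzj.symm]
          · by_cases hk' : k = i
            · subst hk'; simp [hzj, hzj.symm]
            · simp [hk, hk', hz]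
        · by_cases hk : k = z
          · subst hk; simp [hz, hj, Ne.symm hz, Ne.symm hj]
          · by_cases hk' : k = j
            · subst hk'; simp [hz, hj, Ne.symm hz, Ne.symm hj, hzj.symm]
            · simp [Pi.single_apply, hk, hk', hz, hj]
    · split_ifs <;> simp [hu]
  exact LinearMap.congr_fun this f

/-- With `m` indices left after `j`, the index `z` holds `a √(m + 2)`. A rotation with sine `1 / √(m
+ 2)` hands `a` to `j` and leaves `a √(m + 1)`, as the induction requires. -/
lemma exists_rotations (z : Fin n) (L : List (Fin n)) (hz : z ∉ L) (hL : L.Nodup) :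
    ∃ T : (Item n p → ℂ) →ₗ[ℂ] (Item n p → ℂ),
      (∀ (F : Fin ℓ → Bool) f, run O (rotations z L) (embFun v b F f) = embFun v b F (T f)) ∧
      ∀ (f : Item n p → ℂ) (a : ℝ) (g : (Fin (width p) → Bool) → ℂ),
        (∀ y, f (z, y) = (a * Real.sqrt (L.length + 1) : ℝ) * g y) → (∀ j ∈ L, ∀ y, f (j, y) = 0) →
        ∀ c : Item n p, T f c = if c.1 = z ∨ c.1 ∈ L then a * g c.2 else f c := by
  induction L with
  | nil =>
    refine ⟨LinearMap.id, fun F f => rfl, fun f a g h1 _ c => ?_⟩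
    obtain ⟨i, y⟩ := c
    by_cases hi : i = z
    · subst hi; simp [h1]
    · simp [hi]
  | cons j L ih =>
    simp only [List.mem_cons, not_or] at hz
    rw [List.nodup_cons] at hL
    obtain ⟨T, hT, hT2⟩ := ih hz.2 hL.2
    set m : ℝ := (L.length : ℝ) with hm
    have hm0 : 0 ≤ m := by positivity
    set θ := Real.arcsin (Real.sqrt (m + 2))⁻¹ with hθ
    have hs2 : Real.sqrt (m + 2) ≠ 0 := by positivity
    have hsin : Real.sin θ = (Real.sqrt (m + 2))⁻¹ := by
      have h1 : 1 ≤ Real.sqrt (m + 2) := Real.one_le_sqrt.2 (by linarith)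
      exact Real.sin_arcsin (le_trans (by norm_num) (inv_nonneg.2 (Real.sqrt_nonneg _)))
        (inv_le_one_of_one_le₀ h1)
    have hcos : Real.cos θ * Real.sqrt (m + 2) = Real.sqrt (m + 1) := by
      rw [hθ, Real.cos_arcsin, ← Real.sqrt_mul' _ (by linarith)]
      congr 1
      rw [inv_pow, Real.sq_sqrt (by linarith)]
      field_simp
      ring
    refine ⟨T ∘ₗ rotFun z j θ, fun F f => ?_, fun f a g h1 h2 c => ?_⟩
    · rw [rotations, run_append, run_rot_embFun O v b hz.1, hT]
      rfl
    · have hlen : (((j :: L).length : ℕ) : ℝ) + 1 = m + 2 := by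
        rw [List.length_cons]; push_cast; ring
      rw [hlen] at h1
      have hj := h2 j (by simp)
      rw [LinearMap.comp_apply, hT2 (rotFun z j θ f) a g]
      · obtain ⟨i, y⟩ := c
        by_cases hi : i = z ∨ i ∈ L
        · rw [if_pos hi, if_pos (by simp only [List.mem_cons]; tauto)]
        · rw [if_neg hi]
          rw [not_or] at hi
          rw [rotFun_apply, if_neg hi.1]
          by_cases hij : i = j
          · subst hij
            simp only [if_true, List.mem_cons, true_or, or_true, h1, hj, hsin]
            push_cast
            have : (Real.sqrt (m + 2) : ℂ) ≠ 0 := by exact_mod_cast hs2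
            field_simp
            ring
          · rw [if_neg hij, if_neg]
            simp only [List.mem_cons]
            tauto
      · intro y
        rw [rotFun_apply, if_pos rfl, h1, hj, ← hcos]
        push_cast
        ring
      · intro k hk y
        have hkz : k ≠ z := fun h => hz.2 (h ▸ hk)
        have hkj : k ≠ j := fun h => hL.1 (h ▸ hk)
        rw [rotFun_apply, if_neg hkz, if_neg hkj]
        exact h2 k (by simp [hk]) y

/-- Action of a Hadamard gate on amplitudes. -/
def hadFun (s : Fin (width p)) : (Item n p → ℂ) →ₗ[ℂ] (Item n p → ℂ) where
  toFun f c := (Real.sqrt 2 : ℂ)⁻¹ * (f (c.1, Function.update c.2 s false) +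
    sgn (c.2 s) * f (c.1, Function.update c.2 s true))
  map_add' f g := by ext c; simp only [Pi.add_apply]; ring
  map_smul' a f := by ext c; simp only [Pi.smul_apply, smul_eq_mul, RingHom.id_apply]; ring

lemma run_had_embFun (s : Fin (width p)) (F : Fin ℓ → Bool) (f : Item n p → ℂ) :
    run O [had (.y s)] (embFun v b F f) = embFun v b F (hadFun s f) := by
  let K : (Fin (width p) → Bool) → (Fin n → ℂ) →ₗ[ℂ] (Bits (Reg ℓ n p) → ℂ) := fun y =>
    { toFun := fun w => ∑ j, w j • ket (std v b F (j, y)).bits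
      map_add' := fun w w' => by simp [add_smul, Finset.sum_add_distrib]
      map_smul' := fun a w => by simp [mul_smul, Finset.smul_sum] }
  have hK : ∀ g : Item n p → ℂ, embFun v b F g = ∑ y, K y fun j => g (j, y) := by
    intro g
    rw [embFun_apply, Fintype.sum_prod_type, Finset.sum_comm]
    rfl
  rw [hK, hK, hadamard_sum (run O [had (.y s)]) K s (Real.sqrt 2 : ℂ)⁻¹]
  · rfl
  · intro y w
    change run O _ (∑ j, w j • ket (std v b F (j, y)).bits) =
      (Real.sqrt 2 : ℂ)⁻¹ • ((∑ j, w j • ket (std v b F (j, Function.update y s false)).bits) +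
        sgn (y s) • ∑ j, w j • ket (std v b F (j, Function.update y s true)).bits)
    rw [map_sum, Finset.smul_sum, ← Finset.sum_add_distrib, Finset.smul_sum]
    refine Finset.sum_congr rfl fun j _ => ?_
    rw [map_smul, run_had, update_y, update_y]
    have : (if (std v b F (j, y)).bits (.y s) = true then (-1 : ℂ) else 1) = sgn (y s) := rfl
    rw [this]
    change _ • _ • (ket (std v b F (j, Function.update y s false)).bits +
      _ • ket (std v b F (j, Function.update y s true)).bits) = _
    module

/-- `S` is the set of bits on which the amplitude is still concentrated at `0`; every Hadamard gate
frees one of them. -/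
lemma exists_hads (L : List (Fin (width p))) (hL : L.Nodup) :
    ∃ T : (Item n p → ℂ) →ₗ[ℂ] (Item n p → ℂ),
      (∀ (F : Fin ℓ → Bool) f, run O (L.flatMap fun s => [had (.y s)]) (embFun v b F f) =
        embFun v b F (T f)) ∧
      ∀ (f : Item n p → ℂ) (a : ℂ) (S : Finset (Fin (width p))), (∀ s ∈ L, s ∈ S) →
        (∀ c : Item n p, f c = if ∀ s ∈ S, c.2 s = false then a else 0) →
        ∀ c : Item n p, T f c = if ∀ s ∈ S, s ∉ L → c.2 s = false then
          (Real.sqrt 2 : ℂ)⁻¹ ^ L.length * a else 0 := by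
  induction L with
  | nil => exact ⟨LinearMap.id, fun F f => rfl, fun f a S _ h c => by simpa using h c⟩
  | cons s L ih =>
    rw [List.nodup_cons] at hL
    obtain ⟨T, hT, hT2⟩ := ih hL.2
    refine ⟨T ∘ₗ hadFun s, fun F f => ?_, fun f a S hS h c => ?_⟩
    · rw [List.flatMap_cons, run_append, run_had_embFun, hT]
      rfl
    · rw [LinearMap.comp_apply, hT2 _ ((Real.sqrt 2 : ℂ)⁻¹ * a) (S.erase s)]
      · simp only [Finset.mem_erase, List.length_cons, List.mem_cons, pow_succ, mul_assoc]
        refine if_congr (forall_congr' fun t => ?_) rfl rfl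
        tauto
      · intro t ht
        exact Finset.mem_erase.2 ⟨fun h => hL.1 (h ▸ ht), hS t (by simp [ht])⟩
      · intro c
        have hs := hS s (by simp)
        change _ * (f _ + _ * f _) = _
        rw [h, h]
        rw [if_neg (c := ∀ t ∈ S, Function.update c.2 s true t = false)
          (fun h => by simpa using h s hs)]
        have : (∀ t ∈ S, Function.update c.2 s false t = false) ↔
            ∀ t ∈ S.erase s, c.2 t = false := by
          refine forall_congr' fun t => ?_
          by_cases ht : t = s
          · subst ht; simp
          · simp [ht]
        simp only [this]
        split_ifs <;> simp

lemma exists_spread (z : Fin n) :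
    ∃ T : (Item n p → ℂ) →ₗ[ℂ] (Item n p → ℂ),
      (∀ (F : Fin ℓ → Bool) f, run O (spread z) (embFun v b F f) = embFun v b F (T f)) ∧
      ∀ c, T (Pi.single (z, fun _ => false) 1) c =
        (((Real.sqrt n)⁻¹ * (Real.sqrt 2)⁻¹ ^ width p : ℝ) : ℂ) := by
  have hn : 0 < n := z.pos
  obtain ⟨T₁, h1, h1'⟩ := exists_rotations (ℓ := ℓ) O v b z ((List.finRange n).filter (· ≠ z))
    (by simp) ((List.nodup_finRange n).filter _)
  obtain ⟨T₂, h2, h2'⟩ := exists_hads (ℓ := ℓ) O v b (List.finRange (width p))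
    (List.nodup_finRange _)
  refine ⟨T₂ ∘ₗ T₁, fun F f => ?_, fun c => ?_⟩
  · rw [spread, run_append, h1, h2]; rfl
  · have hlen : (((List.finRange n).filter (· ≠ z)).length : ℝ) + 1 = n := by
      have e : ((List.finRange n).filter (· ≠ z)).length + 1 = n := by
        have h3 := List.length_eq_length_filter_add (l := List.finRange n) (· ≠ z)
        rw [List.length_finRange] at h3
        have h4 : ((List.finRange n).filter fun x => !decide (x ≠ z)).length = 1 := by
          have : (fun x : Fin n => !decide (x ≠ z)) = fun x => x == z := by
            ext x; by_cases hx : x = z <;> simp [hx]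
          rw [this, ← List.countP_eq_length_filter, ← List.count]
          exact List.count_eq_one_of_mem (List.nodup_finRange n) (List.mem_finRange z)
        omega
      exact_mod_cast e
    have h3 := h1' (Pi.single (z, fun _ => false) 1) (Real.sqrt n)⁻¹
      (fun y => if y = fun _ => false then 1 else 0) (by
        intro y
        rw [hlen, inv_mul_cancel₀ (by positivity)]
        simp [Pi.single_apply]) (by
        intro j hj y
        rw [Pi.single_apply, if_neg]
        intro h
        simp only [List.mem_filter, decide_eq_true_eq] at hj
        exact hj.2 (Prod.mk.inj h).1)
    rw [LinearMap.comp_apply, h2' _ (((Real.sqrt n)⁻¹ : ℝ) : ℂ) Finset.univ (by simp)]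
    · simp
      ring
    · intro c
      rw [h3, if_pos (by simp; tauto)]
      have : (c.2 = fun _ => false) ↔ ∀ s ∈ Finset.univ, c.2 s = false := by
        simp [funext_iff]
      simp only [this]
      split_ifs <;> simp

end Spread

/-! ### The circuit -/

section Circuit

variable {ℓ n p : ℕ}

def ancs : List (Reg ℓ n p) := (List.finRange (ℓ + width p + 1)).map .anc

def yLits : List (Reg ℓ n p × Bool) := (List.finRange (width p)).map fun s => (.y s, false)

def flagLits : List (Reg ℓ n p × Bool) := (List.finRange ℓ).map fun i => (.flag i, false)

/-- Flip the multiplier if the flag `f` is set. -/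
def kick (f : Fin ℓ) : List (Op n p (Reg ℓ n p)) :=
  (List.finRange (width p)).flatMap fun s => cnot (.flag f) (.y s)

/-- The Grover operator, controlled by the flag `f`. -/
def grover (z : Fin n) (f : Fin ℓ) : List (Op n p (Reg ℓ n p)) :=
  -- Only the middle part is controlled: without it the conjugation is the identity.
  conj (spread z ++ phaseOracle) (kick f) ++
    -- A global sign and a sign on the initial state make the reflection `2 |s⟩⟨s| - 1`.
    ([phaseGate (.flag f) Real.pi] ++ ladder Real.pi (.flag f) ((.hot z, true) :: yLits) ancs)

/-- Test of the flag `f`: a Hadamard test of the Grover operator to the power `2 ^ f`. -/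
def test (z : Fin n) (f : Fin ℓ) : List (Op n p (Reg ℓ n p)) :=
  [had (.flag f)] ++ ((List.replicate (2 ^ (f : ℕ)) (grover z f)).flatten ++ [had (.flag f)])

/-- Phase `e ^ (- i π / 3)` if no flag is set. -/
def markClear : List (Op n p (Reg ℓ n p)) :=
  conj [flip .out] (ladder (-(Real.pi / 3)) .out flagLits ancs)

/-- Phase `e ^ (i π / 3)` on the initial state. -/
def markStart (z : Fin n) : List (Op n p (Reg ℓ n p)) :=
  ladder (Real.pi / 3) (.hot z) (yLits ++ flagLits) ancs

/-- All tests, amplified `k` times by fixed-point search. -/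
def search (z : Fin n) : ℕ → List (Op n p (Reg ℓ n p))
  | 0 => (List.finRange ℓ).flatMap (test z)
  | k + 1 => search z k ++ (markClear ++ (invC (search z k) ++ (markStart z ++ search z k)))

/-- Set the output qubit if no flag is set. -/
def report : List (Op n p (Reg ℓ n p)) :=
  conj [had .out] (ladder Real.pi .out flagLits ancs)

/-- The verification circuit. -/
def verify (z : Fin n) (k : ℕ) : List (Op n p (Reg ℓ n p)) :=
  [flip (.hot z)] ++ (loadVec ++ (loadRhs ++ (search z k ++ report)))

end Circuit

/-! ### The Grover operator -/

section Grover

variable {ℓ n p : ℕ} (O : Oracles n p) (v b : Fin n → ZMod p)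

lemma run_std_phase {C : List (Op n p (Reg ℓ n p))} {F : Fin ℓ → Bool} {θ : Item n p → ℝ}
    (h : ∀ c, run O C (ket (std v b F c).bits) = phase (θ c) • ket (std v b F c).bits)
    (φ : Space n p) :
    run O C (emb v b F φ) = emb v b F (WithLp.toLp 2 fun c => phase (θ c) * φ c) := by
  rw [emb_apply, emb_apply, map_sum]
  refine Finset.sum_congr rfl fun c _ => ?_
  rw [map_smul, h, smul_smul, mul_comm]

/-- Flip all bits of the multiplier. -/
def flipY (φ : Space n p) : Space n p := WithLp.toLp 2 fun c => φ (c.1, fun s => !c.2 s)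

lemma flipY_flipY (φ : Space n p) : flipY (flipY φ) = φ := by
  ext c; simp [flipY]

lemma run_kick (f : Fin ℓ) (F : Fin ℓ → Bool) (φ : Space n p) :
    run O (kick f) (emb v b F φ) = emb v b F (if F f then flipY φ else φ) := by
  have h : ∀ c : Item n p, run O (kick f) (ket (std v b F c).bits) =
      ket (std v b F (c.1, fun s => xor (F f) (c.2 s))).bits := by
    intro c
    refine run_flatMap_update O (fun y => (std v b F (c.1, y)).bits) _ c.2 _ ?_
    intro i y hy
    rw [run_cnot O (by simp), update_y, ← hy]
    rfl
  rw [emb_apply, emb_apply, map_sum]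
  simp only [map_smul, h]
  cases hF : F f
  · simp
  · simp only [Bool.true_xor, if_true]
    have hinv : Function.Involutive fun c : Item n p => (c.1, fun s => !c.2 s) := by
      rintro ⟨j, y⟩; simp
    refine Fintype.sum_equiv hinv.toPerm _ _ fun c => ?_
    simp [flipY, Function.Involutive.toPerm]

/-- The initial state. -/
def start (z : Fin n) : Space n p := EuclideanSpace.single (z, fun _ => false) 1

lemma norm_start (z : Fin n) : ‖(start z : Space n p)‖ = 1 := by
  simp [start]

variable [NeZero p] {M : Matrix (Fin n) (Fin n) (ZMod p)}

/-- The circuit does not touch the flags, so one isometry serves every flag pattern. -/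
lemma exists_encode (hM : IsMatOracle M O.UM) (z : Fin n) :
    ∃ V : Space n p ≃ₗᵢ[ℂ] Space n p,
      (∀ (F : Fin ℓ → Bool) φ, run O (spread z ++ phaseOracle) (emb v b F φ) = emb v b F (V φ)) ∧
      ∀ c, V (start z) c = (((Real.sqrt n)⁻¹ * (Real.sqrt 2)⁻¹ ^ width p : ℝ) : ℂ) *
        phase (2 * Real.pi / p * (num c.2 * residue M v b c.1)) := by
  obtain ⟨T, hT, hT2⟩ := exists_spread (ℓ := ℓ) O v b z
  have h : ∀ (F : Fin ℓ → Bool) φ, run O (spread z ++ phaseOracle) (emb v b F φ) =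
      emb v b F (WithLp.toLp 2 fun c =>
        phase (2 * Real.pi / p * (num c.2 * residue M v b c.1)) * T φ.ofLp c) := by
    intro F φ
    rw [run_append]
    have : run O (spread z) (emb v b F φ) = emb v b F (WithLp.toLp 2 (T φ.ofLp)) := hT F φ.ofLp
    rw [this, run_std_phase O v b fun c => run_phaseOracle O hM v b F c]
  obtain ⟨V, hV⟩ := exists_isometry (emb v b fun _ : Fin ℓ => false) (normSq_emb v b _)
    (run O (spread z ++ phaseOracle)) (normSq_run O _) _ (h _)
  refine ⟨V, fun F φ => by rw [h, hV], fun c => ?_⟩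
  rw [hV]
  simp only [start, PiLp.ofLp_single, hT2]
  ring

/-- The overlap of the initial state with its image under the reflection. -/
def overlap (M : Matrix (Fin n) (Fin n) (ZMod p)) (v b : Fin n → ZMod p) : ℝ :=
  (n : ℝ)⁻¹ * ∑ j, ∏ s ∈ Finset.range (width p),
    Real.cos (2 ^ s * (2 * Real.pi / p * residue M v b j))

/-- The summand factors over the bits, and bit `s` contributes `exp (± i 2 ^ s x)` according to its
value; the two values add up to `2 cos (2 ^ s x)`. -/
lemma sum_phase_prod (w : ℕ) (x : ℝ) :
    ∑ y : Fin w → Bool, phase (-(x * num y)) * phase (x * num fun s => !y s) =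
      ((2 ^ w * ∏ s ∈ Finset.range w, Real.cos (2 ^ s * x) : ℝ) : ℂ) := by
  have h1 : ∀ y : Fin w → Bool, phase (-(x * num y)) * phase (x * num fun s => !y s) =
      ∏ s : Fin w, phase (if y s then -(2 ^ (s : ℕ) * x) else 2 ^ (s : ℕ) * x) := by
    intro y
    have hsum : ∀ g : Fin w → ℝ, ∏ s, phase (g s) = phase (∑ s, g s) := by
      intro g
      simp only [phase, ← Complex.exp_sum]
      push_cast
      rw [Finset.sum_mul]
    rw [hsum, ← phase_add, num_cast, num_cast, ← mul_neg, ← mul_add, ← Finset.sum_neg_distrib,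
      ← Finset.sum_add_distrib, Finset.mul_sum]
    congr 1
    refine Finset.sum_congr rfl fun s _ => ?_
    cases y s <;> simp [mul_comm]
  have h2 : ∀ s : Fin w, ∑ t : Bool, phase (if t then -(2 ^ (s : ℕ) * x) else 2 ^ (s : ℕ) * x) =
      ((2 * Real.cos (2 ^ (s : ℕ) * x) : ℝ) : ℂ) := by
    intro s
    rw [Fintype.sum_bool]
    simp only [if_true, Bool.false_eq_true, if_false]
    rw [phase, phase]
    push_cast
    rw [Complex.two_cos]
    rw [add_comm]
  simp only [h1]
  have h3 := Finset.prod_univ_sum (fun _ : Fin w => (Finset.univ : Finset Bool))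
    (fun s t => phase (if t then -(2 ^ (s : ℕ) * x) else 2 ^ (s : ℕ) * x))
  rw [Fintype.piFinset_univ] at h3
  rw [← h3]
  simp only [h2]
  rw [← Complex.ofReal_prod, Finset.prod_mul_distrib, Finset.prod_const, Finset.card_univ,
    Fintype.card_fin, Finset.prod_range]

lemma exists_grover (hM : IsMatOracle M O.UM) (z : Fin n) (f₀ : Fin ℓ) :
    ∃ G : Space n p ≃ₗᵢ[ℂ] Space n p,
      (∀ (f : Fin ℓ) F φ, run O (grover z f) (emb v b F φ) =
        emb v b F (if F f then G φ else φ)) ∧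
      G (start z) + G.symm (start z) = ((2 * overlap M v b : ℝ) : ℂ) • start z := by
  obtain ⟨V, hV, hV2⟩ := exists_encode (ℓ := ℓ) O v b hM z
  let R : Space n p → Space n p := fun φ => V.symm (flipY (V φ))
  let G₀ : Space n p → Space n p := fun φ => (2 * inner ℂ (start z) (R φ)) • start z - R φ
  have hG : ∀ (f : Fin ℓ) F φ, run O (grover z f) (emb v b F φ) =
      emb v b F (if F f then G₀ φ else φ) := by
    intro f F φ
    have h1 : run O (conj (spread z ++ phaseOracle) (kick f)) (emb v b F φ) =
        emb v b F (if F f then R φ else φ) := by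
      refine run_conj O ?_
      rw [hV, run_kick, hV]
      congr 1
      split_ifs
      · simp [R]
      · rfl
    have h2 : ∀ c : Item n p, run O ([phaseGate (.flag f) Real.pi] ++
        ladder Real.pi (.flag f) ((.hot z, true) :: yLits) ancs) (ket (std v b F c).bits) =
        phase ((if F f then Real.pi else 0) +
          if F f ∧ c = (z, fun _ => false) then Real.pi else 0) • ket (std v b F c).bits := by
      intro c
      rw [run_append, run_phaseGate, map_smul, run_ladder, smul_smul, ← phase_add]
      · congr 3
        refine if_congr (and_congr Iff.rfl ?_) rfl rfl
        obtain ⟨j, y⟩ := c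
        simp [yLits, std, Conf.bits, funext_iff, @eq_comm _ z j]
      · simp [yLits, ancs]
      · exact (List.nodup_finRange _).map fun i j h => by simpa using h
      · simp [ancs, std, Conf.bits]
      · simp [ancs]
      · simp [yLits, ancs]
    rw [grover, run_append, h1, run_std_phase O v b h2]
    congr 1
    ext c
    cases hF : F f
    · simp
    · simp only [if_true, true_and, G₀, phase_add, phase_pi]
      have h3 : inner ℂ (start z) (R φ) = R φ (z, fun _ => false) := by
        simp [start, EuclideanSpace.inner_single_left]
      rw [h3]
      by_cases hc : c = (z, fun _ => false)
      · subst hc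
        simp [start]
        ring
      · simp [start, hc]
  -- With the flag `f₀` set the circuit performs `G₀` unconditionally, which exhibits `G₀` as an
  -- isometry.
  obtain ⟨G, hG2⟩ := exists_isometry (emb v b fun _ : Fin ℓ => true) (normSq_emb v b _)
    (run O (grover z f₀)) (normSq_run O _) G₀ (fun φ => by rw [hG]; simp)
  refine ⟨G, fun f F φ => by rw [hG, hG2], ?_⟩
  rw [grover_add_symm G R (start z) (norm_start z) (by simp [R, flipY_flipY]) hG2]
  congr 1
  have h4 : inner ℂ (start z) (R (start z)) = inner ℂ (V (start z)) (flipY (V (start z))) := by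
    rw [← V.inner_map_map, V.apply_symm_apply]
  set A : ℝ := (Real.sqrt n)⁻¹ * (Real.sqrt 2)⁻¹ ^ width p with hA
  have hA2 : A * A = (n : ℝ)⁻¹ * ((2 : ℝ) ^ width p)⁻¹ := by
    rw [hA, mul_mul_mul_comm, ← mul_inv, Real.mul_self_sqrt (by positivity), ← mul_pow, ← mul_inv,
      Real.mul_self_sqrt (by positivity), inv_pow]
  have h5 : inner ℂ (V (start z)) (flipY (V (start z))) = ((A * A : ℝ) : ℂ) *
      ∑ j, ∑ y : Fin (width p) → Bool,
        phase (-(2 * Real.pi / p * residue M v b j * num y)) *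
          phase (2 * Real.pi / p * residue M v b j * num fun s => !y s) := by
    rw [PiLp.inner_apply, Fintype.sum_prod_type, Finset.mul_sum]
    refine Finset.sum_congr rfl fun j _ => ?_
    rw [Finset.mul_sum]
    refine Finset.sum_congr rfl fun y _ => ?_
    rw [RCLike.inner_apply, hV2]
    simp only [flipY, hV2]
    have : (starRingEnd ℂ) ((A : ℂ) * phase (2 * Real.pi / p * (num y * residue M v b j))) =
        (A : ℂ) * phase (-(2 * Real.pi / p * residue M v b j * num y)) := by
      rw [map_mul, Complex.conj_ofReal]
      congr 1
      rw [← Complex.star_def, conj_phase]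
      congr 1
      ring
    rw [this, mul_comm (num _ : ℝ) (residue M v b j : ℝ), ← mul_assoc (2 * Real.pi / p)]
    push_cast
    ring
  rw [h4, h5]
  simp only [sum_phase_prod]
  rw [hA2, overlap, ← Complex.ofReal_sum, ← Finset.mul_sum, ← Complex.ofReal_mul]
  generalize ∑ j, ∏ s ∈ Finset.range (width p),
    Real.cos (2 ^ s * (2 * Real.pi / p * residue M v b j)) = S
  have : (n : ℝ)⁻¹ * ((2 : ℝ) ^ width p)⁻¹ * (2 ^ width p * S) = (n : ℝ)⁻¹ * S := by
    rw [mul_assoc, inv_mul_cancel_left₀ (by positivity)]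
  rw [this]
  push_cast
  ring

end Grover

/-! ### Correctness of the search -/

section Flags

variable {ℓ n p : ℕ} (O : Oracles n p) (v b : Fin n → ZMod p)

/-- A Hadamard gate on the flag `f`. -/
def hadFlag (f : Fin ℓ) (Φ : FlagSpace ℓ n p) : FlagSpace ℓ n p :=
  WithLp.toLp 2 fun F => (Real.sqrt 2 : ℂ)⁻¹ • (Φ (Function.update F f false) +
    sgn (F f) • Φ (Function.update F f true))

/-- `g` controlled by the flag `f`. -/
def ctrl (f : Fin ℓ) (g : Space n p → Space n p) (Φ : FlagSpace ℓ n p) : FlagSpace ℓ n p :=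
  WithLp.toLp 2 fun F => if F f then g (Φ F) else Φ F

/-- The test of the flag `f`. -/
def testOp (g : Space n p → Space n p) (Φ : FlagSpace ℓ n p) (f : Fin ℓ) : FlagSpace ℓ n p :=
  hadFlag f ((ctrl f g)^[2 ^ (f : ℕ)] (hadFlag f Φ))

lemma ctrl_iterate (f : Fin ℓ) (g : Space n p → Space n p) (m : ℕ) (Φ : FlagSpace ℓ n p)
    (F : Fin ℓ → Bool) : (ctrl f g)^[m] Φ F = if F f then g^[m] (Φ F) else Φ F := by
  induction m generalizing Φ with
  | zero => simp
  | succ m ih =>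
    rw [Function.iterate_succ_apply, ih]
    cases hF : F f <;> simp [ctrl, hF]

lemma run_had_embFlag (f : Fin ℓ) (Φ : FlagSpace ℓ n p) :
    run O [had (.flag f)] (embFlag v b Φ) = embFlag v b (hadFlag f Φ) := by
  rw [embFlag_apply, hadamard_sum (run O [had (.flag f)]) (emb v b) f (Real.sqrt 2 : ℂ)⁻¹]
  · rfl
  · intro F φ
    rw [emb_apply, emb_apply, emb_apply, map_sum, Finset.smul_sum, ← Finset.sum_add_distrib,
      Finset.smul_sum]
    refine Finset.sum_congr rfl fun c _ => ?_
    rw [map_smul, run_had, update_flag, update_flag]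
    have : (if (std v b F c).bits (.flag f) = true then (-1 : ℂ) else 1) = sgn (F f) := rfl
    rw [this]
    change _ • _ • (ket (std v b (Function.update F f false) c).bits +
      _ • ket (std v b (Function.update F f true) c).bits) = _
    module

lemma run_test {z : Fin n} {f : Fin ℓ} {g : Space n p → Space n p}
    (hg : ∀ (F : Fin ℓ → Bool) φ, run O (grover z f) (emb v b F φ) =
      emb v b F (if F f then g φ else φ)) (Φ : FlagSpace ℓ n p) :
    run O (test z f) (embFlag v b Φ) = embFlag v b (testOp g Φ f) := by
  have h : ∀ (m : ℕ) (Φ : FlagSpace ℓ n p), run O (List.replicate m (grover z f)).flatten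
      (embFlag v b Φ) = embFlag v b ((ctrl f g)^[m] Φ) := by
    intro m
    induction m with
    | zero => intro Φ; rfl
    | succ m ih =>
      intro Φ
      rw [List.replicate_succ, List.flatten_cons, run_append, Function.iterate_succ_apply, ← ih,
        embFlag_apply, embFlag_apply, map_sum]
      simp only [hg]
      rfl
  rw [test, run_append, run_append, run_had_embFlag, h, run_had_embFlag]
  rfl

lemma run_tests {z : Fin n} {g : Space n p → Space n p}
    (hg : ∀ (f : Fin ℓ) (F : Fin ℓ → Bool) φ, run O (grover z f) (emb v b F φ) =
      emb v b F (if F f then g φ else φ)) (L : List (Fin ℓ)) (Φ : FlagSpace ℓ n p) :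
    run O (L.flatMap (test z)) (embFlag v b Φ) = embFlag v b (L.foldl (testOp g) Φ) := by
  induction L generalizing Φ with
  | nil => rfl
  | cons f L ih => rw [List.flatMap_cons, run_append, run_test O v b (hg f), ih, List.foldl_cons]

/-- No flag is set. -/
def clear (ℓ : ℕ) : Fin ℓ → Bool := fun _ => false

/-- A Hadamard test on a flag at `0` leaves the component `(1 + G ^ m) / 2` at `0`. Later tests use
other flags, so the all-clear component evolves on its own as long as the flags in `L` are still
`0`. -/
lemma foldl_testOp_clear (G : Space n p ≃ₗᵢ[ℂ] Space n p) (L : List (Fin ℓ)) (hL : L.Nodup)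
    (Φ : FlagSpace ℓ n p) (hΦ : ∀ F, (∃ f ∈ L, F f = true) → Φ F = 0) :
    L.foldl (testOp G) Φ (clear ℓ) =
      L.foldl (fun φ (f : Fin ℓ) => (1 / 2 : ℂ) • (φ + G^[2 ^ (f : ℕ)] φ)) (Φ (clear ℓ)) := by
  induction L generalizing Φ with
  | nil => rfl
  | cons f L ih =>
    rw [List.nodup_cons] at hL
    have hsmul : ∀ (m : ℕ) (a : ℂ) (φ : Space n p), G^[m] (a • φ) = a • G^[m] φ := by
      intro m a
      induction m with
      | zero => intro φ; rfl
      | succ m ih => intro φ; rw [Function.iterate_succ_apply, map_smul, ih]; rfl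
    have happ : ∀ F, testOp G Φ f F = (1 / 2 : ℂ) •
        (Φ (Function.update F f false) + Φ (Function.update F f true) +
          sgn (F f) • G^[2 ^ (f : ℕ)]
            (Φ (Function.update F f false) - Φ (Function.update F f true))) := by
      intro F
      rw [testOp, hadFlag]
      simp only [ctrl_iterate, Function.update_self, hadFlag, Function.update_idem, sgn, hsmul,
        if_true, Bool.false_eq_true, if_false, one_smul, neg_smul, ← sub_eq_add_neg]
      rw [← inv_sqrt_two_mul_self, mul_smul]
      congr 1
      module
    have h0 : Function.update (clear ℓ) f false = clear ℓ := Function.update_eq_self _ _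
    have h1 : Φ (Function.update (clear ℓ) f true) = 0 := hΦ _ ⟨f, by simp, by simp⟩
    rw [List.foldl_cons, ih hL.2, List.foldl_cons, happ, h0, h1]
    · simp [sgn, clear]
    · rintro F ⟨f', hf', hF⟩
      have hne : f' ≠ f := fun h => hL.1 (h ▸ hf')
      have h2 : ∀ t, Φ (Function.update F f t) = 0 := fun t =>
        hΦ _ ⟨f', by simp [hf'], by rw [Function.update_of_ne hne]; exact hF⟩
      have h3 : ∀ m : ℕ, G^[m] (0 : Space n p) = 0 := fun m => by
        have := hsmul m 0 0
        rwa [zero_smul, zero_smul] at this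
      rw [happ, h2, h2, sub_zero, h3]
      simp

/-- The initial state with no flags set. -/
def startFlag (z : Fin n) : FlagSpace ℓ n p :=
  WithLp.toLp 2 fun F => if F = clear ℓ then start z else 0

/-- The projection on the states with no flag set. -/
def projClear : FlagSpace ℓ n p →ₗ[ℂ] FlagSpace ℓ n p where
  toFun Φ := WithLp.toLp 2 fun F => if F = clear ℓ then Φ F else 0
  map_add' Φ Ψ := by
    ext F : 1
    simp only [PiLp.add_apply]
    split_ifs <;> simp
  map_smul' a Φ := by
    ext F : 1
    simp only [PiLp.smul_apply, RingHom.id_apply]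
    split_ifs <;> simp

lemma projClear_apply (Φ : FlagSpace ℓ n p) (F : Fin ℓ → Bool) :
    projClear Φ F = if F = clear ℓ then Φ F else 0 := rfl

lemma norm_projClear_sq (Φ : FlagSpace ℓ n p) : ‖projClear Φ‖ ^ 2 = ‖Φ (clear ℓ)‖ ^ 2 := by
  rw [PiLp.norm_sq_eq_of_L2, Finset.sum_eq_single (clear ℓ)]
  · rw [projClear_apply, if_pos rfl]
  · intro F _ hF
    rw [projClear_apply, if_neg hF]
    simp
  · simp

lemma inner_projClear (Φ : FlagSpace ℓ n p) :
    inner ℂ Φ (projClear Φ) = ((‖projClear Φ‖ ^ 2 : ℝ) : ℂ) := by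
  rw [norm_projClear_sq, PiLp.inner_apply, Finset.sum_eq_single (clear ℓ)]
  · rw [projClear_apply, if_pos rfl, inner_self_eq_norm_sq_to_K]
    simp
  · intro F _ hF
    rw [projClear_apply, if_neg hF, inner_zero_right]
  · simp

lemma norm_startFlag (z : Fin n) : ‖(startFlag z : FlagSpace ℓ n p)‖ = 1 := by
  have h : ‖(startFlag z : FlagSpace ℓ n p)‖ ^ 2 = 1 := by
    rw [PiLp.norm_sq_eq_of_L2, Finset.sum_eq_single (clear ℓ)]
    · simp [startFlag, norm_start]
    · intro F _ hF
      simp [startFlag, hF]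
    · simp
  exact (pow_eq_one_iff_of_nonneg (norm_nonneg _) two_ne_zero).1 h

lemma inner_startFlag (z : Fin n) (Φ : FlagSpace ℓ n p) :
    inner ℂ (startFlag z) Φ = Φ (clear ℓ) (z, fun _ => false) := by
  rw [PiLp.inner_apply, Finset.sum_eq_single (clear ℓ)]
  · simp [startFlag, start, EuclideanSpace.inner_single_left]
  · intro F _ hF
    simp [startFlag, hF]
  · simp

lemma nodup_ancs : (ancs : List (Reg ℓ n p)).Nodup :=
  (List.nodup_finRange _).map fun i j h => by simpa using h

lemma forall_flagLits (F : Fin ℓ → Bool) (c : Item n p) :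
    (∀ l ∈ (flagLits : List (Reg ℓ n p × Bool)), (std v b F c).bits l.1 = l.2) ↔ F = clear ℓ := by
  simp [flagLits, std, Conf.bits, funext_iff, clear]

/-- `markClear` uses this with the output bit set, `report` with both values, between Hadamard
gates. -/
lemma run_ladder_out (θ : ℝ) (F : Fin ℓ → Bool) (c : Item n p) (t : Bool) :
    run O (ladder θ .out flagLits ancs)
        (ket (Function.update (std v b F c).bits .out t)) =
      phase (if t = true ∧ F = clear ℓ then θ else 0) •
        ket (Function.update (std v b F c).bits .out t) := by
  rw [run_ladder]
  · congr 2
    refine if_congr (and_congr (by simp) ?_) rfl rfl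
    refine Iff.trans (forall₂_congr fun l hl => ?_) (forall_flagLits v b F c)
    rw [Function.update_of_ne]
    simp only [flagLits, List.mem_map] at hl
    obtain ⟨i, _, rfl⟩ := hl
    simp
  · simp [flagLits, ancs]
    omega
  · exact nodup_ancs
  · simp [ancs, std, Conf.bits]
  · simp [ancs]
  · simp [flagLits, ancs]

lemma run_markClear (Φ : FlagSpace ℓ n p) :
    run O markClear (embFlag v b Φ) =
      embFlag v b (Φ + (phase (-(Real.pi / 3)) - 1) • projClear Φ) := by
  have h : ∀ F c, run O markClear (ket (std v b F c).bits) =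
      phase (if F = clear ℓ then -(Real.pi / 3) else 0) • ket (std v b F c).bits := by
    intro F c
    refine run_conj_smul O (run_flip O _ _) ?_
    rw [run_ladder_out]
    simp [std, Conf.bits]
  rw [embFlag_apply, map_sum, embFlag_apply]
  refine Finset.sum_congr rfl fun F _ => ?_
  rw [run_std_phase O v b fun c => h F c]
  congr 1
  ext c
  simp only [PiLp.add_apply, PiLp.smul_apply, projClear_apply, smul_eq_mul]
  split_ifs
  · ring
  · simp

lemma run_markStart (z : Fin n) (Φ : FlagSpace ℓ n p) :
    run O (markStart z) (embFlag v b Φ) =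
      embFlag v b (Φ + ((phase (Real.pi / 3) - 1) * inner ℂ (startFlag z) Φ) • startFlag z) := by
  have h : ∀ F c, run O (markStart z) (ket (std v b F c).bits) =
      phase (if F = clear ℓ ∧ c = (z, fun _ => false) then Real.pi / 3 else 0) •
        ket (std v b F c).bits := by
    intro F c
    rw [markStart, run_ladder]
    · congr 2
      refine if_congr ?_ rfl rfl
      obtain ⟨j, y⟩ := c
      rw [List.forall_mem_append, forall_flagLits]
      simp only [yLits, std, Conf.bits, List.mem_map, List.mem_finRange, true_and,
        forall_exists_index, forall_apply_eq_imp_iff, decide_eq_true_eq, Prod.mk.injEq,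
        funext_iff]
      tauto
    · simp [flagLits, yLits, ancs]
      omega
    · exact nodup_ancs
    · simp [ancs, std, Conf.bits]
    · simp [ancs]
    · intro l hl
      simp only [yLits, flagLits, List.mem_append, List.mem_map] at hl
      rcases hl with ⟨i, _, rfl⟩ | ⟨i, _, rfl⟩ <;> simp [ancs]
  rw [embFlag_apply, map_sum, embFlag_apply]
  refine Finset.sum_congr rfl fun F _ => ?_
  rw [run_std_phase O v b fun c => h F c, inner_startFlag]
  congr 1
  ext c
  by_cases hF : F = clear ℓ
  · subst hF
    by_cases hc : c = (z, fun _ => false)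
    · subst hc
      simp [startFlag, start]
      ring
    · simp [startFlag, start, hc]
  · simp [startFlag, hF]

lemma abs_overlap_le_one (M : Matrix (Fin n) (Fin n) (ZMod p)) : |overlap M v b| ≤ 1 := by
  rw [overlap, abs_mul, abs_of_nonneg (by positivity : (0 : ℝ) ≤ (n : ℝ)⁻¹)]
  have : |∑ j, ∏ s ∈ Finset.range (width p),
      Real.cos (2 ^ s * (2 * Real.pi / p * residue M v b j))| ≤ n := by
    refine (Finset.abs_sum_le_sum_abs _ _).trans ?_
    refine (Finset.sum_le_sum fun j _ => abs_prod_cos_le_one _ _).trans ?_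
    simp
  calc (n : ℝ)⁻¹ * _ ≤ (n : ℝ)⁻¹ * n := by gcongr
    _ ≤ 1 := inv_mul_le_one

/-- The probability that the tests raise no flag. -/
def clearProb (ℓ : ℕ) (M : Matrix (Fin n) (Fin n) (ZMod p)) (v b : Fin n → ZMod p) : ℝ :=
  ∏ i ∈ Finset.range ℓ, Real.cos (2 ^ i * (Real.arccos (overlap M v b) / 2)) ^ 2

/-- Without amplification the weight is the product of cosines for the eigenphase `arccos` of the
overlap; every round then cubes it. -/
lemma exists_search [NeZero p] {M : Matrix (Fin n) (Fin n) (ZMod p)} (hM : IsMatOracle M O.UM)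
    (z : Fin n) (f₀ : Fin ℓ) (k : ℕ) :
    ∃ U : FlagSpace ℓ n p ≃ₗᵢ[ℂ] FlagSpace ℓ n p,
      (∀ Φ, run O (search z k) (embFlag v b Φ) = embFlag v b (U Φ)) ∧
      ‖U (startFlag z) (clear ℓ)‖ ^ 2 = clearProb ℓ M v b ^ 3 ^ k := by
  induction k with
  | zero =>
    obtain ⟨G, hG, hG2⟩ := exists_grover O v b hM z f₀
    have h := run_tests O v b (fun f F φ => hG f F φ) (List.finRange ℓ)
    obtain ⟨U, hU⟩ := exists_isometry (embFlag v b) (normSq_embFlag v b) (run O (search z 0))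
      (normSq_run O _) _ h
    refine ⟨U, fun Φ => by rw [hU]; exact h Φ, ?_⟩
    rw [hU, foldl_testOp_clear G _ (List.nodup_finRange _)]
    · have hs : (startFlag z : FlagSpace ℓ n p) (clear ℓ) = start z := by simp [startFlag]
      rw [hs, norm_foldl_half_add_sq ℓ G (Real.arccos (overlap M v b)), norm_start]
      · simp [clearProb]
      · rw [Real.cos_arccos (neg_le_of_abs_le (abs_overlap_le_one v b M))
          (le_of_abs_le (abs_overlap_le_one v b M)), hG2]
    · rintro F ⟨f, _, hF⟩
      have : F ≠ clear ℓ := by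
        rintro rfl
        simp [clear] at hF
      simp [startFlag, this]
  | succ k ih =>
    obtain ⟨U, hU, hU2⟩ := ih
    have h : ∀ Φ : FlagSpace ℓ n p, run O (search z (k + 1)) (embFlag v b Φ) = embFlag v b
        (U ((fun Φ => Φ + ((phase (Real.pi / 3) - 1) * inner ℂ (startFlag z) Φ) • startFlag z)
          (U.symm ((fun Φ => Φ + (phase (-(Real.pi / 3)) - 1) • projClear Φ) (U Φ))))) := by
      intro Φ
      have hinv : ∀ Φ, run O (invC (search z k)) (embFlag v b Φ) = embFlag v b (U.symm Φ) := by
        intro Φ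
        conv_lhs => rw [← U.apply_symm_apply Φ, ← hU, run_invC_run]
      rw [search, run_append, run_append, run_append, run_append, hU, run_markClear, hinv,
        run_markStart, hU]
    obtain ⟨U', hU'⟩ := exists_isometry (embFlag v b) (normSq_embFlag v b)
      (run O (search z (k + 1))) (normSq_run O _) _ h
    refine ⟨U', fun Φ => by rw [hU', h], ?_⟩
    rw [← norm_projClear_sq, hU',
      fixed_point_step U projClear (startFlag z) (fun Φ => ?_) inner_projClear (norm_startFlag z)
        _ _ (fun _ => rfl) (fun _ => rfl), norm_projClear_sq, hU2, pow_succ 3 k, pow_mul]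
    ext F : 1
    simp only [projClear_apply]
    split_ifs <;> rfl

end Flags

/-! ### The verification circuit -/

section Verify

variable {ℓ n p : ℕ} (O : Oracles n p) {v b : Fin n → ZMod p}
  {M : Matrix (Fin n) (Fin n) (ZMod p)}

/-- The final configuration. -/
def reported (v b : Fin n → ZMod p) (x : (Fin ℓ → Bool) × Item n p) : Conf ℓ n p :=
  { std v b x.1 x.2 with out := decide (x.1 = clear ℓ) }

lemma run_report (F : Fin ℓ → Bool) (c : Item n p) :
    run O report (ket (std v b F c).bits) =
      ket (reported v b (F, c)).bits := by
  rw [report, run_conj_had O (fun t => run_ladder_out O v b Real.pi F c t), update_out]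
  have : xor ((std v b F c).bits .out) (decide (F = clear ℓ)) = decide (F = clear ℓ) :=
    Bool.false_xor _
  rw [this]
  rfl

lemma run_verify_eq [NeZero p] (hM : IsMatOracle M O.UM) (hv : IsVecOracle v O.Uv)
    (hb : IsVecOracle b O.Ub) (z : Fin n) (f₀ : Fin ℓ) (k : ℕ) :
    ∃ Φ : FlagSpace ℓ n p, ‖Φ‖ = 1 ∧ ‖Φ (clear ℓ)‖ ^ 2 = clearProb ℓ M v b ^ 3 ^ k ∧
      run O (verify z k) (ket fun _ => false) =
        ∑ x : (Fin ℓ → Bool) × Item n p, Φ x.1 x.2 •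
          ket (reported v b x).bits := by
  obtain ⟨U, hU, hU2⟩ := exists_search O v b hM z f₀ k
  refine ⟨U (startFlag z), by rw [U.norm_map, norm_startFlag], hU2, ?_⟩
  let c₀ : Conf ℓ n p :=
    { flag := clear ℓ, hot := fun _ => false, y := fun _ => false, row := fun _ => false,
      col := fun _ => false, val := fun _ => false, vec := fun _ _ => false,
      rhs := fun _ _ => false, anc := fun _ => false, out := false }
  have h0 : (fun _ => false : Bits (Reg ℓ n p)) = c₀.bits := by
    ext r; cases r <;> rfl
  have h1 : Function.update (fun _ : Fin n => false) z true = fun i => decide (i = z) := by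
    ext i; by_cases h : i = z <;> simp [h]
  have h2 : run O loadRhs (run O loadVec (run O [flip (.hot z)] (ket c₀.bits))) =
      embFlag v b (startFlag z) := by
    rw [run_flip, update_hot, run_loadVec O hv _ rfl rfl, run_loadRhs O hb _ rfl rfl, embFlag_apply,
      Finset.sum_eq_single (clear ℓ)]
    · have : (startFlag z : FlagSpace ℓ n p) (clear ℓ) = start z := by simp [startFlag]
      rw [this]
      have h3 : emb v b (clear ℓ) (start z) = ket (std v b (clear ℓ) (z, fun _ => false)).bits :=
        embFun_single v b _ _
      rw [h3]
      simp only [c₀, std, Conf.bits, Bool.not_false, h1]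
    · intro F _ hF
      simp [startFlag, hF]
    · simp
  rw [verify, run_append, run_append, run_append, run_append, h0, h2, hU, embFlag_eq, map_sum]
  refine Finset.sum_congr rfl fun x _ => ?_
  rw [map_smul, run_report]

/-- The output bit is `1` exactly on the all-clear component; the rejection probability is the rest
of a unit vector. -/
lemma verify_prob [NeZero p] (hM : IsMatOracle M O.UM) (hv : IsVecOracle v O.Uv)
    (hb : IsVecOracle b O.Ub) (z : Fin n) (f₀ : Fin ℓ) (k : ℕ) :
    (compile (verify z k) (.out : Reg ℓ n p)).acceptProb O.UM O.Uv O.Ub =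
        clearProb ℓ M v b ^ 3 ^ k ∧
      (compile (verify z k) (.out : Reg ℓ n p)).rejectProb O.UM O.Uv O.Ub =
        1 - clearProb ℓ M v b ^ 3 ^ k := by
  obtain ⟨Φ, h1, h2, h3⟩ := run_verify_eq O hM hv hb z f₀ k
  have hinj : Function.Injective fun x : (Fin ℓ → Bool) × Item n p =>
      (reported v b x).bits := by
    intro x x' h
    refine std_injective v b ?_
    ext r
    cases r with
    | out => rfl
    | flag i => exact congrFun h (.flag i)
    | hot i => exact congrFun h (.hot i)
    | y i => exact congrFun h (.y i)
    | row i => exact congrFun h (.row i)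
    | col i => exact congrFun h (.col i)
    | val i => exact congrFun h (.val i)
    | vec k i => exact congrFun h (.vec k i)
    | rhs k i => exact congrFun h (.rhs k i)
    | anc i => exact congrFun h (.anc i)
  have hprob : ∀ t : Bool, (compile (verify z k) (.out : Reg ℓ n p)).prob O.UM O.Uv O.Ub t =
      ∑ F : Fin ℓ → Bool, if decide (F = clear ℓ) = t then ‖Φ F‖ ^ 2 else 0 := by
    intro t
    rw [compile_prob, h3, sum_ite_sum_ket hinj _ fun x => x .out = t, Fintype.sum_prod_type]
    refine Finset.sum_congr rfl fun F _ => ?_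
    rw [EuclideanSpace.norm_sq_eq]
    change (∑ c, if decide (F = clear ℓ) = t then ‖Φ F c‖ ^ 2 else 0) = _
    by_cases hF : decide (F = clear ℓ) = t <;> simp only [hF, if_true, if_false,
      Finset.sum_const_zero]
  have hacc : (compile (verify z k) (.out : Reg ℓ n p)).prob O.UM O.Uv O.Ub true =
      clearProb ℓ M v b ^ 3 ^ k := by
    rw [hprob, ← h2]
    simp
  refine ⟨hacc, ?_⟩
  have hsum : (compile (verify z k) (.out : Reg ℓ n p)).prob O.UM O.Uv O.Ub true +
      (compile (verify z k) (.out : Reg ℓ n p)).prob O.UM O.Uv O.Ub false = 1 := by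
    rw [hprob, hprob, ← Finset.sum_add_distrib]
    have h4 := PiLp.norm_sq_eq_of_L2 _ Φ
    rw [h1, one_pow] at h4
    rw [h4]
    refine Finset.sum_congr rfl fun F _ => ?_
    by_cases hF : F = clear ℓ <;> simp [hF]
  rw [QueryAlgorithm.rejectProb, ← hacc]
  linarith

end Verify

/-! ### Acceptance probability -/

section Probability

variable {ℓ n p : ℕ} {M : Matrix (Fin n) (Fin n) (ZMod p)} {v b : Fin n → ZMod p}

lemma dvd_residue_iff [NeZero p] (j : Fin n) :
    (p : ℤ) ∣ residue M v b j ↔ M.mulVec v j = b j := by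
  rw [← ZMod.intCast_zmod_eq_zero_iff_dvd, residue_cast, sub_eq_zero]

lemma clearProb_of_eq (hp : p.Prime) (hn : 0 < n) (h : M.mulVec v = b) :
    clearProb ℓ M v b = 1 := by
  have : NeZero p := ⟨hp.ne_zero⟩
  have h1 : overlap M v b = 1 := by
    rw [overlap, Finset.sum_congr rfl fun j _ =>
      prod_cos_eq_one hp ((dvd_residue_iff j).2 (congrFun h j)) _]
    have : (n : ℝ) ≠ 0 := by positivity
    simp [this]
  simp [clearProb, h1]

lemma clearProb_nonneg (ℓ : ℕ) (M : Matrix (Fin n) (Fin n) (ZMod p)) (v b : Fin n → ZMod p) :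
    0 ≤ clearProb ℓ M v b :=
  Finset.prod_nonneg fun _ _ => sq_nonneg _

/-- A single wrong row loses at least `1 / 4` of the sum; every other row contributes at most `1`.
-/
lemma overlap_le (hp : p.Prime) (h : M.mulVec v ≠ b) : overlap M v b ≤ 1 - 1 / (4 * n) := by
  have : NeZero p := ⟨hp.ne_zero⟩
  obtain ⟨j, hj⟩ := Function.ne_iff.1 h
  have hn : (0 : ℝ) < n := by exact_mod_cast j.pos
  have h1 : ∏ s ∈ Finset.range (width p),
      Real.cos (2 ^ s * (2 * Real.pi / p * residue M v b j)) ≤ 3 / 4 :=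
    prod_cos_le hp fun h => hj ((dvd_residue_iff j).1 h)
  have h2 : ∑ i, ∏ s ∈ Finset.range (width p),
      Real.cos (2 ^ s * (2 * Real.pi / p * residue M v b i)) ≤ n - 1 / 4 := by
    rw [← Finset.add_sum_erase _ _ (Finset.mem_univ j)]
    have h3 : ∑ i ∈ Finset.univ.erase j, ∏ s ∈ Finset.range (width p),
        Real.cos (2 ^ s * (2 * Real.pi / p * residue M v b i)) ≤
        ∑ i ∈ Finset.univ.erase j, (1 : ℝ) :=
      Finset.sum_le_sum fun i _ => (le_abs_self _).trans (abs_prod_cos_le_one _ _)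
    rw [Finset.sum_const, Finset.card_erase_of_mem (Finset.mem_univ j), Finset.card_univ,
      Fintype.card_fin, nsmul_eq_mul, mul_one, Nat.cast_sub j.pos] at h3
    push_cast at h3
    linarith
  calc overlap M v b ≤ (n : ℝ)⁻¹ * (n - 1 / 4) := by
        rw [overlap]
        gcongr
    _ = 1 - 1 / (4 * n) := by field_simp

/-- From `cos α ≥ 1 - α² / 2` follows `α² ≥ 1 / (2 n)`. Then `(2 ^ ℓ α / 2)² ≥ 64 n / (8 n) = 8 > (π
/ 2)²`, so the doubled angles pass `π / 2`. -/
lemma clearProb_le (hp : p.Prime) (hℓ : 64 * n ≤ 4 ^ ℓ) (h : M.mulVec v ≠ b) :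
    clearProb ℓ M v b ≤ 1 / 2 := by
  have hn : (0 : ℝ) < n := by
    obtain ⟨j, _⟩ := Function.ne_iff.1 h
    exact_mod_cast j.pos
  have h1 := overlap_le hp h
  set α := Real.arccos (overlap M v b) with hα
  have hcos : Real.cos α = overlap M v b :=
    Real.cos_arccos (neg_le_of_abs_le (abs_overlap_le_one v b M))
      (le_of_abs_le (abs_overlap_le_one v b M))
  have h2 : 1 / (2 * n) ≤ α ^ 2 := by
    have := Real.one_sub_sq_div_two_le_cos (x := α)
    rw [hcos] at this
    have e : (1 : ℝ) / (2 * n) = 2 * (1 / (4 * n)) := by field_simp; norm_num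
    rw [e]
    linarith
  have h0 : 0 ≤ α := Real.arccos_nonneg _
  have hpos : 0 < α := by
    rcases h0.eq_or_lt with h | h
    · rw [← h] at h2
      have h3 : (0 : ℝ) < 1 / (2 * n) := by positivity
      linarith [zero_pow (M₀ := ℝ) two_ne_zero]
    · exact h
  have hpi : α ≤ Real.pi := Real.arccos_le_pi _
  refine prod_cos_sq_le ℓ (α / 2) (by linarith) (by linarith) ?_
  refine lt_of_pow_lt_pow_left₀ 2 (by positivity) ?_
  have h3 : (64 * n : ℝ) ≤ 4 ^ ℓ := by exact_mod_cast hℓ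
  have h4 : ((2 : ℝ) ^ ℓ * (α / 2)) ^ 2 = 4 ^ ℓ * α ^ 2 / 4 := by
    rw [mul_pow, ← pow_mul, mul_comm ℓ 2, pow_mul]
    norm_num
    ring
  have h5 : (64 * n : ℝ) * (1 / (2 * n)) ≤ 4 ^ ℓ * α ^ 2 := by gcongr
  have h6 : (64 * n : ℝ) * (1 / (2 * n)) = 32 := by field_simp; norm_num
  have h7 := Real.pi_lt_four
  have h8 := Real.pi_pos
  rw [h4]
  nlinarith

end Probability

/-! ### Resources -/

section Resources

variable {ℓ n p : ℕ}

section

variable {ι α : Type}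

lemma gates_flatMap_le_mul_queries {L : List α} {f : α → List (Op n p ι)} {r : ℕ}
    (h : ∀ a ∈ L, gates (f a) ≤ r * queries (f a)) :
    gates (L.flatMap f) ≤ r * queries (L.flatMap f) := by
  induction L with
  | nil => simp
  | cons a L ih =>
    have h1 := h a (by simp)
    have h2 := ih fun a ha => h a (by simp [ha])
    simp only [List.flatMap_cons, gates_append, queries_append, mul_add]
    linarith

lemma queries_flatMap_eq_zero {L : List α} {f : α → List (Op n p ι)}
    (h : ∀ a, queries (f a) = 0) : queries (L.flatMap f) = 0 := by
  rw [queries_flatMap fun a _ => h a, mul_zero]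

lemma vqueries_flatMap_eq_zero {L : List α} {f : α → List (Op n p ι)}
    (h : ∀ a, vqueries (f a) = 0) : vqueries (L.flatMap f) = 0 := by
  rw [vqueries_flatMap fun a _ => h a, mul_zero]

lemma gates_finRange_le {m : ℕ} {f : Fin m → List (Op n p ι)} {r : ℕ}
    (h : ∀ a, gates (f a) ≤ r) : gates ((List.finRange m).flatMap f) ≤ m * r := by
  simpa using gates_flatMap_le (L := List.finRange m) fun a _ => h a

lemma gates_ite_le {c : Prop} [Decidable c] {C : List (Op n p ι)} {r : ℕ} (h : gates C ≤ r) :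
    gates (if c then C else []) ≤ r := by
  split_ifs
  · exact h
  · simp

lemma queries_ite {c : Prop} [Decidable c] {C : List (Op n p ι)} (h : queries C = 0) :
    queries (if c then C else []) = 0 := by
  split_ifs
  · exact h
  · rfl

lemma vqueries_ite {c : Prop} [Decidable c] {C : List (Op n p ι)} (h : vqueries C = 0) :
    vqueries (if c then C else []) = 0 := by
  split_ifs
  · exact h
  · rfl

lemma gates_replicate_flatten (m : ℕ) (C : List (Op n p ι)) :
    gates (List.replicate m C).flatten = m * gates C := by
  induction m with
  | zero => simp
  | succ m ih => rw [List.replicate_succ, List.flatten_cons, gates_append, ih]; ring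

lemma queries_replicate_flatten (m : ℕ) (C : List (Op n p ι)) :
    queries (List.replicate m C).flatten = m * queries C := by
  induction m with
  | zero => simp
  | succ m ih => rw [List.replicate_succ, List.flatten_cons, queries_append, ih]; ring

lemma vqueries_replicate_flatten (m : ℕ) (C : List (Op n p ι)) :
    vqueries (List.replicate m C).flatten = m * vqueries C := by
  induction m with
  | zero => simp
  | succ m ih => rw [List.replicate_succ, List.flatten_cons, vqueries_append, ih]; ring

section

variable [DecidableEq ι] {w : ℕ}

lemma gates_write (r : Fin w → ι) (a : ℕ) :
    gates (write r a : List (Op n p ι)) ≤ w :=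
  (gates_finRange_le (r := 1) fun i => gates_ite_le (gates_flip (r i)).le).trans (mul_one w).le

@[simp] lemma queries_write (r : Fin w → ι) (a : ℕ) :
    queries (write r a : List (Op n p ι)) = 0 :=
  queries_flatMap_eq_zero fun _ => queries_ite (queries_flip _)

@[simp] lemma vqueries_write (r : Fin w → ι) (a : ℕ) :
    vqueries (write r a : List (Op n p ι)) = 0 :=
  vqueries_flatMap_eq_zero fun _ => vqueries_ite (vqueries_flip _)

lemma gates_trilinear (a b c : Fin w → ι) (θ : ℝ) :
    gates (trilinear a b c θ : List (Op n p ι)) ≤ w * (w * (w * 5)) :=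
  gates_finRange_le fun _ => gates_finRange_le fun _ => gates_finRange_le fun _ =>
    gates_ccphase _ _ _ _ _

@[simp] lemma queries_trilinear (a b c : Fin w → ι) (θ : ℝ) :
    queries (trilinear a b c θ : List (Op n p ι)) = 0 :=
  queries_flatMap_eq_zero fun _ => queries_flatMap_eq_zero fun _ =>
    queries_flatMap_eq_zero fun _ => queries_ccphase _ _ _ _ _

@[simp] lemma vqueries_trilinear (a b c : Fin w → ι) (θ : ℝ) :
    vqueries (trilinear a b c θ : List (Op n p ι)) = 0 :=
  vqueries_flatMap_eq_zero fun _ => vqueries_flatMap_eq_zero fun _ =>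
    vqueries_flatMap_eq_zero fun _ => vqueries_ccphase _ _ _ _ _

lemma gates_bilinear (h : ι) (a b : Fin w → ι) (θ : ℝ) :
    gates (bilinear h a b θ : List (Op n p ι)) ≤ w * (w * 5) :=
  gates_finRange_le fun _ => gates_finRange_le fun _ => gates_ccphase _ _ _ _ _

@[simp] lemma queries_bilinear (h : ι) (a b : Fin w → ι) (θ : ℝ) :
    queries (bilinear h a b θ : List (Op n p ι)) = 0 :=
  queries_flatMap_eq_zero fun _ => queries_flatMap_eq_zero fun _ => queries_ccphase _ _ _ _ _

@[simp] lemma vqueries_bilinear (h : ι) (a b : Fin w → ι) (θ : ℝ) :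
    vqueries (bilinear h a b θ : List (Op n p ι)) = 0 :=
  vqueries_flatMap_eq_zero fun _ => vqueries_flatMap_eq_zero fun _ => vqueries_ccphase _ _ _ _ _

end

end

lemma gates_loadRow : gates (loadRow : List (Op n p (Reg ℓ n p))) ≤ n * (width n * 1) :=
  gates_finRange_le fun _ => gates_finRange_le fun _ => gates_ite_le (gates_cnot _ _)

@[simp] lemma queries_loadRow : queries (loadRow : List (Op n p (Reg ℓ n p))) = 0 :=
  queries_flatMap_eq_zero fun _ => queries_flatMap_eq_zero fun _ => queries_ite (queries_cnot _ _)

@[simp] lemma vqueries_loadRow : vqueries (loadRow : List (Op n p (Reg ℓ n p))) = 0 :=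
  vqueries_flatMap_eq_zero fun _ => vqueries_flatMap_eq_zero fun _ =>
    vqueries_ite (vqueries_cnot _ _)

lemma gates_loadVec : gates (loadVec : List (Op n p (Reg ℓ n p))) ≤ n * (2 * width n) :=
  gates_finRange_le fun k => by
    rw [gates_conj]
    have := gates_write (n := n) (p := p) (Reg.row : _ → Reg ℓ n p) k
    have h : gates [(Op.queryV false (vecEmb k) : Op n p (Reg ℓ n p))] = 0 := rfl
    omega

@[simp] lemma queries_loadVec : queries (loadVec : List (Op n p (Reg ℓ n p))) = 0 :=
  queries_flatMap_eq_zero fun k => by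
    rw [queries_conj, queries_write]
    rfl

@[simp] lemma vqueries_loadVec : vqueries (loadVec : List (Op n p (Reg ℓ n p))) = n := by
  rw [loadVec, vqueries_flatMap (b := 1), List.length_finRange, mul_one]
  intro k _
  rw [vqueries_conj, vqueries_write]
  rfl

lemma gates_loadRhs : gates (loadRhs : List (Op n p (Reg ℓ n p))) ≤ n * (2 * width n) :=
  gates_finRange_le fun k => by
    rw [gates_conj]
    have := gates_write (n := n) (p := p) (Reg.row : _ → Reg ℓ n p) k
    have h : gates [(Op.queryB false (rhsEmb k) : Op n p (Reg ℓ n p))] = 0 := rfl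
    omega

@[simp] lemma queries_loadRhs : queries (loadRhs : List (Op n p (Reg ℓ n p))) = 0 :=
  queries_flatMap_eq_zero fun k => by
    rw [queries_conj, queries_write]
    rfl

@[simp] lemma vqueries_loadRhs : vqueries (loadRhs : List (Op n p (Reg ℓ n p))) = n := by
  rw [loadRhs, vqueries_flatMap (b := 1), List.length_finRange, mul_one]
  intro k _
  rw [vqueries_conj, vqueries_write]
  rfl

lemma gates_phaseOracle : gates (phaseOracle : List (Op n p (Reg ℓ n p))) ≤
    2 * (n * width n) + n * (2 * width n + 5 * width p ^ 3) + n * (5 * width p ^ 2) := by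
  have h1 := gates_loadRow (ℓ := ℓ) (n := n) (p := p)
  have h2 : ∀ k : Fin n, gates (conj (write .col k ++ [.queryM false matEmb])
      (trilinear .y (.vec k) .val (2 * Real.pi / p)) : List (Op n p (Reg ℓ n p))) ≤
      2 * width n + 5 * width p ^ 3 := by
    intro k
    rw [gates_conj, gates_append]
    have h3 := gates_write (n := n) (p := p) (Reg.col : _ → Reg ℓ n p) k
    have h4 : gates [(Op.queryM false matEmb : Op n p (Reg ℓ n p))] = 0 := rfl
    have h5 := gates_trilinear (n := n) (p := p) (.y : _ → Reg ℓ n p) (.vec k) .val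
      (2 * Real.pi / p)
    have h6 : width p * (width p * (width p * 5)) = 5 * width p ^ 3 := by ring
    omega
  have h3 : ∀ j : Fin n, gates (bilinear (.hot j) .y (.rhs j) (-(2 * Real.pi / p)) :
      List (Op n p (Reg ℓ n p))) ≤ 5 * width p ^ 2 := by
    intro j
    refine (gates_bilinear _ _ _ _).trans (le_of_eq ?_)
    ring
  have h4 := gates_finRange_le h2
  have h5 := gates_finRange_le h3
  rw [phaseOracle, gates_append, gates_conj]
  rw [mul_one] at h1
  omega

@[simp] lemma queries_phaseOracle :
    queries (phaseOracle : List (Op n p (Reg ℓ n p))) = 2 * n := by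
  rw [phaseOracle, queries_append, queries_conj, queries_loadRow, queries_flatMap (b := 2),
    queries_flatMap_eq_zero fun _ => queries_bilinear _ _ _ _, List.length_finRange]
  · ring
  · intro k _
    rw [queries_conj, queries_append, queries_write, queries_trilinear]
    rfl

@[simp] lemma vqueries_phaseOracle :
    vqueries (phaseOracle : List (Op n p (Reg ℓ n p))) = 0 := by
  rw [phaseOracle, vqueries_append, vqueries_conj, vqueries_loadRow,
    vqueries_flatMap_eq_zero fun _ => vqueries_bilinear _ _ _ _, vqueries_flatMap_eq_zero]
  intro k
  rw [vqueries_conj, vqueries_append, vqueries_write, vqueries_trilinear]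
  rfl

lemma gates_rotations (z : Fin n) (L : List (Fin n)) :
    gates (rotations z L : List (Op n p (Reg ℓ n p))) ≤ L.length := by
  induction L with
  | nil => simp [rotations]
  | cons j L ih =>
    rw [rotations, gates_append, List.length_cons]
    have := gates_rot (n := n) (p := p) (Reg.hot z : Reg ℓ n p) (.hot j)
      (Real.arcsin (Real.sqrt (L.length + 2))⁻¹)
    omega

@[simp] lemma queries_rotations (z : Fin n) (L : List (Fin n)) :
    queries (rotations z L : List (Op n p (Reg ℓ n p))) = 0 := by
  induction L with
  | nil => rfl
  | cons j L ih => rw [rotations, queries_append, queries_rot, ih]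

@[simp] lemma vqueries_rotations (z : Fin n) (L : List (Fin n)) :
    vqueries (rotations z L : List (Op n p (Reg ℓ n p))) = 0 := by
  induction L with
  | nil => rfl
  | cons j L ih => rw [rotations, vqueries_append, vqueries_rot, ih]

lemma gates_spread (z : Fin n) :
    gates (spread z : List (Op n p (Reg ℓ n p))) ≤ n + width p := by
  have h1 := gates_rotations (ℓ := ℓ) (p := p) z ((List.finRange n).filter (· ≠ z))
  have h2 : ((List.finRange n).filter (· ≠ z)).length ≤ n :=
    (List.length_filter_le _ _).trans (List.length_finRange).le
  have h3 := gates_finRange_le (f := fun s => [(had (.y s) : Op n p (Reg ℓ n p))])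
    fun s => (gates_had _).le
  rw [spread, gates_append]
  omega

@[simp] lemma queries_spread (z : Fin n) :
    queries (spread z : List (Op n p (Reg ℓ n p))) = 0 := by
  rw [spread, queries_append, queries_rotations, queries_flatMap_eq_zero fun _ => queries_had _]

@[simp] lemma vqueries_spread (z : Fin n) :
    vqueries (spread z : List (Op n p (Reg ℓ n p))) = 0 := by
  rw [spread, vqueries_append, vqueries_rotations, vqueries_flatMap_eq_zero fun _ => vqueries_had _]

lemma gates_kick (f : Fin ℓ) : gates (kick f : List (Op n p (Reg ℓ n p))) ≤ width p * 1 :=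
  gates_finRange_le fun _ => gates_cnot _ _

@[simp] lemma queries_kick (f : Fin ℓ) : queries (kick f : List (Op n p (Reg ℓ n p))) = 0 :=
  queries_flatMap_eq_zero fun _ => queries_cnot _ _

@[simp] lemma vqueries_kick (f : Fin ℓ) : vqueries (kick f : List (Op n p (Reg ℓ n p))) = 0 :=
  vqueries_flatMap_eq_zero fun _ => vqueries_cnot _ _

/-- The number of gates per query to the matrix oracle, up to a constant. -/
def overhead (n p : ℕ) : ℕ := (width n + 1) * width p ^ 3

/-- The summand `2` reserves room for the two Hadamard gates of a test. -/
lemma gates_grover (hn : 0 < n) (hp : 0 < width p) (z : Fin n) (f : Fin ℓ) :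
    gates (grover z f : List (Op n p (Reg ℓ n p))) + 2 ≤ 65 * (n * overhead n p) := by
  have h1 := gates_phaseOracle (ℓ := ℓ) (n := n) (p := p)
  have h2 := gates_spread (ℓ := ℓ) (p := p) z
  have h3 := gates_kick (n := n) (p := p) f
  have h4 := gates_ladder (n := n) (p := p) Real.pi ((.hot z, true) :: yLits) ancs
    (.flag f : Reg ℓ n p)
  have h5 : ((.hot z, true) :: yLits : List (Reg ℓ n p × Bool)).length = width p + 1 := by
    simp [yLits]
  rw [h5] at h4
  rw [grover, gates_append, gates_conj, gates_append, gates_append, gates_phaseGate]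
  have hw : 1 ≤ width p := hp
  have hT : overhead n p = (width n + 1) * width p ^ 3 := rfl
  have h6 : width p ≤ width p ^ 3 := Nat.le_self_pow (by norm_num) _
  have h7 : width p ^ 2 ≤ width p ^ 3 := Nat.pow_le_pow_right hw (by norm_num)
  have h8 : width n * 1 ≤ width n * width p ^ 3 := Nat.mul_le_mul_left _ (Nat.one_le_pow _ _ hw)
  have h9 : overhead n p = width n * width p ^ 3 + width p ^ 3 := by rw [hT]; ring
  have h10 : n * (2 * width n + 5 * width p ^ 3) ≤ n * (5 * overhead n p) :=
    Nat.mul_le_mul_left _ (by omega)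
  have h11 : n * (5 * width p ^ 2) ≤ n * (5 * overhead n p) := Nat.mul_le_mul_left _ (by omega)
  have h12 : n * width n ≤ n * overhead n p := Nat.mul_le_mul_left _ (by omega)
  have h13 : width p ≤ n * overhead n p := h6.trans ((Nat.le_mul_of_pos_left _ hn).trans
    (Nat.mul_le_mul_left _ (by omega)))
  have h14 : n ≤ n * overhead n p := Nat.le_mul_of_pos_right _ (by omega)
  have h15 : n * (5 * overhead n p) = 5 * (n * overhead n p) := by ring
  omega

end Resources

/-! ### Totals for the tests, the search and the verification circuit -/

section Resources

variable {ℓ n p : ℕ}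

@[simp] lemma queries_grover (z : Fin n) (f : Fin ℓ) :
    queries (grover z f : List (Op n p (Reg ℓ n p))) = 4 * n := by
  simp only [grover, queries_append, queries_conj, queries_spread, queries_phaseOracle,
    queries_kick, queries_phaseGate, queries_ladder]
  ring

@[simp] lemma vqueries_grover (z : Fin n) (f : Fin ℓ) :
    vqueries (grover z f : List (Op n p (Reg ℓ n p))) = 0 := by
  simp only [grover, vqueries_append, vqueries_conj, vqueries_spread, vqueries_phaseOracle,
    vqueries_kick, vqueries_phaseGate, vqueries_ladder]

lemma queries_test (z : Fin n) (f : Fin ℓ) :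
    queries (test z f : List (Op n p (Reg ℓ n p))) = 2 ^ (f : ℕ) * (4 * n) := by
  simp only [test, queries_append, queries_had, queries_replicate_flatten, queries_grover]
  ring

lemma vqueries_test (z : Fin n) (f : Fin ℓ) :
    vqueries (test z f : List (Op n p (Reg ℓ n p))) = 0 := by
  simp only [test, vqueries_append, vqueries_had, vqueries_replicate_flatten, vqueries_grover,
    mul_zero, add_zero]

lemma gates_test_le (hn : 0 < n) (hp : 0 < width p) (z : Fin n) (f : Fin ℓ) :
    gates (test z f : List (Op n p (Reg ℓ n p))) ≤
      17 * overhead n p * queries (test z f : List (Op n p (Reg ℓ n p))) := by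
  have h1 := gates_grover (ℓ := ℓ) hn hp z f
  have h2 : 1 ≤ 2 ^ (f : ℕ) := Nat.one_le_two_pow
  rw [queries_test, test, gates_append, gates_append, gates_had, gates_replicate_flatten]
  calc 1 + (2 ^ (f : ℕ) * gates (grover z f : List (Op n p (Reg ℓ n p))) + 1)
      ≤ 2 ^ (f : ℕ) * (gates (grover z f : List (Op n p (Reg ℓ n p))) + 2) := by
        rw [mul_add]; omega
    _ ≤ 2 ^ (f : ℕ) * (68 * (n * overhead n p)) := Nat.mul_le_mul_left _ (by omega)
    _ = 17 * overhead n p * (2 ^ (f : ℕ) * (4 * n)) := by ring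

lemma queries_search_zero (z : Fin n) :
    queries (search z 0 : List (Op n p (Reg ℓ n p))) = (2 ^ ℓ - 1) * (4 * n) := by
  have h : ∀ L : List (Fin ℓ), queries (L.flatMap (test z) : List (Op n p (Reg ℓ n p))) =
      (L.map fun f : Fin ℓ => 2 ^ (f : ℕ)).sum * (4 * n) := by
    intro L
    induction L with
    | nil => simp
    | cons f L ih =>
      rw [List.flatMap_cons, queries_append, ih, queries_test, List.map_cons, List.sum_cons, add_mul]
  rw [search, h, ← List.ofFn_eq_map, List.sum_ofFn, Fin.sum_univ_eq_sum_range (fun i => 2 ^ i),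
    Nat.geomSum_eq le_rfl]
  simp

lemma queries_search (z : Fin n) (k : ℕ) :
    queries (search z k : List (Op n p (Reg ℓ n p))) = 3 ^ k * ((2 ^ ℓ - 1) * (4 * n)) := by
  induction k with
  | zero => rw [queries_search_zero, pow_zero, one_mul]
  | succ k ih =>
    simp only [search, queries_append, queries_invC, ih, markClear, markStart, queries_conj,
      queries_flip, queries_ladder]
    ring

lemma vqueries_search (z : Fin n) (k : ℕ) :
    vqueries (search z k : List (Op n p (Reg ℓ n p))) = 0 := by
  induction k with
  | zero => exact vqueries_flatMap_eq_zero fun f => vqueries_test z f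
  | succ k ih =>
    simp only [search, vqueries_append, vqueries_invC, ih, markClear, markStart, vqueries_conj,
      vqueries_flip, vqueries_ladder]

lemma gates_markClear_le :
    gates (markClear : List (Op n p (Reg ℓ n p))) ≤ 14 * ℓ + 3 := by
  have h := gates_ladder (n := n) (p := p) (-(Real.pi / 3)) flagLits ancs (.out : Reg ℓ n p)
  have h2 : (flagLits : List (Reg ℓ n p × Bool)).length = ℓ := by simp [flagLits]
  rw [markClear, gates_conj, gates_flip]
  omega

lemma gates_markStart_le (z : Fin n) :
    gates (markStart z : List (Op n p (Reg ℓ n p))) ≤ 14 * (width p + ℓ) + 1 := by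
  have h := gates_ladder (n := n) (p := p) (Real.pi / 3) (yLits ++ flagLits) ancs
    (.hot z : Reg ℓ n p)
  have h2 : (yLits ++ flagLits : List (Reg ℓ n p × Bool)).length = width p + ℓ := by
    simp [flagLits, yLits]
  rw [h2] at h
  exact h

lemma gates_report_le :
    gates (report : List (Op n p (Reg ℓ n p))) ≤ 14 * ℓ + 3 := by
  have h := gates_ladder (n := n) (p := p) Real.pi flagLits ancs (.out : Reg ℓ n p)
  have h2 : (flagLits : List (Reg ℓ n p × Bool)).length = ℓ := by simp [flagLits]
  rw [report, gates_conj, gates_had]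
  omega

lemma overhead_ge (hp : 0 < width p) : width n + 1 ≤ overhead n p ∧ width p ≤ overhead n p := by
  have h1 : 1 ≤ width p ^ 3 := Nat.one_le_pow _ _ hp
  have h2 : width p ≤ width p ^ 3 := Nat.le_self_pow (by norm_num) _
  exact ⟨Nat.le_mul_of_pos_right _ h1, h2.trans (Nat.le_mul_of_pos_left _ (Nat.succ_pos _))⟩

/-- The margin pays for the phase gates of the next round of amplification. -/
lemma gates_search_le (hn : 0 < n) (hp : 0 < width p) (hℓ : 1 ≤ ℓ) (hℓ2 : ℓ ≤ width n + 4)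
    (z : Fin n) (k : ℕ) :
    gates (search z k : List (Op n p (Reg ℓ n p))) + 76 * overhead n p ≤
      36 * overhead n p * queries (search z k : List (Op n p (Reg ℓ n p))) := by
  have h1 : 4 ≤ (2 ^ ℓ - 1) * (4 * n) := by
    have h2 : 2 ≤ 2 ^ ℓ := Nat.le_self_pow (by omega) 2
    calc 4 = 1 * (4 * 1) := rfl
      _ ≤ (2 ^ ℓ - 1) * (4 * n) := Nat.mul_le_mul (by omega) (by omega)
  induction k with
  | zero =>
    have h2 : gates (search z 0 : List (Op n p (Reg ℓ n p))) ≤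
        17 * overhead n p * queries (search z 0 : List (Op n p (Reg ℓ n p))) :=
      gates_flatMap_le_mul_queries fun f _ => gates_test_le hn hp z f
    -- Raising the factor from `17` to `36 = 17 + 19` buys the margin `76 = 19 * 4`, as there are at
    -- least four queries.
    have h3 : 19 * overhead n p * 4 ≤
        19 * overhead n p * queries (search z 0 : List (Op n p (Reg ℓ n p))) :=
      Nat.mul_le_mul_left _ (by rwa [queries_search_zero])
    linarith
  | succ k ih =>
    have h2 := gates_markClear_le (ℓ := ℓ) (n := n) (p := p)
    have h3 := gates_markStart_le (ℓ := ℓ) (p := p) z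
    obtain ⟨h4, h5⟩ := overhead_ge (n := n) hp
    have h6 : queries (search z (k + 1) : List (Op n p (Reg ℓ n p))) =
        3 * queries (search z k : List (Op n p (Reg ℓ n p))) := by
      rw [queries_search, queries_search]
      ring
    rw [h6]
    simp only [search, gates_append, gates_invC]
    -- Three copies of the search bring three margins; one is kept and two pay for the phase
    -- circuits.
    have h7 : 14 * ℓ + 3 + (14 * (width p + ℓ) + 1) ≤ 2 * (76 * overhead n p) := by omega
    linarith

lemma vqueries_verify (z : Fin n) (k : ℕ) :
    vqueries (verify z k : List (Op n p (Reg ℓ n p))) = 2 * n := by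
  simp only [verify, report, vqueries_append, vqueries_flip, vqueries_loadVec, vqueries_loadRhs,
    vqueries_search, vqueries_conj, vqueries_had, vqueries_ladder]
  ring

lemma queries_verify (z : Fin n) (k : ℕ) :
    queries (verify z k : List (Op n p (Reg ℓ n p))) = 3 ^ k * ((2 ^ ℓ - 1) * (4 * n)) := by
  simp only [verify, report, queries_append, queries_flip, queries_loadVec, queries_loadRhs,
    queries_search, queries_conj, queries_had, queries_ladder]
  ring

/-- Loading is charged to one more unit of overhead on the `4 n` or more queries, whence `37`; the
report and the initial flip are paid from the margin. -/
lemma gates_verify_le (hn : 0 < n) (hp : 0 < width p) (hℓ : 1 ≤ ℓ) (hℓ2 : ℓ ≤ width n + 4)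
    (z : Fin n) (k : ℕ) :
    gates (verify z k : List (Op n p (Reg ℓ n p))) ≤
      37 * overhead n p * queries (verify z k : List (Op n p (Reg ℓ n p))) := by
  have h1 := gates_loadVec (ℓ := ℓ) (n := n) (p := p)
  have h2 := gates_loadRhs (ℓ := ℓ) (n := n) (p := p)
  have h3 := gates_report_le (ℓ := ℓ) (n := n) (p := p)
  have h4 := gates_search_le hn hp hℓ hℓ2 z k
  obtain ⟨h5, h6⟩ := overhead_ge (n := n) hp
  have h7 : 4 * n ≤ 3 ^ k * ((2 ^ ℓ - 1) * (4 * n)) := by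
    have h2 : 2 ≤ 2 ^ ℓ := Nat.le_self_pow (by omega) 2
    rw [← mul_assoc]
    refine Nat.le_mul_of_pos_left _ (Nat.mul_pos (by positivity) (by omega))
  have h8 : overhead n p * (4 * n) ≤ overhead n p * (3 ^ k * ((2 ^ ℓ - 1) * (4 * n))) :=
    Nat.mul_le_mul_left _ h7
  have h9 : n * (2 * width n) + n * (2 * width n) ≤ overhead n p * (4 * n) := by
    calc n * (2 * width n) + n * (2 * width n) = width n * (4 * n) := by ring
      _ ≤ overhead n p * (4 * n) := Nat.mul_le_mul_right _ (by omega)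
  have h10 : 14 * ℓ + 4 ≤ 76 * overhead n p := by omega
  rw [queries_search] at h4
  rw [queries_verify]
  simp only [verify, gates_append, gates_flip]
  linarith

end Resources

/-! ### Choice of the parameters -/

section Parameters

variable {n p : ℕ} {ε : ℝ}

lemma two_pow_width_lt {m : ℕ} (hm : 0 < m) : 2 ^ width m < 2 * m := by
  rcases Nat.lt_or_ge 1 m with h | h
  · have h1 := Nat.pow_pred_clog_lt_self (b := 2) (by norm_num) h
    have h2 : 0 < width m := Nat.clog_pos (by norm_num) h
    calc 2 ^ width m = 2 * 2 ^ (width m).pred := by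
          rw [← pow_succ', Nat.pred_eq_sub_one, Nat.sub_add_cancel h2]
      _ < 2 * m := Nat.mul_lt_mul_of_pos_left h1 (by norm_num)
  · obtain rfl : m = 1 := by omega
    simp

lemma width_mul_log_two_le {m : ℕ} (hm : 0 < m) : width m * Real.log 2 ≤ Real.log (2 * m) := by
  rw [← Real.log_pow]
  refine Real.log_le_log (by positivity) ?_
  exact_mod_cast (two_pow_width_lt hm).le

lemma width_add_one_le (hn : 0 < n) : (width n + 1 : ℝ) ≤ 3 * Real.log (2 * n) := by
  have h1 := width_mul_log_two_le hn
  have h2 : Real.log 2 ≤ Real.log (2 * n) := by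
    refine Real.log_le_log (by norm_num) ?_
    have : (1 : ℝ) ≤ n := by exact_mod_cast hn
    linarith
  have h3 := Real.log_two_gt_d9
  have h4 : (0 : ℝ) ≤ width n := Nat.cast_nonneg _
  nlinarith

lemma width_le (hp : 2 ≤ p) : (width p : ℝ) ≤ 3 * Real.log p := by
  have h0 : (2 : ℝ) ≤ p := by exact_mod_cast hp
  have h1 := width_mul_log_two_le (m := p) (by omega)
  have h2 : Real.log 2 ≤ Real.log p := Real.log_le_log (by norm_num) h0
  rw [Real.log_mul (by norm_num) (by linarith)] at h1
  have h3 := Real.log_two_gt_d9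
  have h4 : (0 : ℝ) ≤ width p := Nat.cast_nonneg _
  nlinarith

lemma overhead_le (hn : 0 < n) (hp : 2 ≤ p) :
    (overhead n p : ℝ) ≤ 81 * (Real.log (2 * n) * Real.log p ^ 3) := by
  have h1 := width_add_one_le hn
  have h2 := width_le hp
  have h3 : (0 : ℝ) ≤ width n + 1 := by positivity
  rw [overhead]
  push_cast
  calc (width n + 1 : ℝ) * width p ^ 3 ≤ 3 * Real.log (2 * n) * (3 * Real.log p) ^ 3 := by
        gcongr
        linarith
    _ = _ := by ring

/-- The number of tests. -/
def tests (n : ℕ) : ℕ := (width n + 1) / 2 + 3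

lemma four_pow_tests (n : ℕ) : 4 ^ tests n = 64 * 2 ^ (2 * ((width n + 1) / 2)) := by
  rw [tests, pow_add, pow_mul]
  norm_num
  ring

lemma le_four_pow_tests (n : ℕ) : 64 * n ≤ 4 ^ tests n := by
  rw [four_pow_tests]
  have h : n ≤ 2 ^ width n := Nat.le_pow_clog (by norm_num) n
  exact Nat.mul_le_mul_left _ (h.trans (Nat.pow_le_pow_right (by norm_num) (by omega)))

/-- Rounding `n` up to a power of two and its exponent up to an even number cost a factor two each,
so `4 ^ tests n ≤ 64 * 4 * n`. -/
lemma two_pow_tests_le (hn : 0 < n) : (2 ^ tests n : ℝ) ≤ 16 * Real.sqrt n := by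
  have h1 : 4 ^ tests n ≤ 256 * n := by
    have h2 : 2 ^ (2 * ((width n + 1) / 2)) ≤ 2 * 2 ^ width n := by
      rw [← pow_succ']
      exact Nat.pow_le_pow_right (by norm_num) (by omega)
    have h3 := two_pow_width_lt hn
    rw [four_pow_tests]
    omega
  refine (pow_le_pow_iff_left₀ (by positivity) (by positivity) two_ne_zero).1 ?_
  rw [mul_pow, Real.sq_sqrt (Nat.cast_nonneg n), ← pow_mul, mul_comm, pow_mul]
  norm_num
  exact_mod_cast h1

/-- For the least such `k > 0`, failure at `k - 1` means `3 ^ (k - 1) * log 2 < log (1 / ε)`, and `3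
/ log 2 < 5`. For `k = 0` the bound holds since `log 2 > 1 / 5`. -/
lemma exists_rounds (h0 : 0 < ε) (h1 : ε < 1) :
    ∃ k : ℕ, (1 / 2 : ℝ) ^ 3 ^ k ≤ ε ∧ (3 ^ k : ℝ) ≤ 5 * Real.log (2 / ε) := by
  have hex : ∃ k : ℕ, (1 / 2 : ℝ) ^ 3 ^ k ≤ ε := by
    obtain ⟨m, hm⟩ := exists_pow_lt_of_lt_one h0 (show (1 / 2 : ℝ) < 1 by norm_num)
    exact ⟨m, (pow_le_pow_of_le_one (by norm_num) (by norm_num)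
      (Nat.lt_pow_self (by norm_num)).le).trans hm.le⟩
  classical
  refine ⟨Nat.find hex, Nat.find_spec hex, ?_⟩
  have h2 := Real.log_two_gt_d9
  have h3 : Real.log (2 / ε) = Real.log 2 - Real.log ε := Real.log_div (by norm_num) h0.ne'
  have h4 : Real.log ε < 0 := Real.log_neg h0 h1
  cases hk : Nat.find hex with
  | zero =>
    rw [h3, pow_zero]
    linarith
  | succ k =>
    have h5 : ε < (1 / 2 : ℝ) ^ 3 ^ k := not_le.1 (Nat.find_min hex (by omega))
    have h6 := Real.log_lt_log h0 h5
    rw [Real.log_pow, one_div, Real.log_inv] at h6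
    push_cast at h6
    have h7 : (0 : ℝ) < 3 ^ k := by positivity
    rw [h3, pow_succ]
    nlinarith

end Parameters

end QMvPV

/-! ### Assembly of the verification algorithm -/

theorem lemma5p1 :
    ∃ (K : ℝ) (c : ℕ), ∀ (n p : ℕ) (ε : ℝ), 1 ≤ n → p.Prime → 0 < ε → ε < 1 →
      ∃ A : QMvPV.QueryAlgorithm n p,
        (∀ (M : Matrix (Fin n) (Fin n) (ZMod p)) (v b : Fin n → ZMod p)
            (UM : QMvPV.Unitary (QMvPV.MatReg n p)) (Uv Ub : QMvPV.Unitary (QMvPV.VecReg n p)),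
          QMvPV.IsMatOracle M UM → QMvPV.IsVecOracle v Uv → QMvPV.IsVecOracle b Ub →
            (M.mulVec v = b → A.acceptProb UM Uv Ub = 1) ∧
            (M.mulVec v ≠ b → 1 - ε ≤ A.rejectProb UM Uv Ub)) ∧
        (A.queriesM : ℝ) ≤ K * ((n : ℝ) ^ (3 / 2 : ℝ) * Real.log (2 / ε)) ∧
        ((A.queriesV + A.queriesB : ℕ) : ℝ) ≤ K * n ∧
        (A.gates : ℝ) ≤ K * (A.queriesM * Real.log (2 * n) * Real.log p ^ c) ∧
        (A.qubits : ℝ) ≤ K * (n * Real.log p) := by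
  -- The gate count dominates: `37 * 81 = 2997`, against `320` for matrix queries, `2` for vector
  -- queries and `60` for qubits. The exponent `3` comes from the phases of triple products.
  refine ⟨3000, 3, fun n p ε hn hp h0 h1 => ?_⟩
  obtain ⟨k, hk1, hk2⟩ := QMvPV.exists_rounds h0 h1
  have hw : 0 < QMvPV.width p := Nat.clog_pos (by norm_num) hp.one_lt
  have : NeZero p := ⟨hp.ne_zero⟩
  have hℓ : 1 ≤ QMvPV.tests n := Nat.le_add_left _ _
  have hℓ2 : QMvPV.tests n ≤ QMvPV.width n + 4 := by
    rw [QMvPV.tests]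
    omega
  refine ⟨QMvPV.compile (QMvPV.verify ⟨0, hn⟩ k) (.out : QMvPV.Reg (QMvPV.tests n) n p),
    ?_, ?_, ?_, ?_, ?_⟩
  · intro M v b UM Uv Ub hM hv hb
    obtain ⟨ha, hr⟩ := QMvPV.verify_prob (ℓ := QMvPV.tests n) ⟨UM, Uv, Ub⟩ hM hv hb ⟨0, hn⟩
      ⟨0, hℓ⟩ k
    refine ⟨fun h => ?_, fun h => ?_⟩
    · rw [ha, QMvPV.clearProb_of_eq hp hn h, one_pow]
    · rw [hr]
      have h2 := pow_le_pow_left₀ (QMvPV.clearProb_nonneg _ M v b)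
        (QMvPV.clearProb_le hp (QMvPV.le_four_pow_tests n) h) (3 ^ k)
      linarith
  · rw [QMvPV.compile_queriesM, QMvPV.queries_verify, Nat.cast_mul, Nat.cast_mul,
      Nat.cast_sub Nat.one_le_two_pow]
    push_cast
    have h2 : (n : ℝ) ^ (3 / 2 : ℝ) = n * Real.sqrt n := by
      rw [Real.sqrt_eq_rpow, ← Real.rpow_one_add' (Nat.cast_nonneg n) (by norm_num)]
      norm_num
    have h3 := QMvPV.two_pow_tests_le hn
    have h4 : (0 : ℝ) ≤ Real.log (2 / ε) :=
      Real.log_nonneg (by rw [le_div_iff₀ h0]; linarith)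
    have h5 : (1 : ℝ) ≤ 2 ^ QMvPV.tests n := one_le_pow₀ (by norm_num)
    -- `3 ^ k` copies of the tests, in which the Grover operators number `1 + 2 + 4 + ⋯ = 2 ^ ℓ -
    -- 1`, at `4 n` queries each.
    calc (3 ^ k : ℝ) * ((2 ^ QMvPV.tests n - 1) * (4 * n))
        ≤ 5 * Real.log (2 / ε) * (16 * Real.sqrt n * (4 * n)) := by
          gcongr
          linarith
      _ = 320 * ((n : ℝ) ^ (3 / 2 : ℝ) * Real.log (2 / ε)) := by rw [h2]; ring
      _ ≤ _ := by gcongr; norm_num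
  · rw [QMvPV.compile_queriesVB, QMvPV.vqueries_verify]
    push_cast
    gcongr
    norm_num
  · rw [QMvPV.compile_gates, QMvPV.compile_queriesM]
    have h2 := QMvPV.gates_verify_le (p := p) hn hw hℓ hℓ2 ⟨0, hn⟩ k
    have h3 := QMvPV.overhead_le hn hp.two_le
    set C : List (QMvPV.Op n p (QMvPV.Reg (QMvPV.tests n) n p)) := QMvPV.verify ⟨0, hn⟩ k
    have h4 : (0 : ℝ) ≤ QMvPV.overhead n p := Nat.cast_nonneg _
    calc (QMvPV.gates C : ℝ) ≤ 37 * QMvPV.overhead n p * QMvPV.queries C := by exact_mod_cast h2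
      _ ≤ 37 * (81 * (Real.log (2 * n) * Real.log p ^ 3)) * QMvPV.queries C := by gcongr
      _ = 2997 * (QMvPV.queries C * Real.log (2 * n) * Real.log p ^ 3) := by ring
      _ ≤ 3000 * (QMvPV.queries C * Real.log (2 * n) * Real.log p ^ 3) := by
          refine mul_le_mul_of_nonneg_right (by norm_num) ?_
          have : 0 ≤ Real.log (2 * n) * Real.log p ^ 3 := by linarith
          rw [mul_assoc]
          positivity
  · have h2 : Fintype.card (QMvPV.Reg (QMvPV.tests n) n p) ≤ 20 * (n * QMvPV.width p) := by
      rw [QMvPV.card_reg]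
      have h3 : QMvPV.width n ≤ n := Nat.clog_le_of_le_pow (Nat.lt_two_pow_self).le
      have h4 : n ≤ n * QMvPV.width p := Nat.le_mul_of_pos_right _ hw
      have h5 : QMvPV.width p ≤ n * QMvPV.width p := Nat.le_mul_of_pos_left _ hn
      rw [QMvPV.tests]
      omega
    have h3 := QMvPV.width_le hp.two_le
    have h4 : (0 : ℝ) ≤ Real.log p := Real.log_natCast_nonneg p
    calc (Fintype.card (QMvPV.Reg (QMvPV.tests n) n p) : ℝ)
        ≤ 20 * (n * QMvPV.width p) := by exact_mod_cast h2
      _ ≤ 20 * (n * (3 * Real.log p)) := by gcongr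
      _ = 60 * (n * Real.log p) := by ring
      _ ≤ 3000 * (n * Real.log p) := by gcongr; norm_num

end
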